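/- Let $\Bbbk$ be $\mathbb R$ or $\mathbb C$, let $M$ be a smooth manifold and $R=C^\infty(M,\Bbbk)$. Let $(L,A)$ be a Lie pair over $M$, i.e. a Lie algebroid $L\to M$ over $\Bbbk$ with anchor $\rho$ together with a Lie subalgebroid $A\subset L$ over $M$. Put $B=L/A$, let $q:L\to B$ be the projection, and let $j:B\to L$ be a splitting ($q\circ j=\mathrm{id}$), with associated projection $p:L\to A$. Let $\nabla$ be an $L$-connection on $B$ which extends the Bott connection, $\nabla_a q(l)=q([a,l])$ for $a\in\Gamma(A)$, $l\in\Gamma(L)$, and is torsion-free, $\nabla_{l_1}q(l_2)-\nabla_{l_2}q(l_1)=q([l_1,l_2])$ for $l_1,l_2\in\Gamma(L)$. Consider the graded commutative algebra $\mathcal C=\Gamma(\Lambda^\bullet L^\vee\otimes\hat S B^\vee)$ of functions on the graded manifold $L[1]\oplus B$. For a local frame $(\partial_k)$ of $B$ with dual frame $(\chi_k)$ let $\delta(\omega\otimes\chi^J)=\sum_m (q^\top\chi_m\wedge\omega)\otimes J_m\chi^{J-e_m}$, and let $d_L^\nabla$ be the covariant Chevalley–Eilenberg operator of the connection induced by $\nabla$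 on $\hat SB^\vee$. Elements of $\Gamma(\Lambda^\bullet L^\vee\otimes\hat SB^\vee\otimes B)$ act on $\mathcal C$ by $(\omega\otimes\sigma\otimes b)\cdot(\omega'\otimes\sigma')=(\omega\wedge\omega')\otimes(\sigma\odot\partial_b\sigma')$, where $\partial_b$ is the derivation of $\hat SB^\vee$ with $\partial_b\chi=\langle\chi,b\rangle$ for $\chi\in B^\vee$. Let $\tilde h=h\otimes\mathrm{id}_B$ on $\Gamma(\Lambda^\bullet L^\vee\otimes\hat SB^\vee\otimes B)$, where for $\omega\in p^\top(\Lambda^uA^\vee)\otimes q^\top(\Lambda^vB^\vee)$ $$h(\omega\otimes\chi^J)=\frac1{v+|J|}\sum_k(\iota_{j(\partial_k)}\omega)\otimes\chi^{J+e_k}\ \text{ if } v\ge1,\qquad h(\omega\otimes\chi^J)=0\ \text{ if } v=0 .$$ Then there is a unique $X^\nabla\in\Gamma(L^\vee\otimes\hat S^{\ge2}B^\vee\otimes B)$ with $\tilde h(X^\nabla)=0$ such that $Q=-\delta+d_L^\nabla+X^\nabla$ satisfies $Q^2=0$ on $\mathcal C$. Consequently $(L[1]\oplus B,Q)$ is a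 dg manifold: $Q$ is a $\Bbbk$-linear derivation of degree $+1$ of $\mathcal C$ with $Q^2=0$. Moreover $X^\nabla=\sum_{k\ge2}X_k$, $X_k\in\Gamma(L^\vee\otimes S^kB^\vee\otimes B)$, is obtained by Fedosov iteration: $$X_2=\tilde h(R^\nabla),\qquad X_{k+1}=\tilde h\Big(d_L^\nabla\circ X_k+X_k\circ d_L^\nabla+\sum_{\substack{p+q=k+1\\2\le p,q\le k-1}}X_p\circ X_q\Big)\quad(k\ge2),$$ where $R^\nabla=d_L^\nabla\circ d_L^\nabla$, viewed as an element of $\Gamma(\Lambda^2L^\vee\otimes B^\vee\otimes B)$ through its action on $\mathcal C$, and likewise the operator in parentheses is the action of an element of $\Gamma(\Lambda^2L^\vee\otimes S^kB^\vee\otimes B)$. -/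

import Mathlib

open scoped Manifold ContDiff Bundle TensorProduct

noncomputable section

namespace Fedosov

/-! ## Forms on `L` with values in formal power series on `B`

Throughout this part `R` is a commutative ring and `𝓛`, `𝓑`, `N` are `R`-modules; they will be
`C^∞(M, 𝕜)`, `Γ(L)`, `Γ(B)` and `R` or `Γ(B)`. A section of `Λᵏ L^∨ ⊗ Sᵖ B^∨ ⊗ V` is the same
thing as an `R`-multilinear map `Γ(L)ᵏ × Γ(B)ᵖ → Γ(V)` which is alternating in the first `k` and
symmetric in the last `p` arguments. The identification is the one given by the duality pairing
`⟨ν₁ ⊙ ⋯ ⊙ ν_p, b₁ ⊙ ⋯ ⊙ b_p⟩ = ∑_σ ∏ ⟨ν_i, b_{σ i}⟩` and the usual determinant pairing on `Λ`. -/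

section Algebra

variable {R 𝓛 𝓑 N : Type*} [CommRing R] [AddCommGroup 𝓛] [Module R 𝓛] [AddCommGroup 𝓑] [Module R 𝓑]
  [AddCommGroup N] [Module R N]

/-- Functions of a finite list of elements of `𝓛` and a finite multiset of elements of `𝓑`. -/
abbrev PreForm (𝓛 𝓑 N : Type*) := List 𝓛 → Multiset 𝓑 → N

/-- `Γ(Λ^• L^∨ ⊗ Ŝ B^∨ ⊗ V)` where `N = Γ(V)`: the families, indexed by all `k` and `p`, of
`R`-multilinear maps `𝓛ᵏ × 𝓑ᵖ → N` alternating in `𝓛` and symmetric in `𝓑`. The value of the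
`(k, p)` member at `(l₁, …, l_k; b₁, …, b_p)` is `F [l₁, …, l_k] {b₁, …, b_p}`; it is symmetric
in the `b`'s because these are collected in a multiset. There is no restriction on `p`, whence
the completion `Ŝ`. -/
def Form (R 𝓛 𝓑 N : Type*) [CommRing R] [AddCommGroup 𝓛] [Module R 𝓛] [AddCommGroup 𝓑] [Module R 𝓑]
    [AddCommGroup N] [Module R N] : Submodule R (PreForm 𝓛 𝓑 N) where
  carrier := {F |
    (∀ (s t : List 𝓛) (a : R) (x y : 𝓛) (m : Multiset 𝓑),
      F (s ++ (a • x + y) :: t) m = a • F (s ++ x :: t) m + F (s ++ y :: t) m) ∧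
    (∀ (s t : List 𝓛) (x : 𝓛) (m : Multiset 𝓑), F (s ++ x :: x :: t) m = 0) ∧
    (∀ (s : List 𝓛) (a : R) (b c : 𝓑) (m : Multiset 𝓑),
      F s ((a • b + c) ::ₘ m) = a • F s (b ::ₘ m) + F s (c ::ₘ m))}
  zero_mem' := by simp
  add_mem' := by
    rintro F G ⟨h1, h2, h3⟩ ⟨g1, g2, g3⟩
    refine ⟨fun s t a x y m => ?_, fun s t x m => ?_, fun s a b c m => ?_⟩
    · simp only [Pi.add_apply, h1, g1]; module
    · simp only [Pi.add_apply, h2, g2, add_zero]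
    · simp only [Pi.add_apply, h3, g3]; module
  smul_mem' := by
    rintro r F ⟨h1, h2, h3⟩
    refine ⟨fun s t a x y m => ?_, fun s t x m => ?_, fun s a b c m => ?_⟩
    · simp only [Pi.smul_apply, h1]; module
    · simp only [Pi.smul_apply, h2, smul_zero]
    · simp only [Pi.smul_apply, h3]; module

/-- The elements of `Γ(Λ^• L^∨ ⊗ Ŝ B^∨ ⊗ V)` all of whose components outside the bidegrees
`(k, p)` with `P k p` vanish. For `P k p = (k = 1 ∧ 2 ≤ p)` this is
`Γ(L^∨ ⊗ Ŝ^{≥ 2} B^∨ ⊗ V)`. -/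
def FormIn (R 𝓛 𝓑 N : Type*) [CommRing R] [AddCommGroup 𝓛] [Module R 𝓛] [AddCommGroup 𝓑]
    [Module R 𝓑] [AddCommGroup N] [Module R N] (P : ℕ → ℕ → Prop) :
    Submodule R (PreForm 𝓛 𝓑 N) where
  carrier := {F | F ∈ Form R 𝓛 𝓑 N ∧ ∀ s m, ¬ P s.length m.card → F s m = 0}
  zero_mem' := ⟨zero_mem _, fun _ _ _ => rfl⟩
  add_mem' := fun hF hG => ⟨add_mem hF.1 hG.1, fun s m h => by
    simp [hF.2 s m h, hG.2 s m h]⟩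
  smul_mem' := fun r _ hF => ⟨Submodule.smul_mem _ r hF.1, fun s m h => by
    simp [hF.2 s m h]⟩

/-- The component in `Γ(Λ^• L^∨ ⊗ S^p B^∨ ⊗ V)`. -/
def symComponent (p : ℕ) (F : PreForm 𝓛 𝓑 N) : PreForm 𝓛 𝓑 N :=
  fun s m => if m.card = p then F s m else 0

/-- All ways of splitting a list into two complementary sublists (shuffles), each with the sign
of the permutation which moves the first sublist in front of the second. -/
def signedSplits : List 𝓛 → List (ℤ × List 𝓛 × List 𝓛)
  | [] => [(1, [], [])]
  | l :: s =>
    (signedSplits s).map (fun c => (c.1, l :: c.2.1, c.2.2)) ++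
      (signedSplits s).map (fun c => ((-1) ^ c.2.1.length * c.1, c.2.1, l :: c.2.2))

/-- The product of the graded commutative algebra `Γ(Λ^• L^∨ ⊗ Ŝ B^∨)`, that is
`(ω ⊗ σ) (ω' ⊗ σ') = (ω ∧ ω') ⊗ (σ ⊙ σ')`: a signed sum over shuffles of the arguments in `𝓛`
and a sum over shuffles of the arguments in `𝓑`. -/
def mul (F G : PreForm 𝓛 𝓑 R) : PreForm 𝓛 𝓑 R := fun s m =>
  ((signedSplits s).map fun c =>
    c.1 • (m.antidiagonal.map fun d => F c.2.1 d.1 * G c.2.2 d.2).sum).sum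

/-- The natural action of `Γ(Λ^• L^∨ ⊗ Ŝ B^∨ ⊗ B)` (forms with values in the formal vertical
vector fields of `B`) on `Γ(Λ^• L^∨ ⊗ Ŝ B^∨)`, that is
`(ω ⊗ σ ⊗ b) · (ω' ⊗ σ') = (ω ∧ ω') ⊗ (σ ⊙ ∂_b σ')`,
where `∂_b` is the derivation of `Ŝ B^∨` with `∂_b χ = ⟨χ, b⟩` for `χ` in `B^∨`; in terms of
symmetric multilinear maps, `∂_b` inserts `b` as one of the arguments. -/
def act (Y : PreForm 𝓛 𝓑 𝓑) (F : PreForm 𝓛 𝓑 R) : PreForm 𝓛 𝓑 R := fun s m =>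
  ((signedSplits s).map fun c =>
    c.1 • (m.antidiagonal.map fun d => F c.2.2 (Y c.2.1 d.1 ::ₘ d.2)).sum).sum

/-- The operator `δ (ω ⊗ χ^J) = ∑_m (q^⊤ χ_m ∧ ω) ⊗ J_m χ^{J - e_m}`, that is
`(δ F)(l₀, …, l_k; b's) = ∑_i (-1)^i F(l₀, …, l̂_i, …, l_k; q l_i, b's)`. -/
def delta (q : 𝓛 → 𝓑) (F : PreForm 𝓛 𝓑 R) : PreForm 𝓛 𝓑 R := fun s m =>
  ∑ i : Fin s.length, (-1 : ℤ) ^ (i : ℕ) • F (s.eraseIdx i) (q s[i] ::ₘ m)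

open Classical in
/-- The covariant derivative on `Γ(Ŝ B^∨)` induced by `∇` on `Γ(B)`:
`(∇_l f)(b₁, …, b_p) = ρ(l)(f(b₁, …, b_p)) - ∑_i f(b₁, …, ∇_l b_i, …, b_p)`. -/
def covDeriv (ρ : 𝓛 → R → R) (nab : 𝓛 → 𝓑 → 𝓑) (l : 𝓛) (f : Multiset 𝓑 → R) : Multiset 𝓑 → R :=
  fun m => ρ l (f m) - (m.map fun b => f (nab l b ::ₘ m.erase b)).sum

/-- The covariant Chevalley–Eilenberg differential `d_L^∇` on `Γ(Λ^• L^∨ ⊗ Ŝ B^∨)`: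
`(d F)(l₀, …, l_k) = ∑_i (-1)^i ∇_{l_i} (F(…, l̂_i, …))
  + ∑_{i < j} (-1)^{i + j} F([l_i, l_j], …, l̂_i, …, l̂_j, …)`. -/
def dCE (ρ : 𝓛 → R → R) (br : 𝓛 → 𝓛 → 𝓛) (nab : 𝓛 → 𝓑 → 𝓑) (F : PreForm 𝓛 𝓑 R) :
    PreForm 𝓛 𝓑 R := fun s m =>
  (∑ i : Fin s.length, (-1 : ℤ) ^ (i : ℕ) • covDeriv ρ nab s[i] (F (s.eraseIdx i)) m) +
    ∑ k : Fin s.length, ∑ i ∈ Finset.Iio k, (-1 : ℤ) ^ ((i : ℕ) + (k : ℕ)) •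
      F (br s[i] s[k] :: (s.eraseIdx k).eraseIdx i) m

/-- The component of `F` in `p^⊤(Λ^• A^∨) ⊗ q^⊤(Λ^v B^∨) ⊗ Ŝ B^∨ ⊗ V` for the decomposition of
`Λ^• L^∨` given by the splitting `id = i ∘ p + j ∘ q` of `L`: the sum, over all sets of `v`
arguments, of `F` evaluated with these arguments projected to `j(B)` and all others to `A`. -/
def bComponent (q : 𝓛 → 𝓑) (j : 𝓑 → 𝓛) (v : ℕ) (F : PreForm 𝓛 𝓑 N) : PreForm 𝓛 𝓑 N := fun s m =>
  ∑ S ∈ Finset.powersetCard v (Finset.range s.length),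
    F (s.mapIdx fun i l => if i ∈ S then j (q l) else l - j (q l)) m

open Classical in
/-- The homotopy operator (`ι : K → R` includes the constants): for `ω ∈ p^⊤(Λ^u A^∨) ⊗ q^⊤(Λ^v B^∨)`,
`h (ω ⊗ χ^J) = (v + |J|)⁻¹ ∑_k (ι_{j ∂_k} ω) ⊗ χ^{J + e_k}` if `v ≥ 1`, and `0` if `v = 0`; it
acts as the identity on the coefficients `V` (so for `N = Γ(B)` it is the operator `h̃`). In
terms of multilinear maps, `∑_k (ι_{j ∂_k} ω) ⊗ χ^{J + e_k}` sends `(l's; b₀, …, b_p)` to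
`∑_i (ω ⊗ χ^J)(j b_i, l's; b₀, …, b̂_i, …, b_p)`. -/
def homotopy {K : Type*} [Field K] (ι : K →+* R) (q : 𝓛 → 𝓑) (j : 𝓑 → 𝓛) (F : PreForm 𝓛 𝓑 N) :
    PreForm 𝓛 𝓑 N := fun s m =>
  ∑ v ∈ Finset.Icc 1 (s.length + 1),
    (m.map fun b => ι (((v + (m.erase b).card : ℕ) : K)⁻¹) •
      bComponent q j v F (j b :: s) (m.erase b)).sum

/-- A homological vector field on the graded manifold `L[1] ⊕ B`: a derivation of degree
`+1` of the graded algebra of functions `Γ(Λ^• L^∨ ⊗ Ŝ B^∨)`, linear over the field of constants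
`ι : K → R`, of square zero. -/
structure IsHomologicalVectorField {K : Type*} [Field K] (ι : K →+* R)
    (Q : PreForm 𝓛 𝓑 R → PreForm 𝓛 𝓑 R) : Prop where
  mapsTo : ∀ F ∈ Form R 𝓛 𝓑 R, Q F ∈ Form R 𝓛 𝓑 R
  map_add : ∀ F ∈ Form R 𝓛 𝓑 R, ∀ G ∈ Form R 𝓛 𝓑 R, Q (F + G) = Q F + Q G
  map_smul : ∀ (c : K), ∀ F ∈ Form R 𝓛 𝓑 R, Q (ι c • F) = ι c • Q F
  degree : ∀ k, ∀ F ∈ FormIn R 𝓛 𝓑 R (fun k' _ => k' = k),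
    Q F ∈ FormIn R 𝓛 𝓑 R (fun k' _ => k' = k + 1)
  leibniz : ∀ k, ∀ F ∈ FormIn R 𝓛 𝓑 R (fun k' _ => k' = k), ∀ G ∈ Form R 𝓛 𝓑 R,
    Q (mul F G) = mul (Q F) G + (-1 : ℤ) ^ k • mul F (Q G)
  sq_zero : ∀ F ∈ Form R 𝓛 𝓑 R, Q (Q F) = 0

/-- The derivation `Y ∈ Γ(Λ^• L^∨ ⊗ Ŝ B^∨ ⊗ B)` of `Γ(Λ^• L^∨ ⊗ Ŝ B^∨)` is the operator `T`. -/
def ActsAs (R : Type*) [CommRing R] [Module R 𝓛] [Module R 𝓑] (Y : PreForm 𝓛 𝓑 𝓑)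
    (T : PreForm 𝓛 𝓑 R → PreForm 𝓛 𝓑 R) : Prop :=
  ∀ F ∈ Form R 𝓛 𝓑 R, act Y F = T F

/-- `X` is produced by the Fedosov iteration from the differential `d = d_L^∇` and the homotopy
`h̃`: its components `X_k ∈ Γ(L^∨ ⊗ S^k B^∨ ⊗ B)` satisfy `X₂ = h̃(R)`, where the curvature
`R ∈ Γ(Λ² L^∨ ⊗ B^∨ ⊗ B)` is the derivation `d ∘ d`, and for `k ≥ 2`
`X_{k+1} = h̃(d ∘ X_k + X_k ∘ d + ∑_{p + q = k + 1, 2 ≤ p, q ≤ k - 1} X_p ∘ X_q)`,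
where the argument of `h̃` is a derivation that belongs to `Γ(Λ² L^∨ ⊗ S^k B^∨ ⊗ B)`. -/
structure IsFedosovIteration (d : PreForm 𝓛 𝓑 R → PreForm 𝓛 𝓑 R)
    (hTilde : PreForm 𝓛 𝓑 𝓑 → PreForm 𝓛 𝓑 𝓑) (X : PreForm 𝓛 𝓑 𝓑) : Prop where
  sum_from_two : X ∈ FormIn R 𝓛 𝓑 𝓑 (fun k p => k = 1 ∧ 2 ≤ p)
  initial : ∃ Y ∈ FormIn R 𝓛 𝓑 𝓑 (fun k p => k = 2 ∧ p = 1),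
    ActsAs R Y (fun F => d (d F)) ∧ symComponent 2 X = hTilde Y
  step : ∀ n, 2 ≤ n → ∃ Y ∈ FormIn R 𝓛 𝓑 𝓑 (fun k p => k = 2 ∧ p = n),
    ActsAs R Y (fun F => d (act (symComponent n X) F) + act (symComponent n X) (d F) +
      ∑ p ∈ Finset.Icc 2 (n - 1),
        act (symComponent p X) (act (symComponent (n + 1 - p) X) F)) ∧
    symComponent (n + 1) X = hTilde Y

end Algebra

/-! ## Lie algebroids and Lie pairs -/

section Geometry

/-- Multiplication and addition of `𝕜 = ℝ` or `ℂ` are smooth over `ℝ`. -/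
instance contMDiffRing_rclike (𝕜 : Type*) [RCLike 𝕜] : ContMDiffRing 𝓘(ℝ, 𝕜) ∞ 𝕜 where
  contMDiff_add := by
    rw [contMDiff_iff]
    refine ⟨continuous_add, fun x y => ?_⟩
    simp only [mfld_simps, chartAt_self_eq]
    rw [contDiffOn_univ]
    exact contDiff_add
  contMDiff_mul := by
    rw [contMDiff_iff]
    refine ⟨continuous_mul, fun x y => ?_⟩
    simp only [mfld_simps, chartAt_self_eq]
    rw [contDiffOn_univ]
    exact contDiff_mul

/-- `R = C^∞(M, 𝕜)`, for a real manifold `M` modelled on `E`. -/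
abbrev Fn (𝕜 E M : Type*) [RCLike 𝕜] [NormedAddCommGroup E] [NormedSpace ℝ E] [TopologicalSpace M]
    [ChartedSpace E M] := C^∞⟮𝓘(ℝ, E), M; 𝓘(ℝ, 𝕜), 𝕜⟯

/-- `Γ(L)`, the smooth sections of a bundle `L → M` with typical fibre `F`. -/
abbrev Sec (E F : Type*) {M : Type*} [NormedAddCommGroup E] [NormedSpace ℝ E] [TopologicalSpace M]
    [ChartedSpace E M] [NormedAddCommGroup F] [NormedSpace ℝ F] (L : M → Type*)
    [TopologicalSpace (Bundle.TotalSpace F L)] [∀ x, TopologicalSpace (L x)] [FiberBundle F L] :=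
  ContMDiffSection 𝓘(ℝ, E) F ∞ L

variable {𝕜 : Type*} [RCLike 𝕜]
  {E : Type*} [NormedAddCommGroup E] [NormedSpace ℝ E]
  {M : Type*} [TopologicalSpace M] [ChartedSpace E M]
  {F : Type*} [NormedAddCommGroup F] [NormedSpace ℝ F] [NormedSpace 𝕜 F] [IsScalarTower ℝ 𝕜 F]
  {L : M → Type*} [TopologicalSpace (Bundle.TotalSpace F L)] [∀ x, TopologicalSpace (L x)]
  [∀ x, AddCommGroup (L x)] [∀ x, Module 𝕜 (L x)] [FiberBundle F L] [VectorBundle 𝕜 F L]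

/-- The product of a smooth `𝕜`-valued function and a smooth section, `(f • s)(x) = f(x) s(x)`. -/
instance : SMul (Fn 𝕜 E M) (Sec E F L) where
  smul f s := ⟨fun x => f x • s x, by
    intro x₀
    rw [Bundle.contMDiffAt_section]
    have hs := (Bundle.contMDiffAt_section x₀).1 (s.contMDiff x₀)
    set e := trivializationAt F L x₀
    have hf : ContMDiffAt 𝓘(ℝ, E) 𝓘(ℝ, 𝕜) ∞ f x₀ := f.contMDiff x₀
    have key : ContMDiffAt 𝓘(ℝ, E) 𝓘(ℝ, F) ∞ (fun x => f x • (e ⟨x, s x⟩).2) x₀ :=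
      (contDiff_smul (𝕜 := ℝ) (𝕜' := 𝕜) (F := F) (n := ∞)).contMDiff.contMDiffAt.comp x₀
        (hf.prodMk_space hs)
    refine key.congr_of_eventuallyEq ?_
    filter_upwards [e.open_baseSet.mem_nhds (FiberBundle.mem_baseSet_trivializationAt F L x₀)]
      with x hx
    exact (e.linear 𝕜 hx).2 _ _⟩

theorem Sec.fn_smul_apply (f : Fn 𝕜 E M) (s : Sec E F L) (x : M) : (f • s) x = f x • s x := rfl

variable [∀ x, Module ℝ (L x)] [VectorBundle ℝ F L]

/-- `Γ(L)` is a module over `C^∞(M, 𝕜)`. -/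
instance : Module (Fn 𝕜 E M) (Sec E F L) where
  one_smul s := by ext x; simp [Sec.fn_smul_apply]
  mul_smul f g s := by ext x; simp [Sec.fn_smul_apply, mul_smul]
  smul_zero f := by ext x; simp [Sec.fn_smul_apply]
  smul_add f s t := by ext x; simp [Sec.fn_smul_apply]
  add_smul f g s := by ext x; simp [Sec.fn_smul_apply, add_smul]
  zero_smul s := by ext x; simp [Sec.fn_smul_apply]

variable (𝕜 E M) in
/-- The inclusion `𝕜 → C^∞(M, 𝕜)` of the constant functions. -/
def constFn : 𝕜 →+* Fn 𝕜 E M where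
  toFun c := ContMDiffMap.const c
  map_one' := rfl
  map_mul' _ _ := rfl
  map_zero' := rfl
  map_add' _ _ := rfl

/-- The derivative `v f ∈ 𝕜` of `f : M → 𝕜` along a vector `v ∈ T_x M ⊗_ℝ 𝕜`. -/
def dirDeriv (f : M → 𝕜) (x : M) : 𝕜 ⊗[ℝ] TangentSpace 𝓘(ℝ, E) x →ₗ[𝕜] 𝕜 :=
  LinearMap.liftBaseChange 𝕜
    (show TangentSpace 𝓘(ℝ, E) x →L[ℝ] 𝕜 from mfderiv 𝓘(ℝ, E) 𝓘(ℝ, 𝕜) f x).toLinearMap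

variable (𝕜 E F L) in
/-- A structure of Lie algebroid over `𝕜` on the `𝕜`-vector bundle `L → M`. The anchor is a bundle
map `ρ : L → TM ⊗_ℝ 𝕜`; it is smooth if and only if `ρ(s) f` is a smooth function for each smooth
section `s` and each smooth function `f`. -/
structure LieAlgebroid where
  /-- the anchor, fibre by fibre -/
  anchor : ∀ x, L x →ₗ[𝕜] 𝕜 ⊗[ℝ] TangentSpace 𝓘(ℝ, E) x
  anchor_smooth : ∀ (s : Sec E F L) (f : Fn 𝕜 E M),
    ContMDiff 𝓘(ℝ, E) 𝓘(ℝ, 𝕜) ∞ (fun x => dirDeriv f x (anchor x (s x)))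
  /-- the Lie bracket of sections -/
  bracket : Sec E F L → Sec E F L → Sec E F L
  bracket_add : ∀ X Y Z, bracket X (Y + Z) = bracket X Y + bracket X Z
  bracket_self : ∀ X, bracket X X = 0
  add_bracket : ∀ X Y Z, bracket (X + Y) Z = bracket X Z + bracket Y Z
  jacobi : ∀ X Y Z, bracket X (bracket Y Z) = bracket (bracket X Y) Z + bracket Y (bracket X Z)
  leibniz : ∀ (X Y : Sec E F L) (f : Fn 𝕜 E M) (x : M), bracket X (f • Y) x =
    f x • bracket X Y x + dirDeriv f x (anchor x (X x)) • Y x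
  anchor_bracket : ∀ (X Y : Sec E F L) (f : Fn 𝕜 E M) (x : M),
    dirDeriv f x (anchor x (bracket X Y x)) =
      dirDeriv (fun y => dirDeriv f y (anchor y (Y y))) x (anchor x (X x)) -
        dirDeriv (fun y => dirDeriv f y (anchor y (X y))) x (anchor x (Y x))

/-- The function `ρ(s) f`. -/
def LieAlgebroid.rho (LA : LieAlgebroid 𝕜 E F L) (s : Sec E F L) (f : Fn 𝕜 E M) : Fn 𝕜 E M :=
  ⟨fun x => dirDeriv f x (LA.anchor x (s x)), LA.anchor_smooth s f⟩

/-- A Lie subalgebroid `A` of `L`, so that `(L, A)` is a Lie pair: a smooth vector subbundle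
(a family of subspaces with smooth local frames) whose sections are closed under the bracket. -/
structure LieSubalgebroid (LA : LieAlgebroid 𝕜 E F L) where
  /-- the fibres of `A` -/
  fiber : ∀ x, Submodule 𝕜 (L x)
  localFrame : ∀ x₀ : M, ∃ U ∈ nhds x₀, ∃ (n : ℕ) (e : Fin n → Sec E F L), ∀ x ∈ U,
    LinearIndependent 𝕜 (fun i => e i x) ∧ Submodule.span 𝕜 (Set.range fun i => e i x) = fiber x
  bracket_mem : ∀ s t : Sec E F L, (∀ x, s x ∈ fiber x) → (∀ x, t x ∈ fiber x) →
    ∀ x, LA.bracket s t x ∈ fiber x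

variable {LA : LieAlgebroid 𝕜 E F L}

/-- `Γ(A)` as a submodule of `Γ(L)`. -/
def LieSubalgebroid.sections (A : LieSubalgebroid LA) : Submodule (Fn 𝕜 E M) (Sec E F L) where
  carrier := {s | ∀ x, s x ∈ A.fiber x}
  zero_mem' x := (A.fiber x).zero_mem
  add_mem' hs ht x := (A.fiber x).add_mem (hs x) (ht x)
  smul_mem' f _ hs x := (A.fiber x).smul_mem (f x) (hs x)

/-- `Γ(B)` for the quotient bundle `B = L/A`, which is `Γ(L)/Γ(A)`. -/
abbrev LieSubalgebroid.QuotSec (A : LieSubalgebroid LA) := Sec E F L ⧸ A.sections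

/-- The projection `q : Γ(L) → Γ(L/A)`. -/
abbrev LieSubalgebroid.q (A : LieSubalgebroid LA) : Sec E F L →ₗ[Fn 𝕜 E M] A.QuotSec :=
  A.sections.mkQ

/-- An `L`-connection on `B = L/A`, as a covariant derivative `Γ(L) × Γ(B) → Γ(B)`. -/
structure QuotConnection (A : LieSubalgebroid LA) where
  /-- the covariant derivative -/
  cov : Sec E F L → A.QuotSec → A.QuotSec
  add_cov : ∀ l l' b, cov (l + l') b = cov l b + cov l' b
  cov_add : ∀ l b b', cov l (b + b') = cov l b + cov l b'
  smul_cov : ∀ (f : Fn 𝕜 E M) l b, cov (f • l) b = f • cov l b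
  leibniz : ∀ (f : Fn 𝕜 E M) l b, cov l (f • b) = LA.rho l f • b + f • cov l b

variable {A : LieSubalgebroid LA}

/-- `∇` extends the Bott `A`-connection: `∇_a q(l) = q([a, l])` for `a ∈ Γ(A)`, `l ∈ Γ(L)`. -/
def QuotConnection.ExtendsBott (nab : QuotConnection A) : Prop :=
  ∀ a ∈ A.sections, ∀ l, nab.cov a (A.q l) = A.q (LA.bracket a l)

/-- `∇` is torsion-free: `T(l₁, l₂) = ∇_{l₁} q(l₂) - ∇_{l₂} q(l₁) - q([l₁, l₂])` vanishes (and so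
does the map `Λ²(L/A) → L/A` through which it factors). -/
def QuotConnection.IsTorsionFree (nab : QuotConnection A) : Prop :=
  ∀ l₁ l₂, nab.cov l₁ (A.q l₂) - nab.cov l₂ (A.q l₁) - A.q (LA.bracket l₁ l₂) = 0

/-- The differential `d_L^∇` on `Γ(Λ^• L^∨ ⊗ Ŝ B^∨)`. -/
def QuotConnection.d (nab : QuotConnection A) (F' : PreForm (Sec E F L) A.QuotSec (Fn 𝕜 E M)) :
    PreForm (Sec E F L) A.QuotSec (Fn 𝕜 E M) :=
  dCE LA.rho LA.bracket nab.cov F'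

/-- The operator `Q = - δ + d_L^∇ + X` on `Γ(Λ^• L^∨ ⊗ Ŝ B^∨)`. -/
def QuotConnection.Q (nab : QuotConnection A) (X : PreForm (Sec E F L) A.QuotSec A.QuotSec)
    (F' : PreForm (Sec E F L) A.QuotSec (Fn 𝕜 E M)) :
    PreForm (Sec E F L) A.QuotSec (Fn 𝕜 E M) :=
  - delta A.q F' + nab.d F' + act X F'

/-- The operator `h̃` on `Γ(Λ^• L^∨ ⊗ Ŝ B^∨ ⊗ B)` given by a splitting `j : L/A → L`. -/
def hTilde (j : A.QuotSec →ₗ[Fn 𝕜 E M] Sec E F L)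
    (X : PreForm (Sec E F L) A.QuotSec A.QuotSec) : PreForm (Sec E F L) A.QuotSec A.QuotSec :=
  homotopy (constFn 𝕜 E M) A.q j X

end Geometry

end Fedosov

end

/-! Every operator involved is of Cartan type. A form is a function of lists in `𝓛` whose values are
symmetric functions on `𝓑`. For operators `A l` on the values, `ce` is defined by Cartan's formula
`ι_l d = L_l - d ι_l`, so identities are proved by contracting with one argument at a time; the
symmetric arguments are treated in the same way with `insB`. The action of a one-form obeys a
recursion of the same shape (`ce_add_vert`), and `δ` is the action of the one-form `qHat`, whose
values are constant vector fields. Hence `Q` is the differential of one connection `∇ + Z` with `Z =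
X - q`, and it is a graded derivation because each operator of this connection is a derivation.

The square of such a differential is the action of its curvature (`ce_ce`, `sq_eq`), here `mc Z = R
+ dZ + Z·Z`. Torsion-freeness means `dq = 0`, and `Z·q = 0` because `q` has constant coefficients,
so `mc (X - q) = mc X - δX`. As linear functionals separate the sections of `B`, `Q² = 0` is
equivalent to `δX = mc X`.

The homotopy `h` contracts `δ`: if `hX = 0`, then `hδX = X` (`homotopy_actN_qHat`), so every
solution satisfies `X = h(mc X)`. If two one-forms agree up to some symmetric degree, so do their
images under `mc`, and `h` gains one degree; therefore the fixed point exists and is unique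
(`exists_fixed`, `eq_of_fixed`). Conversely, a fixed point has `hX = 0` since `h² = 0` on two-forms,
and its defect `mc X - δX` is killed by `h`. The Bianchi identity `Q ∘ Q² = Q² ∘ Q` makes the lowest
part of the defect `δ`-closed, and a two-form which is closed and killed by `h` vanishes
(`eq_zero_of_closed`); so the defect vanishes degree by degree (`mc_of_fixed`). The recursion for
the `X_k` is the fixed point equation split by symmetric degree. -/

noncomputable section

namespace Fedosov

set_option linter.unusedSectionVars false

/-! ## Operators on symmetric functions -/

section Symmetric

variable {R 𝓛 𝓑 N : Type*} [CommRing R] [AddCommGroup 𝓑] [Module R 𝓑] [AddCommGroup N] [Module R N]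

variable (R 𝓑 N) in
/-- The `R`-multilinear functions among the functions of a finite multiset in `𝓑`. -/
def SymLin : Submodule R (Multiset 𝓑 → N) where
  carrier := {f | ∀ (a : R) (b c : 𝓑) (m : Multiset 𝓑),
    f ((a • b + c) ::ₘ m) = a • f (b ::ₘ m) + f (c ::ₘ m)}
  zero_mem' := by simp
  add_mem' := by
    intro f g hf hg a b c m
    simp only [Pi.add_apply, hf a b c m, hg a b c m]; module
  smul_mem' := by
    intro r f hf a b c m
    simp only [Pi.smul_apply, hf a b c m]; module

theorem SymLin.add {f : Multiset 𝓑 → N} (hf : f ∈ SymLin R 𝓑 N) (b c : 𝓑) (m : Multiset 𝓑) :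
    f ((b + c) ::ₘ m) = f (b ::ₘ m) + f (c ::ₘ m) := by
  simpa using hf 1 b c m

theorem SymLin.zero {f : Multiset 𝓑 → N} (hf : f ∈ SymLin R 𝓑 N) (m : Multiset 𝓑) :
    f (0 ::ₘ m) = 0 := by
  simpa using SymLin.add hf 0 0 m

theorem SymLin.smul {f : Multiset 𝓑 → N} (hf : f ∈ SymLin R 𝓑 N) (a : R) (b : 𝓑)
    (m : Multiset 𝓑) : f ((a • b) ::ₘ m) = a • f (b ::ₘ m) := by
  simpa [SymLin.zero hf] using hf a b 0 m

theorem SymLin.neg {f : Multiset 𝓑 → N} (hf : f ∈ SymLin R 𝓑 N) (b : 𝓑)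
    (m : Multiset 𝓑) : f ((-b) ::ₘ m) = - f (b ::ₘ m) := by
  simpa using SymLin.smul hf (-1) b m

theorem SymLin.sub {f : Multiset 𝓑 → N} (hf : f ∈ SymLin R 𝓑 N) (b c : 𝓑) (m : Multiset 𝓑) :
    f ((b - c) ::ₘ m) = f (b ::ₘ m) - f (c ::ₘ m) := by
  rw [sub_eq_add_neg, SymLin.add hf, SymLin.neg hf, sub_eq_add_neg]

/-- Insertion of an argument. -/
def insB (b : 𝓑) (f : Multiset 𝓑 → N) : Multiset 𝓑 → N := fun m => f (b ::ₘ m)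

theorem insB_apply (b : 𝓑) (f : Multiset 𝓑 → N) (m : Multiset 𝓑) : insB b f m = f (b ::ₘ m) := rfl

theorem insB_comm (b c : 𝓑) (f : Multiset 𝓑 → N) : insB b (insB c f) = insB c (insB b f) := by
  funext m; simp only [insB_apply, Multiset.cons_swap]

theorem insB_lin {f : Multiset 𝓑 → N} (hf : f ∈ SymLin R 𝓑 N) (a : R) (b c : 𝓑) :
    insB (a • b + c) f = a • insB b f + insB c f := funext fun m => hf a b c m

theorem SymLin.insB {f : Multiset 𝓑 → N} (hf : f ∈ SymLin R 𝓑 N) (b : 𝓑) :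
    insB b f ∈ SymLin R 𝓑 N := by
  intro a c d m
  simp only [insB_apply, Multiset.cons_swap b, hf a c d]

theorem symLin_of_insB {f : Multiset 𝓑 → N}
    (h : ∀ (a : R) (b c : 𝓑), Fedosov.insB (a • b + c) f = a • Fedosov.insB b f + Fedosov.insB c f) :
    f ∈ SymLin R 𝓑 N := fun a b c m => congrFun (h a b c) m

open Classical in
/-- The sum over all ways to single out one element of a multiset. -/
def sumErase (G : 𝓑 → Multiset 𝓑 → N) (m : Multiset 𝓑) : N :=
  (m.map fun b => G b (m.erase b)).sum

@[simp] theorem sumErase_zero (G : 𝓑 → Multiset 𝓑 → N) : sumErase G 0 = 0 := by simp [sumErase]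

theorem sumErase_cons (G : 𝓑 → Multiset 𝓑 → N) (b : 𝓑) (m : Multiset 𝓑) :
    sumErase G (b ::ₘ m) = G b m + sumErase (fun c t => G c (b ::ₘ t)) m := by
  classical
  simp only [sumErase, Multiset.map_cons, Multiset.erase_cons_head, Multiset.sum_cons]
  congr 2
  refine Multiset.map_congr rfl fun c hc => ?_
  rw [Multiset.erase_cons_tail_of_mem hc]

theorem sumErase_congr {G H : 𝓑 → Multiset 𝓑 → N} {m : Multiset 𝓑}
    (h : ∀ b t, b ::ₘ t = m → G b t = H b t) : sumErase G m = sumErase H m := by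
  classical
  unfold sumErase
  congr 1
  exact Multiset.map_congr rfl fun b hb => h b _ (Multiset.cons_erase hb)

theorem sumErase_add (G H : 𝓑 → Multiset 𝓑 → N) (m : Multiset 𝓑) :
    sumErase (fun b t => G b t + H b t) m = sumErase G m + sumErase H m := by
  simp [sumErase, Multiset.sum_map_add]

theorem sumErase_neg (G : 𝓑 → Multiset 𝓑 → N) (m : Multiset 𝓑) :
    sumErase (fun b t => - G b t) m = - sumErase G m := by
  simp [sumErase]

theorem sumErase_smul (a : R) (G : 𝓑 → Multiset 𝓑 → N) (m : Multiset 𝓑) :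
    sumErase (fun b t => a • G b t) m = a • sumErase G m := by
  simp [sumErase, Multiset.smul_sum]

theorem sumErase_add_fun (G H : 𝓑 → Multiset 𝓑 → N) :
    sumErase (fun b => G b + H b) = sumErase G + sumErase H :=
  funext fun m => sumErase_add G H m

theorem sumErase_smul_fun (a : R) (G : 𝓑 → Multiset 𝓑 → N) :
    sumErase (fun b => a • G b) = a • sumErase G :=
  funext fun m => sumErase_smul a G m

/-- Each of the `m.card` summands puts the removed element back. This is Euler's relation, the
source of the integers that the weights of the homotopy operator invert. -/
theorem sumErase_const (f : Multiset 𝓑 → N) (m : Multiset 𝓑) :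
    sumErase (fun b t => f (b ::ₘ t)) m = m.card • f m := by
  classical
  unfold sumErase
  rw [Multiset.map_congr (g := fun _ => f m) rfl fun b hb => by simp only [Multiset.cons_erase hb]]
  simp

theorem sumErase_symLin {G : 𝓑 → Multiset 𝓑 → N} (h1 : ∀ b, G b ∈ SymLin R 𝓑 N)
    (h2 : ∀ (a : R) b c m, G (a • b + c) m = a • G b m + G c m) : sumErase G ∈ SymLin R 𝓑 N := by
  intro a b c m
  simp only [sumErase_cons, h2, h1 _ a b c, sumErase_add, sumErase_smul]
  module

theorem sumErase_comm (G : 𝓑 → 𝓑 → Multiset 𝓑 → N) (m : Multiset 𝓑) :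
    sumErase (fun b => sumErase fun c => G b c) m = sumErase (fun b => sumErase fun c => G c b) m := by
  induction m using Multiset.induction generalizing G with
  | empty => simp
  | cons b m ih =>
    simp only [sumErase_cons, sumErase_add]
    rw [ih fun x y t => G x y (b ::ₘ t)]
    abel

/-- The covariant derivative on symmetric functions with values in `N`, for operators `D` on `N`
and `nab` on the arguments. -/
def cov (D : N →+ N) (nab : 𝓑 → 𝓑) : (Multiset 𝓑 → N) →+ (Multiset 𝓑 → N) where
  toFun f := fun m => D (f m) - sumErase (fun b t => f (nab b ::ₘ t)) m
  map_zero' := by funext m; simp [sumErase]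
  map_add' f g := by funext m; simp only [Pi.add_apply, map_add, sumErase_add]; abel

theorem cov_apply (D : N →+ N) (nab : 𝓑 → 𝓑) (f : Multiset 𝓑 → N) (m : Multiset 𝓑) :
    cov D nab f m = D (f m) - sumErase (fun b t => f (nab b ::ₘ t)) m := rfl

theorem cov_zero (D : N →+ N) (nab : 𝓑 → 𝓑) (f : Multiset 𝓑 → N) :
    cov D nab f 0 = D (f 0) := by simp [cov_apply]

/-- The commutation rules of `insB` with `cov` and, in `insB_vert`, with `vert` drive all inductions
over the symmetric arguments: an identity at `b ::ₘ m` becomes identities at `m` for contracted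
data. -/
theorem insB_cov (D : N →+ N) (nab : 𝓑 → 𝓑) (b : 𝓑) (f : Multiset 𝓑 → N) :
    insB b (cov D nab f) = cov D nab (insB b f) - insB (nab b) f := by
  funext m
  simp only [insB_apply, cov_apply, Pi.sub_apply, sumErase_cons, Multiset.cons_swap b]
  abel

theorem cov_cons (D : N →+ N) (nab : 𝓑 → 𝓑) (b : 𝓑) (f : Multiset 𝓑 → N) (m : Multiset 𝓑) :
    cov D nab f (b ::ₘ m) = cov D nab (insB b f) m - f (nab b ::ₘ m) :=
  congrFun (insB_cov D nab b f) m

/-- The formal vertical vector field `y` as a derivation of symmetric functions. -/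
def vert (y : Multiset 𝓑 → 𝓑) : (Multiset 𝓑 → N) →+ (Multiset 𝓑 → N) where
  toFun f := fun m => (m.antidiagonal.map fun d => f (y d.1 ::ₘ d.2)).sum
  map_zero' := by funext m; simp
  map_add' f g := by funext m; simp [Multiset.sum_map_add]

theorem vert_apply (y : Multiset 𝓑 → 𝓑) (f : Multiset 𝓑 → N) (m : Multiset 𝓑) :
    vert y f m = (m.antidiagonal.map fun d => f (y d.1 ::ₘ d.2)).sum := rfl

theorem vert_empty (y : Multiset 𝓑 → 𝓑) (f : Multiset 𝓑 → N) : vert y f 0 = f (y 0 ::ₘ 0) := by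
  simp [vert_apply]

theorem insB_vert (y : Multiset 𝓑 → 𝓑) (b : 𝓑) (f : Multiset 𝓑 → N) :
    insB b (vert y f) = vert (insB b y) f + vert y (insB b f) := by
  funext m
  simp only [insB_apply, vert_apply, Pi.add_apply, Multiset.antidiagonal_cons, Multiset.map_add,
    Multiset.sum_add, Multiset.map_map, Function.comp_def, Prod.map, id, Multiset.cons_swap b]
  rw [add_comm]

theorem vert_cons (y : Multiset 𝓑 → 𝓑) (b : 𝓑) (f : Multiset 𝓑 → N) (m : Multiset 𝓑) :
    vert y f (b ::ₘ m) = vert (insB b y) f m + vert y (insB b f) m :=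
  congrFun (insB_vert y b f) m

theorem vert_smul (y : Multiset 𝓑 → 𝓑) (a : R) (f : Multiset 𝓑 → N) :
    vert y (a • f) = a • vert y f := by
  funext m; simp [vert_apply, Multiset.smul_sum]

theorem vert_lin {f : Multiset 𝓑 → N} (hf : f ∈ SymLin R 𝓑 N) (a : R) (y z : Multiset 𝓑 → 𝓑) :
    vert (a • y + z) f = a • vert y f + vert z f := by
  funext m
  simp [vert_apply, hf a, Multiset.sum_map_add, Multiset.smul_sum]

theorem vert_add {f : Multiset 𝓑 → N} (hf : f ∈ SymLin R 𝓑 N) (y z : Multiset 𝓑 → 𝓑) :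
    vert (y + z) f = vert y f + vert z f := by
  simpa using vert_lin hf 1 y z

theorem vert_zero {f : Multiset 𝓑 → N} (hf : f ∈ SymLin R 𝓑 N) :
    vert (0 : Multiset 𝓑 → 𝓑) f = 0 := by
  simpa using vert_add hf 0 0

theorem vert_neg {f : Multiset 𝓑 → N} (hf : f ∈ SymLin R 𝓑 N) (y : Multiset 𝓑 → 𝓑) :
    vert (-y) f = - vert y f := by
  simpa [vert_zero hf] using vert_lin hf (-1) y 0

theorem vert_sub {f : Multiset 𝓑 → N} (hf : f ∈ SymLin R 𝓑 N) (y z : Multiset 𝓑 → 𝓑) :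
    vert (y - z) f = vert y f - vert z f := by
  rw [sub_eq_add_neg, vert_add hf, vert_neg hf, sub_eq_add_neg]

theorem vert_symLin {y : Multiset 𝓑 → 𝓑} (hy : y ∈ SymLin R 𝓑 𝓑) {f : Multiset 𝓑 → N}
    (hf : f ∈ SymLin R 𝓑 N) : vert y f ∈ SymLin R 𝓑 N := by
  refine symLin_of_insB fun a b c => ?_
  simp only [insB_vert, insB_lin hy, insB_lin hf, vert_lin hf, map_add, vert_smul]
  module

/-- The symmetric function concentrated on the empty multiset. -/
def atZero (b : N) : Multiset 𝓑 → N := fun m => if m.card = 0 then b else 0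

theorem insB_atZero (b : 𝓑) (c : N) : insB b (atZero c) = 0 := by
  funext m; simp [insB, atZero]

theorem atZero_symLin (c : N) : atZero c ∈ SymLin R 𝓑 N := by
  intro a b d m; simp [atZero]

theorem vert_atZero {f : Multiset 𝓑 → N} (hf : f ∈ SymLin R 𝓑 N) (b : 𝓑) :
    vert (atZero b) f = insB b f := by
  funext m
  induction m using Multiset.induction generalizing f with
  | empty => simp [vert_empty, atZero, insB]
  | cons c m ih =>
    rw [vert_cons, insB_atZero, vert_zero hf, ih (SymLin.insB hf c), insB_comm]
    simp [insB]

theorem cov_symLin {ρ : R → R} {D : N →+ N} {nab : 𝓑 → 𝓑}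
    (hD : ∀ (a : R) n, D (a • n) = ρ a • n + a • D n)
    (hn : ∀ (a : R) b c, nab (a • b + c) = ρ a • b + a • nab b + nab c)
    {f : Multiset 𝓑 → N} (hf : f ∈ SymLin R 𝓑 N) : cov D nab f ∈ SymLin R 𝓑 N := by
  have hs : ∀ (a : R) (g : Multiset 𝓑 → N), cov D nab (a • g) = ρ a • g + a • cov D nab g := by
    intro a g
    funext m
    simp only [cov_apply, Pi.smul_apply, Pi.add_apply, hD, sumErase_smul]
    module
  refine symLin_of_insB fun a b c => ?_
  simp only [insB_cov, insB_lin hf, hn, map_add, hs]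
  rw [show ρ a • b + a • nab b + nab c = ρ a • b + (a • nab b + nab c) by abel]
  simp only [insB_lin hf]
  module

theorem cov_smul {ρ : R → R} {D : N →+ N} (nab : 𝓑 → 𝓑)
    (hD : ∀ (a : R) n, D (a • n) = ρ a • n + a • D n) (a : R) (f : Multiset 𝓑 → N) :
    cov D nab (a • f) = a • cov D nab f + ρ a • f := by
  funext m
  simp only [cov_apply, Pi.smul_apply, Pi.add_apply, hD, sumErase_smul]
  module

/-- Inserting `b` reproduces the claim for `insB b y` and for `insB b f`, and the terms that contain
`nab b` agree on both sides. -/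
theorem cov_vert (D : N →+ N) (nab : 𝓑 →+ 𝓑) (y : Multiset 𝓑 → 𝓑)
    {f : Multiset 𝓑 → N} (hf : f ∈ SymLin R 𝓑 N) :
    cov D nab (vert y f) - vert y (cov D nab f) = vert (cov nab nab y) f := by
  funext m
  induction m using Multiset.induction generalizing y f with
  | empty => simp [vert_empty, cov_apply, sumErase_cons, -Multiset.cons_zero]
  | cons b m ih =>
    have h1 := ih (insB b y) hf
    have h2 := ih y (SymLin.insB hf b)
    rw [Pi.sub_apply] at h1 h2 ⊢
    rw [cov_cons, vert_cons y b (cov D nab f), vert_cons (cov nab nab y), insB_vert, insB_cov, insB_cov,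
      ← insB_apply (nab b) (vert y f), insB_vert, map_add, map_sub, vert_sub hf]
    simp only [Pi.add_apply, Pi.sub_apply]
    linear_combination (norm := abel) h1 + h2

/-- This is the Lie bracket of formal vector fields. In degree zero, the term where both vectors are
inserted into `f` is symmetric in `y` and `z` and drops out of the commutator; higher degrees follow
by contraction. -/
theorem vert_vert {f : Multiset 𝓑 → N} (hf : f ∈ SymLin R 𝓑 N) (y z : Multiset 𝓑 → 𝓑) :
    vert y (vert z f) - vert z (vert y f) = vert (vert y z - vert z y) f := by
  funext m
  induction m using Multiset.induction generalizing y z f with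
  | empty =>
    simp only [Pi.sub_apply, vert_empty, vert_cons, insB_apply, SymLin.sub hf,
      Multiset.cons_swap (y 0)]
    abel
  | cons b m ih =>
    have h1 := ih hf (insB b y) z
    have h2 := ih hf y (insB b z)
    have h3 := ih (SymLin.insB hf b) y z
    simp only [Pi.sub_apply, vert_sub hf, vert_sub (SymLin.insB hf b)] at h1 h2 h3 ⊢
    simp only [vert_cons, insB_vert, map_add, Pi.add_apply, vert_add hf]
    linear_combination (norm := abel) h1 + h2 + h3

/-- The symmetric function concentrated on multisets with one element given by a function. -/
def atOne (φ : 𝓑 → N) : Multiset 𝓑 → N := fun m => if m.card = 1 then (m.map φ).sum else 0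

theorem insB_atOne (φ : 𝓑 → N) (b : 𝓑) : insB b (atOne φ) = atZero (φ b) := by
  funext m
  by_cases h : m.card = 0
  · rw [Multiset.card_eq_zero] at h; subst h; simp [insB, atOne, atZero]
  · simp [insB, atOne, atZero, h]

theorem atOne_symLin {φ : 𝓑 → N} (h : ∀ (a : R) b c, φ (a • b + c) = a • φ b + φ c) :
    atOne φ ∈ SymLin R 𝓑 N := by
  refine symLin_of_insB fun a b c => ?_
  simp only [insB_atOne, h]
  funext m
  by_cases hm : m.card = 0 <;> simp [atZero, hm]

/-- The curvature of the covariant derivative on symmetric functions is the curvature on the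
arguments. -/
theorem cov_curvature {D₁ D₂ D₃ : N →+ N} {n₁ n₂ n₃ : 𝓑 → 𝓑}
    (hD : ∀ n, D₁ (D₂ n) - D₂ (D₁ n) - D₃ n = 0) {f : Multiset 𝓑 → N} (hf : f ∈ SymLin R 𝓑 N) :
    cov D₁ n₁ (cov D₂ n₂ f) - cov D₂ n₂ (cov D₁ n₁ f) - cov D₃ n₃ f =
      vert (atOne fun b => n₂ (n₁ b) - n₁ (n₂ b) + n₃ b) f := by
  funext m
  induction m using Multiset.induction generalizing f with
  | empty => simp [cov_zero, hD, vert_empty, atOne, -Multiset.cons_zero, SymLin.zero hf]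
  | cons b m ih =>
    have h := ih (SymLin.insB hf b)
    rw [vert_cons, insB_atOne, vert_atZero hf, ← h]
    simp only [Pi.sub_apply, cov_cons, insB_cov, map_sub, insB_apply, SymLin.add hf, SymLin.sub hf]
    abel

/-- The product of symmetric functions. -/
def star (f g : Multiset 𝓑 → R) : Multiset 𝓑 → R := fun m =>
  (m.antidiagonal.map fun d => f d.1 * g d.2).sum

theorem star_empty (f g : Multiset 𝓑 → R) : star f g 0 = f 0 * g 0 := by simp [star]

theorem insB_star (b : 𝓑) (f g : Multiset 𝓑 → R) :
    insB b (star f g) = star (insB b f) g + star f (insB b g) := by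
  funext m
  simp only [insB_apply, star, Pi.add_apply, Multiset.antidiagonal_cons, Multiset.map_add,
    Multiset.sum_add, Multiset.map_map, Function.comp_def, Prod.map, id]
  rw [add_comm]

theorem star_cons (b : 𝓑) (f g : Multiset 𝓑 → R) (m : Multiset 𝓑) :
    star f g (b ::ₘ m) = star (insB b f) g m + star f (insB b g) m :=
  congrFun (insB_star b f g) m

theorem star_lin_left (a : R) (f f' g : Multiset 𝓑 → R) :
    star (a • f + f') g = a • star f g + star f' g := by
  funext m
  simp [star, add_mul, mul_assoc, Multiset.sum_map_add, Multiset.sum_map_mul_left]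

theorem star_lin_right (a : R) (f g g' : Multiset 𝓑 → R) :
    star f (a • g + g') = a • star f g + star f g' := by
  funext m
  simp [star, mul_add, mul_left_comm, Multiset.sum_map_add, Multiset.sum_map_mul_left]

theorem star_add_left (f f' g : Multiset 𝓑 → R) : star (f + f') g = star f g + star f' g := by
  simpa using star_lin_left 1 f f' g

theorem star_add_right (f g g' : Multiset 𝓑 → R) : star f (g + g') = star f g + star f g' := by
  simpa using star_lin_right 1 f g g'

theorem star_zero_left (g : Multiset 𝓑 → R) : star 0 g = 0 := by
  simpa using star_add_left 0 0 g

theorem star_zero_right (f : Multiset 𝓑 → R) : star f 0 = 0 := by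
  simpa using star_add_right f 0 0

theorem star_neg_left (f g : Multiset 𝓑 → R) : star (-f) g = - star f g := by
  simpa [star_zero_left] using star_lin_left (-1) f 0 g

theorem star_neg_right (f g : Multiset 𝓑 → R) : star f (-g) = - star f g := by
  simpa [star_zero_right] using star_lin_right (-1) f g 0

theorem star_sub_left (f f' g : Multiset 𝓑 → R) : star (f - f') g = star f g - star f' g := by
  rw [sub_eq_add_neg, star_add_left, star_neg_left, sub_eq_add_neg]

theorem star_sub_right (f g g' : Multiset 𝓑 → R) : star f (g - g') = star f g - star f g' := by
  rw [sub_eq_add_neg, star_add_right, star_neg_right, sub_eq_add_neg]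

theorem star_symLin {f g : Multiset 𝓑 → R} (hf : f ∈ SymLin R 𝓑 R) (hg : g ∈ SymLin R 𝓑 R) :
    star f g ∈ SymLin R 𝓑 R := by
  refine symLin_of_insB fun a b c => ?_
  simp only [insB_star, insB_lin hf, insB_lin hg, star_lin_left, star_lin_right]
  module

theorem cov_star {D : R →+ R} (hD : ∀ a b, D (a * b) = D a * b + a * D b) (nab : 𝓑 → 𝓑)
    (f g : Multiset 𝓑 → R) :
    cov D nab (star f g) = star (cov D nab f) g + star f (cov D nab g) := by
  funext m
  induction m using Multiset.induction generalizing f g with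
  | empty => simp [cov_zero, star_empty, hD]
  | cons b m ih =>
    have h1 := ih (insB b f) g
    have h2 := ih f (insB b g)
    simp only [Pi.add_apply] at h1 h2 ⊢
    simp only [cov_cons, star_cons, insB_star, insB_cov, map_add, Pi.add_apply, star_sub_left,
      star_sub_right, Pi.sub_apply, h1, h2]
    abel

theorem vert_star (y : Multiset 𝓑 → 𝓑) (f g : Multiset 𝓑 → R) :
    vert y (star f g) = star (vert y f) g + star f (vert y g) := by
  funext m
  induction m using Multiset.induction generalizing y f g with
  | empty => simp [vert_empty, star_cons, star_empty, insB, -Multiset.cons_zero]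
  | cons b m ih =>
    simp only [vert_cons, star_cons, insB_star, insB_vert, map_add, Pi.add_apply, star_add_left,
      star_add_right, ih]
    abel

end Symmetric

/-! ## Cartan calculus on functions of lists -/

section Lists

variable {R 𝓛 P : Type*} [CommRing R] [AddCommGroup 𝓛] [Module R 𝓛] [AddCommGroup P] [Module R P]

/-- Insertion of the first argument. -/
def ins (x : 𝓛) (F : List 𝓛 → P) : List 𝓛 → P := fun s => F (x :: s)

theorem ins_apply (x : 𝓛) (F : List 𝓛 → P) (s : List 𝓛) : ins x F s = F (x :: s) := rfl

theorem ins_add (x : 𝓛) (F G : List 𝓛 → P) : ins x (F + G) = ins x F + ins x G := rfl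

theorem ins_sub (x : 𝓛) (F G : List 𝓛 → P) : ins x (F - G) = ins x F - ins x G := rfl

theorem ins_neg (x : 𝓛) (F : List 𝓛 → P) : ins x (-F) = - ins x F := rfl

theorem ins_smul (x : 𝓛) (a : R) (F : List 𝓛 → P) : ins x (a • F) = a • ins x F := rfl

/-- The extension of `φ` to a derivation on the arguments. -/
def listDer (φ : 𝓛 → 𝓛) (F : List 𝓛 → P) : List 𝓛 → P
  | [] => 0
  | x :: s => F (φ x :: s) + listDer φ (ins x F) s

theorem listDer_add (φ : 𝓛 → 𝓛) (F G : List 𝓛 → P) :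
    listDer φ (F + G) = listDer φ F + listDer φ G := by
  funext s
  induction s generalizing F G with
  | nil => simp [listDer]
  | cons x s ih => simp only [listDer, ins_add, ih, Pi.add_apply]; abel

theorem listDer_smul (φ : 𝓛 → 𝓛) (a : R) (F : List 𝓛 → P) :
    listDer φ (a • F) = a • listDer φ F := by
  funext s
  induction s generalizing F with
  | nil => simp [listDer]
  | cons x s ih => simp only [listDer, ins_smul, ih, Pi.smul_apply, smul_add]

theorem listDer_mem (S : Submodule R P) (φ : 𝓛 → 𝓛) {F : List 𝓛 → P} (hF : ∀ s, F s ∈ S)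
    (s : List 𝓛) : listDer φ F s ∈ S := by
  induction s generalizing F with
  | nil => exact S.zero_mem
  | cons x s ih => exact S.add_mem (hF _) (ih fun t => hF _)

/-- The Lie derivative on functions of lists, for an operator `A` on the values and `φ` on the
arguments. -/
def lieOp (A : P →+ P) (φ : 𝓛 → 𝓛) (F : List 𝓛 → P) : List 𝓛 → P :=
  fun s => A (F s) - listDer φ F s

theorem lieOp_nil (A : P →+ P) (φ : 𝓛 → 𝓛) (F : List 𝓛 → P) : lieOp A φ F [] = A (F []) := by
  simp [lieOp, listDer]

theorem ins_lieOp (A : P →+ P) (φ : 𝓛 → 𝓛) (F : List 𝓛 → P) (x : 𝓛) :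
    ins x (lieOp A φ F) = lieOp A φ (ins x F) - ins (φ x) F := by
  funext s
  simp only [ins_apply, lieOp, listDer, Pi.sub_apply]
  abel

theorem lieOp_cons (A : P →+ P) (φ : 𝓛 → 𝓛) (F : List 𝓛 → P) (x : 𝓛) (s : List 𝓛) :
    lieOp A φ F (x :: s) = lieOp A φ (ins x F) s - F (φ x :: s) :=
  congrFun (ins_lieOp A φ F x) s

theorem lieOp_add (A : P →+ P) (φ : 𝓛 → 𝓛) (F G : List 𝓛 → P) :
    lieOp A φ (F + G) = lieOp A φ F + lieOp A φ G := by
  funext s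
  simp only [lieOp, listDer_add, Pi.add_apply, map_add]; abel

theorem lieOp_zero (A : P →+ P) (φ : 𝓛 → 𝓛) : lieOp A φ (0 : List 𝓛 → P) = 0 := by
  simpa using lieOp_add A φ 0 0

theorem lieOp_neg (A : P →+ P) (φ : 𝓛 → 𝓛) (F : List 𝓛 → P) :
    lieOp A φ (-F) = - lieOp A φ F := by
  rw [eq_neg_iff_add_eq_zero, ← lieOp_add, neg_add_cancel, lieOp_zero]

theorem lieOp_sub (A : P →+ P) (φ : 𝓛 → 𝓛) (F G : List 𝓛 → P) :
    lieOp A φ (F - G) = lieOp A φ F - lieOp A φ G := by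
  rw [sub_eq_add_neg, lieOp_add, lieOp_neg, sub_eq_add_neg]

theorem lieOp_smul {A : P →+ P} (φ : 𝓛 → 𝓛) {a r : R} (hA : ∀ p, A (a • p) = a • A p + r • p)
    (F : List 𝓛 → P) : lieOp A φ (a • F) = a • lieOp A φ F + r • F := by
  funext s
  simp only [lieOp, listDer_smul, Pi.smul_apply, hA, Pi.add_apply]
  module

/-- The Chevalley–Eilenberg differential for operators `A l` on the values and a bracket on the
arguments, defined by Cartan's formula. -/
def ce (A : 𝓛 → P →+ P) (br : 𝓛 → 𝓛 → 𝓛) (F : List 𝓛 → P) : List 𝓛 → P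
  | [] => 0
  | l :: s => lieOp (A l) (br l) F s - ce A br (ins l F) s

theorem ce_nil (A : 𝓛 → P →+ P) (br : 𝓛 → 𝓛 → 𝓛) (F : List 𝓛 → P) : ce A br F [] = 0 := rfl

theorem ins_ce (A : 𝓛 → P →+ P) (br : 𝓛 → 𝓛 → 𝓛) (F : List 𝓛 → P) (l : 𝓛) :
    ins l (ce A br F) = lieOp (A l) (br l) F - ce A br (ins l F) := rfl

theorem ce_cons (A : 𝓛 → P →+ P) (br : 𝓛 → 𝓛 → 𝓛) (F : List 𝓛 → P) (l : 𝓛) (s : List 𝓛) :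
    ce A br F (l :: s) = lieOp (A l) (br l) F s - ce A br (ins l F) s := rfl

theorem ce_add (A : 𝓛 → P →+ P) (br : 𝓛 → 𝓛 → 𝓛) (F G : List 𝓛 → P) :
    ce A br (F + G) = ce A br F + ce A br G := by
  funext s
  induction s generalizing F G with
  | nil => simp [ce]
  | cons x s ih => simp only [ce, lieOp_add, ins_add, ih, Pi.add_apply]; abel

theorem ce_zero (A : 𝓛 → P →+ P) (br : 𝓛 → 𝓛 → 𝓛) : ce A br (0 : List 𝓛 → P) = 0 := by
  simpa using ce_add A br 0 0

theorem ce_neg (A : 𝓛 → P →+ P) (br : 𝓛 → 𝓛 → 𝓛) (F : List 𝓛 → P) :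
    ce A br (-F) = - ce A br F := by
  rw [eq_neg_iff_add_eq_zero, ← ce_add, neg_add_cancel, ce_zero]

theorem ce_sub (A : 𝓛 → P →+ P) (br : 𝓛 → 𝓛 → 𝓛) (F G : List 𝓛 → P) :
    ce A br (F - G) = ce A br F - ce A br G := by
  rw [sub_eq_add_neg, ce_add, ce_neg, sub_eq_add_neg]

theorem ce_mem (S : Submodule R P) {A : 𝓛 → P →+ P} (br : 𝓛 → 𝓛 → 𝓛)
    (hA : ∀ l, ∀ p ∈ S, A l p ∈ S) {F : List 𝓛 → P} (hF : ∀ s, F s ∈ S)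
    (s : List 𝓛) : ce A br F s ∈ S := by
  induction s generalizing F with
  | nil => exact S.zero_mem
  | cons x s ih =>
    exact S.sub_mem (S.sub_mem (hA _ _ (hF _)) (listDer_mem S _ hF _)) (ih fun t => hF _)

/-- The support of the differential with respect to the number of arguments. -/
theorem ce_support (A : 𝓛 → P →+ P) (br : 𝓛 → 𝓛 → 𝓛) {Z : ℕ → Prop} {F : List 𝓛 → P}
    (hF : ∀ s, Z s.length → F s = 0) (s : List 𝓛) (n : ℕ) (hn : s.length = n + 1) (hZ : Z n) :
    ce A br F s = 0 := by
  have hd : ∀ (φ : 𝓛 → 𝓛) (s : List 𝓛) (Z : ℕ → Prop) (F : List 𝓛 → P),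
      (∀ s, Z s.length → F s = 0) → Z s.length → listDer φ F s = 0 := by
    intro φ s
    induction s with
    | nil => intros; rfl
    | cons x s ih =>
      intro Z F hF hZ
      rw [listDer, hF _ (by simpa using hZ), zero_add]
      exact ih (fun n => Z (n + 1)) _ (fun t ht => hF _ (by simpa using ht)) (by simpa using hZ)
  induction s generalizing F Z n with
  | nil => simp at hn
  | cons x s ih =>
    simp only [List.length_cons, Nat.add_right_cancel_iff] at hn
    subst hn
    rw [ce_cons, lieOp, hF s hZ, hd _ _ _ _ hF hZ, map_zero, sub_zero, zero_sub, neg_eq_zero]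
    cases s with
    | nil => rfl
    | cons y s =>
      -- Contraction lowers the degree by one, so the set of degrees where the form vanishes is
      -- shifted.
      exact ih (Z := fun n => Z (n + 1)) (fun t ht => hF _ (by simpa using ht)) s.length rfl hZ

/-- Alternating multilinear functions of lists. -/
structure IsAlt (R : Type*) [CommRing R] [Module R 𝓛] [Module R P] (F : List 𝓛 → P) : Prop where
  lin : ∀ (s t : List 𝓛) (a : R) (x y : 𝓛),
    F (s ++ (a • x + y) :: t) = a • F (s ++ x :: t) + F (s ++ y :: t)
  alt : ∀ (s t : List 𝓛) (x : 𝓛), F (s ++ x :: x :: t) = 0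

namespace IsAlt

variable {F G : List 𝓛 → P}

theorem ins (hF : IsAlt R F) (x : 𝓛) : IsAlt R (ins x F) :=
  ⟨fun s t => hF.lin (x :: s) t, fun s t => hF.alt (x :: s) t⟩

theorem ins_lin (hF : IsAlt R F) (a : R) (x y : 𝓛) :
    Fedosov.ins (a • x + y) F = a • Fedosov.ins x F + Fedosov.ins y F :=
  funext fun s => hF.lin [] s a x y

theorem ins_add (hF : IsAlt R F) (x y : 𝓛) :
    Fedosov.ins (x + y) F = Fedosov.ins x F + Fedosov.ins y F := by
  simpa using hF.ins_lin 1 x y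

theorem ins_zero (hF : IsAlt R F) : Fedosov.ins 0 F = 0 := by
  simpa using hF.ins_add 0 0

theorem ins_smul (hF : IsAlt R F) (a : R) (x : 𝓛) :
    Fedosov.ins (a • x) F = a • Fedosov.ins x F := by
  simpa [hF.ins_zero] using hF.ins_lin a x 0

theorem ins_neg (hF : IsAlt R F) (x : 𝓛) : Fedosov.ins (-x) F = - Fedosov.ins x F := by
  simpa using hF.ins_smul (-1) x

theorem ins_self (hF : IsAlt R F) (x : 𝓛) : Fedosov.ins x (Fedosov.ins x F) = 0 :=
  funext fun s => hF.alt [] s x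

theorem ins_swap (hF : IsAlt R F) (x y : 𝓛) :
    Fedosov.ins x (Fedosov.ins y F) = - Fedosov.ins y (Fedosov.ins x F) := by
  have h := hF.ins_self (x + y)
  simp only [hF.ins_add, Fedosov.ins_add, (hF.ins _).ins_add, hF.ins_self] at h
  rw [eq_neg_iff_add_eq_zero, add_comm]
  simpa using h

theorem lieOp {A : P →+ P} {φ : 𝓛 → 𝓛} {r : R → R} (hA : ∀ a p, A (a • p) = a • A p + r a • p)
    (hφ : ∀ a x y, φ (a • x + y) = a • φ x + r a • x + φ y) (hF : IsAlt R F) :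
    IsAlt R (lieOp A φ F) := by
  constructor
  · intro s
    induction s generalizing F with
    | nil =>
      intro t a x y
      suffices h : Fedosov.ins (a • x + y) (Fedosov.lieOp A φ F) =
        a • Fedosov.ins x (Fedosov.lieOp A φ F) + Fedosov.ins y (Fedosov.lieOp A φ F) from
        congrFun h t
      rw [ins_lieOp, ins_lieOp, ins_lieOp, hF.ins_lin, lieOp_add, lieOp_smul φ (hA a), hφ,
        hF.ins_add, hF.ins_lin, hF.ins_smul]
      module
    | cons z s ih =>
      intro t a x y
      simp only [List.cons_append, lieOp_cons, ih (hF.ins z)]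
      have := hF.lin (φ z :: s) t a x y
      simp only [List.cons_append] at this
      rw [this]
      module
  · intro s
    induction s generalizing F with
    | nil =>
      intro t x
      suffices h : Fedosov.ins x (Fedosov.ins x (Fedosov.lieOp A φ F)) = 0 from congrFun h t
      rw [ins_lieOp, Fedosov.ins_sub, ins_lieOp, hF.ins_self, lieOp_zero, hF.ins_swap x (φ x)]
      simp
    | cons z s ih =>
      intro t x
      simp only [List.cons_append, lieOp_cons, ih (hF.ins z)]
      have := hF.alt (φ z :: s) t x
      simp only [List.cons_append] at this
      rw [this, sub_zero]

/-- Moving `φ s[k]` to the front costs the sign `(-1)^k`. This matches the recursive Lie derivative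
with the bracket terms of the explicit Chevalley–Eilenberg formula. -/
theorem listDer_eq (hF : IsAlt R F) (φ : 𝓛 → 𝓛) (s : List 𝓛) :
    listDer φ F s = ∑ k : Fin s.length, (-1 : ℤ) ^ (k : ℕ) • F (φ s[k] :: s.eraseIdx k) := by
  induction s generalizing F with
  | nil => simp [listDer]
  | cons x s ih =>
    rw [listDer, ih (hF.ins x)]
    simp only [List.length_cons, Fin.sum_univ_succ]
    congr 1
    · simp
    · refine Finset.sum_congr rfl fun k _ => ?_
      have h := congrFun (hF.ins_swap x (φ s[k])) (s.eraseIdx k)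
      simp only [ins_apply, Pi.neg_apply] at h ⊢
      simp only [Fin.val_succ, pow_succ, Fin.getElem_fin, List.getElem_cons_succ,
        List.eraseIdx_cons_succ] at h ⊢
      rw [h]
      simp

end IsAlt

/-- The laws of a connection, given by operators `A l` on `P` which preserve the values in `S`. -/
structure IsConn (ρ : 𝓛 → R → R) (br : 𝓛 → 𝓛 → 𝓛) (A : 𝓛 → P →+ P) (S : Submodule R P) :
    Prop where
  br_lin : ∀ l (a : R) x y, br l (a • x + y) = a • br l x + ρ l a • x + br l y
  br_swap : ∀ x y, br x y = - br y x
  br_self : ∀ x, br x x = 0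
  smul : ∀ l (a : R) p, A l (a • p) = a • A l p + ρ l a • p
  lin : ∀ (a : R) x y, ∀ p ∈ S, A (a • x + y) p = a • A x p + A y p
  mem : ∀ l, ∀ p ∈ S, A l p ∈ S

/-- The product with a one-form. -/
def wedge (c : 𝓛 → R) (F : List 𝓛 → P) : List 𝓛 → P
  | [] => 0
  | l :: s => c l • F s - wedge c (ins l F) s

theorem wedge_neg (c : 𝓛 → R) (F : List 𝓛 → P) : wedge c (-F) = - wedge c F := by
  funext s
  induction s generalizing F with
  | nil => simp [wedge]
  | cons x s ih => simp only [wedge, ins_neg, ih, Pi.neg_apply, smul_neg]; abel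

theorem wedge_zero_left {c : 𝓛 → R} (hc : ∀ l, c l = 0) (F : List 𝓛 → P) : wedge c F = 0 := by
  funext s
  induction s generalizing F with
  | nil => simp [wedge]
  | cons x s ih => simp [wedge, ih, hc]

/-! ### Tensoriality of the differential of a connection -/

section Conn

variable {ρ : 𝓛 → R → R} {br : 𝓛 → 𝓛 → 𝓛} {A : 𝓛 → P →+ P} {S : Submodule R P}

theorem IsConn.ce_smul (h : IsConn ρ br A S) (a : R) (F : List 𝓛 → P) :
    ce A br (a • F) = a • ce A br F + wedge (fun l => ρ l a) F := by
  funext s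
  induction s generalizing F with
  | nil => simp [ce, wedge]
  | cons x s ih =>
    rw [ce_cons, ins_smul, ih, lieOp_smul _ (h.smul x a)]
    simp only [Pi.add_apply, Pi.smul_apply, ce_cons, wedge]
    module

/-- This is Cartan's `L_{ax} = a L_x + da ∧ ι_x`. In `IsConn.isAlt_ce` the term `da ∧ ι_x F` cancels
against the one that `IsConn.ce_smul` produces from `d(a ι_x F)`. -/
theorem IsConn.lieOp_lin (h : IsConn ρ br A S) {F : List 𝓛 → P} (hF : IsAlt R F)
    (hS : ∀ s, F s ∈ S) (a : R) (x y : 𝓛) :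
    lieOp (A (a • x + y)) (br (a • x + y)) F =
      a • lieOp (A x) (br x) F + lieOp (A y) (br y) F + wedge (fun l => ρ l a) (ins x F) := by
  funext s
  induction s generalizing F with
  | nil =>
    simp only [lieOp_nil, Pi.add_apply, Pi.smul_apply, wedge, add_zero, h.lin a x y _ (hS [])]
  | cons z s ih =>
    have hb : br (a • x + y) z = a • br x z + (-(ρ z a • x) + br y z) := by
      rw [h.br_swap, h.br_lin, h.br_swap z x, h.br_swap z y]; module
    simp only [lieOp_cons, ih (hF.ins z) (fun t => hS _), Pi.add_apply, Pi.smul_apply, wedge]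
    rw [hF.ins_swap z x, wedge_neg, hb]
    simp only [← ins_apply _ F, hF.ins_lin, hF.ins_add, hF.ins_neg, hF.ins_smul, Pi.add_apply,
      Pi.smul_apply, Pi.neg_apply]
    module

theorem IsConn.isAlt_ce (h : IsConn ρ br A S) {F : List 𝓛 → P} (hF : IsAlt R F)
    (hS : ∀ s, F s ∈ S) : IsAlt R (ce A br F) := by
  have hL : ∀ {F : List 𝓛 → P} l, IsAlt R F → IsAlt R (lieOp (A l) (br l) F) := fun l hF =>
    hF.lieOp (h.smul l) (h.br_lin l)
  constructor
  · intro s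
    induction s generalizing F with
    | nil =>
      intro t a x y
      suffices h : ins (a • x + y) (ce A br F) = a • ins x (ce A br F) + ins y (ce A br F) from
        congrFun h t
      rw [ins_ce, ins_ce, ins_ce, hF.ins_lin, ce_add, h.ce_smul, h.lieOp_lin hF hS]
      module
    | cons z s ih =>
      intro t a x y
      simp only [List.cons_append, ce_cons, ih (hF.ins z) (fun t => hS _), (hL z hF).lin]
      module
  · intro s
    induction s generalizing F with
    | nil =>
      intro t x
      suffices h : ins x (ins x (ce A br F)) = 0 from congrFun h t
      rw [ins_ce, ins_sub, ins_lieOp, ins_ce, hF.ins_self, h.br_self, hF.ins_zero, ce_zero]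
      simp
    | cons z s ih =>
      intro t x
      simp only [List.cons_append, ce_cons, ih (hF.ins z) (fun t => hS _), (hL z hF).alt, sub_zero]

end Conn

/-! ### Shuffle products -/

variable {P₁ P₂ : Type*} [AddCommGroup P₁] [AddCommGroup P₂]

/-- The sign operator of the grading by the number of arguments. -/
def sgn (F : List 𝓛 → P) : List 𝓛 → P := fun s => (-1 : ℤ) ^ s.length • F s

theorem ins_sgn (x : 𝓛) (F : List 𝓛 → P) : ins x (sgn F) = - sgn (ins x F) := by
  funext s
  simp [ins, sgn, pow_succ]

theorem sgn_of_support {F : List 𝓛 → P} {n : ℕ} (hF : ∀ s, s.length ≠ n → F s = 0) :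
    sgn F = (-1 : ℤ) ^ n • F := by
  funext s
  by_cases h : s.length = n
  · simp [sgn, h]
  · simp [sgn, hF s h]

theorem sgn_mem (S : Submodule R P) {F : List 𝓛 → P} (hF : ∀ s, F s ∈ S) (s : List 𝓛) :
    sgn F s ∈ S := S.toAddSubgroup.zsmul_mem (hF s) _

theorem IsAlt.sgn {F : List 𝓛 → P} (hF : IsAlt R F) : IsAlt R (sgn F) := by
  constructor
  · intro s t a x y
    simp only [Fedosov.sgn, hF.lin, List.length_append, List.length_cons, smul_add]
    rw [smul_comm]
  · intro s t x
    simp only [Fedosov.sgn, hF.alt, smul_zero]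

/-- The signed sum over shuffles of a product of values. -/
def shuffle (β : P₁ → P₂ → P) (F : List 𝓛 → P₁) (G : List 𝓛 → P₂) : List 𝓛 → P := fun s =>
  ((signedSplits s).map fun c => c.1 • β (F c.2.1) (G c.2.2)).sum

theorem shuffle_nil (β : P₁ → P₂ → P) (F : List 𝓛 → P₁) (G : List 𝓛 → P₂) :
    shuffle β F G [] = β (F []) (G []) := by simp [shuffle, signedSplits]

/-- In a shuffle the first argument goes either to `F` or, past all arguments of `F`, to `G`; the
sign of the second case is recorded by `sgn F`. Every later induction on shuffle products uses this
recursion. -/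
theorem shuffle_cons {β : P₁ → P₂ → P} {F : List 𝓛 → P₁} {G : List 𝓛 → P₂} (x : 𝓛)
    (hβ : ∀ s t, β (-F s) (G t) = - β (F s) (G t)) (s : List 𝓛) :
    shuffle β F G (x :: s) = shuffle β (ins x F) G s + shuffle β (sgn F) (ins x G) s := by
  simp only [shuffle, signedSplits, List.map_append, List.sum_append, List.map_map]
  congr 2
  refine List.map_congr_left fun c _ => ?_
  simp only [Function.comp, sgn, ins, mul_comm _ c.1, mul_smul]
  congr 1
  rcases neg_one_pow_eq_or ℤ c.2.1.length with h | h <;> simp [h, hβ]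

theorem shuffle_congr_zero {β : P₁ → P₂ → P} {F : List 𝓛 → P₁} {G : List 𝓛 → P₂} {s : List 𝓛}
    (h : ∀ u v, β (F u) (G v) = 0) : shuffle β F G s = 0 := by
  simp [shuffle, h]

theorem shuffle_lin_right {β : P₁ → P₂ → P} [Module R P₂] (a : R)
    (hβ : ∀ f g g', β f (a • g + g') = a • β f g + β f g') (F : List 𝓛 → P₁) (G G' : List 𝓛 → P₂) :
    shuffle β F (a • G + G') = a • shuffle β F G + shuffle β F G' := by
  funext s
  simp only [shuffle, Pi.add_apply, Pi.smul_apply, hβ]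
  induction signedSplits s with
  | nil => simp
  | cons c l ih =>
    simp only [List.map_cons, List.sum_cons, ih]
    rw [smul_add, smul_comm c.1]; module

theorem shuffle_lin_left {β : P₁ → P₂ → P} [Module R P₁] (a : R) (F F' : List 𝓛 → P₁)
    {G : List 𝓛 → P₂} (hβ : ∀ f f' s, β (a • f + f') (G s) = a • β f (G s) + β f' (G s)) :
    shuffle β (a • F + F') G = a • shuffle β F G + shuffle β F' G := by
  funext s
  simp only [shuffle, Pi.add_apply, Pi.smul_apply, hβ]
  induction signedSplits s with
  | nil => simp
  | cons c l ih =>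
    simp only [List.map_cons, List.sum_cons, ih]
    rw [smul_add, smul_comm c.1]; module

theorem shuffle_mem (S : Submodule R P) {β : P₁ → P₂ → P} {F : List 𝓛 → P₁} {G : List 𝓛 → P₂}
    (h : ∀ u v, β (F u) (G v) ∈ S) (s : List 𝓛) : shuffle β F G s ∈ S := by
  refine S.toAddSubgroup.list_sum_mem fun x hx => ?_
  obtain ⟨c, -, rfl⟩ := List.mem_map.1 hx
  exact S.toAddSubgroup.zsmul_mem (h _ _) _

end Lists

/-! ## The operators on forms as operators of Cartan type -/

section Forms

variable {R 𝓛 𝓑 N : Type*} [CommRing R] [AddCommGroup 𝓛] [Module R 𝓛] [AddCommGroup 𝓑] [Module R 𝓑]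
  [AddCommGroup N] [Module R N]

theorem mem_form_iff {F : PreForm 𝓛 𝓑 N} :
    F ∈ Form R 𝓛 𝓑 N ↔ IsAlt R F ∧ ∀ s, F s ∈ SymLin R 𝓑 N := by
  constructor
  · rintro ⟨h1, h2, h3⟩
    exact ⟨⟨fun s t a x y => funext fun m => h1 s t a x y m,
      fun s t x => funext fun m => h2 s t x m⟩, h3⟩
  · rintro ⟨⟨h1, h2⟩, h3⟩
    exact ⟨fun s t a x y m => congrFun (h1 s t a x y) m, fun s t x m => congrFun (h2 s t x) m, h3⟩

theorem Form.isAlt {F : PreForm 𝓛 𝓑 N} (hF : F ∈ Form R 𝓛 𝓑 N) : IsAlt R F :=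
  (mem_form_iff.1 hF).1

theorem Form.symLin {F : PreForm 𝓛 𝓑 N} (hF : F ∈ Form R 𝓛 𝓑 N) (s : List 𝓛) :
    F s ∈ SymLin R 𝓑 N := (mem_form_iff.1 hF).2 s

theorem Form.ins {F : PreForm 𝓛 𝓑 N} (hF : F ∈ Form R 𝓛 𝓑 N) (x : 𝓛) :
    ins x F ∈ Form R 𝓛 𝓑 N :=
  mem_form_iff.2 ⟨(Form.isAlt hF).ins x, fun _ => Form.symLin hF _⟩

theorem Form.sgn {F : PreForm 𝓛 𝓑 N} (hF : F ∈ Form R 𝓛 𝓑 N) : sgn F ∈ Form R 𝓛 𝓑 N :=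
  mem_form_iff.2 ⟨(Form.isAlt hF).sgn, fun s => sgn_mem _ (Form.symLin hF) s⟩

/-- The action of forms with values in vertical vector fields, on forms with values in `N`. -/
def actN (Y : PreForm 𝓛 𝓑 𝓑) (F : PreForm 𝓛 𝓑 N) : PreForm 𝓛 𝓑 N :=
  shuffle (fun y f => vert y f) Y F

theorem act_eq (Y : PreForm 𝓛 𝓑 𝓑) (F : PreForm 𝓛 𝓑 R) : act Y F = actN Y F := by
  funext s m
  simp only [act, actN, shuffle]
  induction signedSplits s with
  | nil => simp
  | cons c l ih => simp only [List.map_cons, List.sum_cons, ih]; rfl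

theorem mul_eq (F G : PreForm 𝓛 𝓑 R) : mul F G = shuffle star F G := by
  funext s m
  simp only [mul, shuffle]
  induction signedSplits s with
  | nil => simp
  | cons c l ih => simp only [List.map_cons, List.sum_cons, ih]; rfl

theorem actN_nil (Y : PreForm 𝓛 𝓑 𝓑) (F : PreForm 𝓛 𝓑 N) : actN Y F [] = vert (Y []) (F []) :=
  shuffle_nil _ _ _

theorem actN_cons (Y : PreForm 𝓛 𝓑 𝓑) {F : PreForm 𝓛 𝓑 N} (hF : ∀ s, F s ∈ SymLin R 𝓑 N)
    (l : 𝓛) (s : List 𝓛) :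
    actN Y F (l :: s) = actN (ins l Y) F s + actN (sgn Y) (ins l F) s :=
  shuffle_cons _ (fun _ t => vert_neg (hF t) _) s

theorem actN_lin_left (a : R) (Y Z : PreForm 𝓛 𝓑 𝓑) {F : PreForm 𝓛 𝓑 N}
    (hF : ∀ s, F s ∈ SymLin R 𝓑 N) : actN (a • Y + Z) F = a • actN Y F + actN Z F :=
  shuffle_lin_left a _ _ fun _ _ s => vert_lin (hF s) a _ _

theorem actN_add_left (Y Z : PreForm 𝓛 𝓑 𝓑) {F : PreForm 𝓛 𝓑 N}
    (hF : ∀ s, F s ∈ SymLin R 𝓑 N) : actN (Y + Z) F = actN Y F + actN Z F := by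
  simpa using actN_lin_left 1 Y Z hF

theorem actN_zero_left {F : PreForm 𝓛 𝓑 N} (hF : ∀ s, F s ∈ SymLin R 𝓑 N) :
    actN 0 F = 0 := by
  simpa using actN_add_left 0 0 hF

theorem actN_neg_left (Y : PreForm 𝓛 𝓑 𝓑) {F : PreForm 𝓛 𝓑 N}
    (hF : ∀ s, F s ∈ SymLin R 𝓑 N) : actN (-Y) F = - actN Y F := by
  simpa [actN_zero_left hF] using actN_lin_left (-1) Y 0 hF

theorem actN_sub_left (Y Z : PreForm 𝓛 𝓑 𝓑) {F : PreForm 𝓛 𝓑 N}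
    (hF : ∀ s, F s ∈ SymLin R 𝓑 N) : actN (Y - Z) F = actN Y F - actN Z F := by
  rw [sub_eq_add_neg, actN_add_left _ _ hF, actN_neg_left _ hF, sub_eq_add_neg]

theorem actN_add_right (Y : PreForm 𝓛 𝓑 𝓑) (F G : PreForm 𝓛 𝓑 N) :
    actN Y (F + G) = actN Y F + actN Y G := by
  funext s m
  simp only [actN, shuffle, Pi.add_apply, map_add]
  induction signedSplits s with
  | nil => simp
  | cons c l ih =>
    simp only [List.map_cons, List.sum_cons, Pi.add_apply, Pi.smul_apply, smul_add] at ih ⊢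
    rw [ih]; abel

theorem actN_zero_right (Y : PreForm 𝓛 𝓑 𝓑) : actN Y (0 : PreForm 𝓛 𝓑 N) = 0 := by
  simpa using actN_add_right Y (0 : PreForm 𝓛 𝓑 N) 0

theorem actN_neg_right (Y : PreForm 𝓛 𝓑 𝓑) (F : PreForm 𝓛 𝓑 N) : actN Y (-F) = - actN Y F := by
  rw [eq_neg_iff_add_eq_zero, ← actN_add_right, neg_add_cancel, actN_zero_right]

theorem actN_sub_right (Y : PreForm 𝓛 𝓑 𝓑) (F G : PreForm 𝓛 𝓑 N) :
    actN Y (F - G) = actN Y F - actN Y G := by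
  rw [sub_eq_add_neg, actN_add_right, actN_neg_right, sub_eq_add_neg]

theorem actN_of_support_zero {Y : PreForm 𝓛 𝓑 𝓑} (hY : ∀ s, s.length ≠ 0 → Y s = 0)
    {F : PreForm 𝓛 𝓑 N} (hF : F ∈ Form R 𝓛 𝓑 N) (s : List 𝓛) :
    actN Y F s = vert (Y []) (F s) := by
  induction s generalizing F with
  | nil => exact actN_nil _ _
  | cons x s ih =>
    have h0 : ins x Y = 0 := funext fun t => hY _ (by simp)
    rw [actN_cons (R := R) Y (Form.symLin hF), h0, actN_zero_left (R := R) (Form.symLin hF),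
      sgn_of_support hY, pow_zero, one_smul, ih (Form.ins hF x)]
    simp [ins]

/-- A one-form is odd, whence the minus sign. The recursion has the shape of Cartan's formula with
`vert (Y [l])` in the place of the Lie derivative, so the action of `Y` can be absorbed into a
connection. -/
theorem actN_one_cons {Y : PreForm 𝓛 𝓑 𝓑} (hY : ∀ s, s.length ≠ 1 → Y s = 0)
    {F : PreForm 𝓛 𝓑 N} (hF : F ∈ Form R 𝓛 𝓑 N) (l : 𝓛) (s : List 𝓛) :
    actN Y F (l :: s) = vert (Y [l]) (F s) - actN Y (ins l F) s := by
  rw [actN_cons (R := R) Y (Form.symLin hF), sgn_of_support hY, pow_one, neg_smul, one_smul,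
    actN_neg_left (R := R) _ (Form.symLin (Form.ins hF l)),
    actN_of_support_zero (Y := ins l Y) (fun t ht => hY _ (by simpa using ht)) hF]
  simp only [ins_apply, Pi.neg_apply, sub_eq_add_neg]

theorem actN_two_cons {Y : PreForm 𝓛 𝓑 𝓑} (hY : ∀ s, s.length ≠ 2 → Y s = 0)
    {F : PreForm 𝓛 𝓑 N} (hF : F ∈ Form R 𝓛 𝓑 N) (l : 𝓛) (s : List 𝓛) :
    actN Y F (l :: s) = actN (ins l Y) F s + actN Y (ins l F) s := by
  rw [actN_cons (R := R) Y (Form.symLin hF), sgn_of_support hY]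
  simp

theorem actN_nil_of_support {Y : PreForm 𝓛 𝓑 𝓑} {n : ℕ} (hn : n ≠ 0)
    (hY : ∀ s, s.length ≠ n → Y s = 0) {F : PreForm 𝓛 𝓑 N} (hF : F ∈ Form R 𝓛 𝓑 N) :
    actN Y F [] = 0 := by
  rw [actN_nil, hY [] (by simpa using hn.symm), vert_zero (Form.symLin hF [])]

/-- The action of one-forms is a Cartan type operator. -/
theorem ce_add_vert (A : 𝓛 → (Multiset 𝓑 → N) →+ (Multiset 𝓑 → N)) (br : 𝓛 → 𝓛 → 𝓛)
    {Y : PreForm 𝓛 𝓑 𝓑} (hY : ∀ s, s.length ≠ 1 → Y s = 0) {F : PreForm 𝓛 𝓑 N}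
    (hF : F ∈ Form R 𝓛 𝓑 N) :
    ce (fun l => A l + vert (Y [l])) br F = ce A br F + actN Y F := by
  funext s
  induction s generalizing F with
  | nil => rw [Pi.add_apply, ce_nil, ce_nil, actN_nil_of_support one_ne_zero hY hF, add_zero]
  | cons l s ih =>
    rw [Pi.add_apply, ce_cons, ce_cons, actN_one_cons hY hF, ih (Form.ins hF l)]
    simp only [lieOp, Pi.add_apply, AddMonoidHom.add_apply]
    abel

/-- Among the terms of the explicit formula, those where the first argument `l` differentiates or
enters a bracket add up to the Lie derivative along `l`; the others are minus the formula for `ins l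
F`. -/
theorem dCE_eq (ρ : 𝓛 → R →+ R) (br : 𝓛 → 𝓛 → 𝓛) (nab : 𝓛 → 𝓑 → 𝓑) {F : PreForm 𝓛 𝓑 R}
    (hF : F ∈ Form R 𝓛 𝓑 R) :
    dCE (fun l f => ρ l f) br nab F = ce (fun l => cov (ρ l) (nab l)) br F := by
  have hcov : ∀ l f m, covDeriv (fun l f => ρ l f) nab l f m = cov (ρ l) (nab l) f m :=
    fun _ _ _ => rfl
  funext s m
  induction s generalizing F with
  | nil => simp [dCE, ce]
  | cons l s ih =>
    rw [ce_cons, Pi.sub_apply, ← ih (Form.ins hF l), lieOp, (Form.isAlt hF).listDer_eq]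
    simp only [dCE, List.length_cons, Fin.sum_univ_succ]
    -- A pair `i < k + 1` either has `i = 0`, so that `l` enters the bracket, or is a shifted pair
    -- of positions in `s`.
    have hI : ∀ k : Fin s.length, ∀ g : Fin (s.length + 1) → R,
        ∑ i ∈ Finset.Iio k.succ, g i = g 0 + ∑ i ∈ Finset.Iio k, g i.succ := by
      intro k g
      rw [← Finset.sum_filter_add_sum_filter_not (Finset.Iio k.succ) (fun i => i = 0)]
      congr 1
      · rw [show (Finset.Iio k.succ).filter (fun i => i = 0) = {0} by ext i; aesop]
        simp
      · refine Eq.trans ?_ (Finset.sum_map (Finset.Iio k) (Fin.succEmb _) g)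
        refine Finset.sum_congr ?_ fun _ _ => rfl
        ext i
        refine Fin.cases ?_ (fun i => ?_) i <;> simp
    have h0 : Finset.Iio (0 : Fin (s.length + 1)) = ∅ := by ext i; simp
    simp only [hI, h0, Finset.sum_empty, zero_add, Finset.sum_add_distrib]
    -- The bracket of two later arguments stands in front of `l` and must be moved behind it.
    have hs : ∀ i k : Fin s.length, F (br s[i] s[k] :: l :: (s.eraseIdx k).eraseIdx i) m =
        - F (l :: br s[i] s[k] :: (s.eraseIdx k).eraseIdx i) m := fun i k =>
      congrFun (congrFun ((Form.isAlt hF).ins_swap _ _) _) m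
    simp only [Fin.getElem_fin] at hs
    simp only [Fin.val_zero, Fin.val_succ, Fin.getElem_fin, List.getElem_cons_zero,
      List.getElem_cons_succ, List.eraseIdx_cons_zero, List.eraseIdx_cons_succ, pow_zero, one_smul,
      hs, pow_succ, zero_add, hcov, ins, Finset.sum_apply, Pi.sub_apply, Pi.smul_apply, pow_add,
      mul_neg, mul_one, neg_smul, smul_neg, neg_mul, neg_neg, Finset.sum_neg_distrib]
    abel

/-- Contraction with `q l` is the derivation along the constant vector field `q l` (`vert_atZero`).
Thus `-δ` merges with `X` into the action of one one-form. -/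
theorem delta_eq (q : 𝓛 → 𝓑) {Y : PreForm 𝓛 𝓑 𝓑} (hY : ∀ s, s.length ≠ 1 → Y s = 0)
    (hq : ∀ l, Y [l] = atZero (q l)) {F : PreForm 𝓛 𝓑 R} (hF : F ∈ Form R 𝓛 𝓑 R) :
    delta q F = actN Y F := by
  funext s m
  induction s generalizing F with
  | nil => rw [actN_nil_of_support one_ne_zero hY hF]; simp [delta]
  | cons l s ih =>
    rw [actN_one_cons hY hF, hq, vert_atZero (Form.symLin hF s), Pi.sub_apply,
      ← ih (Form.ins hF l), sub_eq_add_neg]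
    simp only [delta, List.length_cons, Fin.sum_univ_succ, ← Finset.sum_neg_distrib]
    congr 1
    · simp [insB]
    · simp [pow_succ, ins]

/-! ### The Leibniz rule -/

theorem lieOp_sgn {P : Type*} [AddCommGroup P] (A : P →+ P) (φ : 𝓛 → 𝓛) (F : List 𝓛 → P) :
    lieOp A φ (sgn F) = sgn (lieOp A φ F) := by
  funext s
  induction s generalizing F with
  | nil => simp [lieOp_nil, sgn]
  | cons x s ih =>
    simp only [lieOp_cons, ins_sgn, lieOp_neg, Pi.neg_apply, ih]
    simp only [sgn, lieOp_cons, List.length_cons, pow_succ, mul_neg, mul_one, neg_smul, smul_sub]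

theorem ce_sgn {P : Type*} [AddCommGroup P] (A : 𝓛 → P →+ P) (br : 𝓛 → 𝓛 → 𝓛) (F : List 𝓛 → P) :
    ce A br (sgn F) = - sgn (ce A br F) := by
  funext s
  induction s generalizing F with
  | nil => simp [ce, sgn]
  | cons x s ih =>
    rw [ce_cons, ins_sgn, ce_neg, Pi.neg_apply, ih, lieOp_sgn]
    simp only [sgn, Pi.neg_apply, ce_cons, List.length_cons, pow_succ, mul_neg, mul_one, neg_smul,
      smul_sub]
    abel

theorem mulStar_cons (F G : PreForm 𝓛 𝓑 R) (x : 𝓛) (s : List 𝓛) :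
    shuffle star F G (x :: s) = shuffle star (ins x F) G s + shuffle star (sgn F) (ins x G) s :=
  shuffle_cons x (fun _ _ => star_neg_left _ _) s

theorem ins_mulStar (F G : PreForm 𝓛 𝓑 R) (x : 𝓛) :
    ins x (shuffle star F G) = shuffle star (ins x F) G + shuffle star (sgn F) (ins x G) :=
  funext fun s => mulStar_cons F G x s

theorem mulStar_lin_left (a : R) (F F' G : PreForm 𝓛 𝓑 R) :
    shuffle star (a • F + F') G = a • shuffle star F G + shuffle star F' G :=
  shuffle_lin_left a _ _ fun _ _ _ => star_lin_left _ _ _ _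

theorem mulStar_lin_right (a : R) (F G G' : PreForm 𝓛 𝓑 R) :
    shuffle star F (a • G + G') = a • shuffle star F G + shuffle star F G' :=
  shuffle_lin_right a (fun _ _ _ => star_lin_right _ _ _ _) _ _ _

theorem mulStar_add_left (F F' G : PreForm 𝓛 𝓑 R) :
    shuffle star (F + F') G = shuffle star F G + shuffle star F' G := by
  simpa using mulStar_lin_left 1 F F' G

theorem mulStar_add_right (F G G' : PreForm 𝓛 𝓑 R) :
    shuffle star F (G + G') = shuffle star F G + shuffle star F G' := by
  simpa using mulStar_lin_right 1 F G G'

theorem mulStar_zero_left (G : PreForm 𝓛 𝓑 R) : shuffle star (0 : PreForm 𝓛 𝓑 R) G = 0 := by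
  simpa using mulStar_add_left 0 0 G

theorem mulStar_zero_right (F : PreForm 𝓛 𝓑 R) : shuffle star F (0 : PreForm 𝓛 𝓑 R) = 0 := by
  simpa using mulStar_add_right F 0 0

theorem mulStar_neg_left (F G : PreForm 𝓛 𝓑 R) : shuffle star (-F) G = - shuffle star F G := by
  simpa [mulStar_zero_left] using mulStar_lin_left (-1) F 0 G

theorem mulStar_neg_right (F G : PreForm 𝓛 𝓑 R) : shuffle star F (-G) = - shuffle star F G := by
  simpa [mulStar_zero_right] using mulStar_lin_right (-1) F G 0

theorem mulStar_sub_left (F F' G : PreForm 𝓛 𝓑 R) :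
    shuffle star (F - F') G = shuffle star F G - shuffle star F' G := by
  rw [sub_eq_add_neg, mulStar_add_left, mulStar_neg_left, sub_eq_add_neg]

theorem mulStar_sub_right (F G G' : PreForm 𝓛 𝓑 R) :
    shuffle star F (G - G') = shuffle star F G - shuffle star F G' := by
  rw [sub_eq_add_neg, mulStar_add_right, mulStar_neg_right, sub_eq_add_neg]

theorem lieOp_mulStar {A : (Multiset 𝓑 → R) →+ (Multiset 𝓑 → R)}
    (hA : ∀ f g, A (star f g) = star (A f) g + star f (A g)) (φ : 𝓛 → 𝓛) (F G : PreForm 𝓛 𝓑 R) :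
    lieOp A φ (shuffle star F G) =
      shuffle star (lieOp A φ F) G + shuffle star F (lieOp A φ G) := by
  funext s
  induction s generalizing F G with
  | nil => simp only [lieOp_nil, Pi.add_apply, shuffle_nil, hA]
  | cons x s ih =>
    simp only [lieOp_cons, ins_mulStar, mulStar_cons, Pi.add_apply, lieOp_add, ih, ins_lieOp,
      mulStar_sub_left, mulStar_sub_right, Pi.sub_apply, lieOp_sgn]
    abel

/-- Each side is contracted with `x`: the Lie derivative is an even derivation, and the sign created
by `ins` passing `sgn` combines with the one from `ce_sgn`. On forms of degree `k`, `sgn` is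
`(-1)^k`. -/
theorem ce_mulStar {A : 𝓛 → (Multiset 𝓑 → R) →+ (Multiset 𝓑 → R)}
    (hA : ∀ l f g, A l (star f g) = star (A l f) g + star f (A l g)) (br : 𝓛 → 𝓛 → 𝓛)
    (F G : PreForm 𝓛 𝓑 R) :
    ce A br (shuffle star F G) =
      shuffle star (ce A br F) G + shuffle star (sgn F) (ce A br G) := by
  funext s
  induction s generalizing F G with
  | nil => simp [ce, shuffle_nil, star_zero_left, star_zero_right]
  | cons x s ih =>
    have hsg : sgn (ce A br F) = - ce A br (sgn F) := by rw [ce_sgn, neg_neg]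
    have hss : sgn (sgn F) = F := by
      funext t
      rcases neg_one_pow_eq_or ℤ t.length with h | h <;> simp [sgn, h]
    simp only [ce_cons, ins_mulStar, mulStar_cons, Pi.add_apply, ce_add, ih, ins_ce, ins_sgn,
      lieOp_mulStar (hA x), mulStar_sub_left, mulStar_sub_right, mulStar_neg_left, Pi.sub_apply,
      Pi.neg_apply, hsg, hss]
    abel

theorem mulStar_mem_form {F G : PreForm 𝓛 𝓑 R} (hF : F ∈ Form R 𝓛 𝓑 R) (hG : G ∈ Form R 𝓛 𝓑 R) :
    shuffle star F G ∈ Form R 𝓛 𝓑 R := by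
  refine mem_form_iff.2 ⟨⟨fun s => ?_, fun s => ?_⟩, fun s =>
    shuffle_mem _ (fun u v => star_symLin (Form.symLin hF u) (Form.symLin hG v)) s⟩
  · induction s generalizing F G with
    | nil =>
      intro t a x y
      simp only [List.nil_append, mulStar_cons, (Form.isAlt hF).ins_lin, (Form.isAlt hG).ins_lin,
        mulStar_lin_left, mulStar_lin_right, Pi.add_apply, Pi.smul_apply]
      module
    | cons z s ih =>
      intro t a x y
      simp only [List.cons_append, mulStar_cons, ih (Form.ins hF z) hG,
        ih (Form.sgn hF) (Form.ins hG z)]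
      module
  · induction s generalizing F G with
    | nil =>
      intro t x
      simp only [List.nil_append, mulStar_cons, ins_sgn, (Form.isAlt hF).ins_self,
        (Form.isAlt hG).ins_self, mulStar_zero_left, mulStar_zero_right, mulStar_neg_left,
        Pi.neg_apply, Pi.zero_apply]
      abel
    | cons z s ih =>
      intro t x
      simp only [List.cons_append, mulStar_cons, ih (Form.ins hF z) hG,
        ih (Form.sgn hF) (Form.ins hG z), add_zero]

end Forms

/-! ## The square of a differential of Cartan type -/

section Square

variable {R 𝓛 𝓑 N : Type*} [CommRing R] [AddCommGroup 𝓛] [Module R 𝓛] [AddCommGroup 𝓑] [Module R 𝓑]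
  [AddCommGroup N] [Module R N]

/-- The brackets acting on the arguments cancel by the Jacobi identity, so `[L_l, L_x] - L_{[l,x]}`
only sees the curvature of the operators on the values. -/
theorem lieOp_curvature {A : 𝓛 → (Multiset 𝓑 → N) →+ (Multiset 𝓑 → N)} {br : 𝓛 → 𝓛 → 𝓛}
    (hj : ∀ x y z, br x (br y z) = br (br x y) z + br y (br x z)) {l x : 𝓛} {y : Multiset 𝓑 → 𝓑}
    (hA : ∀ f ∈ SymLin R 𝓑 N, A l (A x f) - A x (A l f) - A (br l x) f = vert y f)
    {F : PreForm 𝓛 𝓑 N} (hF : F ∈ Form R 𝓛 𝓑 N) (s : List 𝓛) :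
    lieOp (A l) (br l) (lieOp (A x) (br x) F) s - lieOp (A x) (br x) (lieOp (A l) (br l) F) s -
      lieOp (A (br l x)) (br (br l x)) F s = vert y (F s) := by
  induction s generalizing F with
  | nil => simpa only [lieOp_nil] using hA _ (Form.symLin hF [])
  | cons z s ih =>
    have h := congrFun ((Form.isAlt hF).ins_add (br (br l x) z) (br x (br l z))) s
    rw [← hj] at h
    simp only [ins_apply, Pi.add_apply] at h
    rw [← ins_apply z F, ← ih (Form.ins hF z)]
    simp only [lieOp_cons, ins_lieOp, lieOp_sub, Pi.sub_apply, h]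
    abel

/-- Cartan's formula applied twice gives `ι_l d² = [L_l, d] + d² ι_l`, which is the recursion
`actN_two_cons` for the action of a two-form once `[L_l, d]` is known to be the action of `ι_l Y`.
-/
theorem ce_ce {A : 𝓛 → (Multiset 𝓑 → N) →+ (Multiset 𝓑 → N)} {br : 𝓛 → 𝓛 → 𝓛}
    (hj : ∀ x y z, br x (br y z) = br (br x y) z + br y (br x z)) {Y : PreForm 𝓛 𝓑 𝓑}
    (hY : ∀ s, s.length ≠ 2 → Y s = 0)
    (hA : ∀ l x, ∀ f ∈ SymLin R 𝓑 N,
      A l (A x f) - A x (A l f) - A (br l x) f = vert (Y [l, x]) f)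
    {F : PreForm 𝓛 𝓑 N} (hF : F ∈ Form R 𝓛 𝓑 N) :
    ce A br (ce A br F) = actN Y F := by
  have hY1 : ∀ l (s : List 𝓛), s.length ≠ 1 → ins l Y s = 0 := fun l s hs =>
    hY _ (by simpa using hs)
  -- This is `[L_l, d] = ι_l Y`; contracted once more with `x`, it reduces to `lieOp_curvature`.
  have key : ∀ (s : List 𝓛) (l : 𝓛) (F : PreForm 𝓛 𝓑 N), F ∈ Form R 𝓛 𝓑 N →
      lieOp (A l) (br l) (ce A br F) s - ce A br (lieOp (A l) (br l) F) s =
        actN (ins l Y) F s := by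
    intro s
    induction s with
    | nil =>
      intro l F hF
      rw [actN_nil_of_support one_ne_zero (hY1 l) hF]
      simp [lieOp_nil, ce]
    | cons x s ih =>
      intro l F hF
      rw [actN_one_cons (hY1 l) hF, ← ih l _ (Form.ins hF x), ins_apply,
        ← lieOp_curvature (R := R) hj (hA l x) hF]
      simp only [lieOp_cons, ce_cons, ins_ce, ins_lieOp, lieOp_sub, ce_sub, Pi.sub_apply]
      abel
  funext s
  induction s generalizing F with
  | nil => rw [actN_nil_of_support two_ne_zero hY hF, ce_nil]
  | cons l s ih =>
    rw [actN_two_cons hY hF, ← ih (Form.ins hF l), ← key s l F hF, ce_cons, ins_ce, ce_sub,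
      Pi.sub_apply]
    abel

/-- The function of lists concentrated on lists with one element. -/
def oneForm {P : Type*} [Zero P] (c : 𝓛 → P) : List 𝓛 → P
  | [x] => c x
  | _ => 0

/-- The function of lists concentrated on lists with two elements. -/
def twoForm {P : Type*} [Zero P] (c : 𝓛 → 𝓛 → P) : List 𝓛 → P
  | [x, y] => c x y
  | _ => 0

theorem oneForm_support {P : Type*} [Zero P] (c : 𝓛 → P) (s : List 𝓛) (hs : s.length ≠ 1) :
    oneForm c s = 0 := by
  rcases s with _ | ⟨x, _ | ⟨y, s⟩⟩ <;> simp_all [oneForm]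

theorem twoForm_support {P : Type*} [Zero P] (c : 𝓛 → 𝓛 → P) (s : List 𝓛) (hs : s.length ≠ 2) :
    twoForm c s = 0 := by
  rcases s with _ | ⟨x, _ | ⟨y, _ | ⟨z, s⟩⟩⟩ <;> simp_all [twoForm]

theorem isAlt_oneForm {P : Type*} [AddCommGroup P] [Module R P] {c : 𝓛 → P}
    (h : ∀ (a : R) x y, c (a • x + y) = a • c x + c y) : IsAlt R (oneForm c) := by
  constructor
  · intro s t a x y
    rcases s with _ | ⟨u, s⟩
    · rcases t with _ | ⟨v, t⟩ <;> simp [oneForm, h]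
    · simp only [oneForm_support c _ (show ((u :: s) ++ _ :: t).length ≠ 1 by simp), smul_zero,
        add_zero]
  · intro s t x
    exact oneForm_support c _ (by simp; omega)

theorem isAlt_twoForm {P : Type*} [AddCommGroup P] [Module R P] {c : 𝓛 → 𝓛 → P}
    (h : ∀ (a : R) x y z, c z (a • x + y) = a • c z x + c z y) (hs : ∀ x y, c x y = - c y x)
    (h0 : ∀ x, c x x = 0) : IsAlt R (twoForm c) := by
  have h' : ∀ (a : R) x y z, c (a • x + y) z = a • c x z + c y z := by
    intro a x y z
    rw [hs, h, hs z x, hs z y]; module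
  constructor
  · intro s t a x y
    by_cases hl : s.length + t.length = 1
    · rcases s with _ | ⟨u, s⟩
      · obtain ⟨v, rfl⟩ := List.length_eq_one_iff.1 (by simpa using hl)
        exact h' a x y v
      · obtain ⟨rfl, rfl⟩ : s = [] ∧ t = [] := by
          simp only [List.length_cons] at hl
          constructor <;> apply List.eq_nil_of_length_eq_zero <;> omega
        exact h a x y u
    · have hz : ∀ w, twoForm c (s ++ w :: t) = 0 := fun w =>
        twoForm_support c _ (by simp; omega)
      simp [hz]
  · intro s t x
    by_cases hl : s.length + t.length = 0
    · obtain ⟨rfl, rfl⟩ : s = [] ∧ t = [] := by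
        constructor <;> apply List.eq_nil_of_length_eq_zero <;> omega
      simp [twoForm, h0]
    · exact twoForm_support c _ (by simp; omega)

/-- Forms of degree `n` on `𝓛`. -/
structure IsDeg (R : Type*) [CommRing R] [Module R 𝓛] [Module R 𝓑] [Module R N] (n : ℕ)
    (F : PreForm 𝓛 𝓑 N) : Prop where
  form : F ∈ Form R 𝓛 𝓑 N
  support : ∀ s, s.length ≠ n → F s = 0

theorem IsDeg.add {n : ℕ} {F G : PreForm 𝓛 𝓑 N} (hF : IsDeg R n F) (hG : IsDeg R n G) :
    IsDeg R n (F + G) :=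
  ⟨add_mem hF.form hG.form, fun s hs => by simp [hF.support s hs, hG.support s hs]⟩

theorem IsDeg.neg {n : ℕ} {F : PreForm 𝓛 𝓑 N} (hF : IsDeg R n F) : IsDeg R n (-F) :=
  ⟨neg_mem hF.form, fun s hs => by simp [hF.support s hs]⟩

theorem IsDeg.sub {n : ℕ} {F G : PreForm 𝓛 𝓑 N} (hF : IsDeg R n F) (hG : IsDeg R n G) :
    IsDeg R n (F - G) := by
  rw [sub_eq_add_neg]; exact hF.add hG.neg

theorem IsDeg.zero {n : ℕ} : IsDeg R n (0 : PreForm 𝓛 𝓑 N) := ⟨zero_mem _, fun _ _ => rfl⟩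

theorem IsDeg.ext_one {F G : PreForm 𝓛 𝓑 N} (hF : IsDeg R 1 F) (hG : IsDeg R 1 G)
    (h : ∀ x, F [x] = G [x]) : F = G := by
  funext s
  by_cases hs : s.length = 1
  · obtain ⟨x, rfl⟩ := List.length_eq_one_iff.1 hs
    exact h x
  · rw [hF.support s hs, hG.support s hs]

theorem IsDeg.ext_two {F G : PreForm 𝓛 𝓑 N} (hF : IsDeg R 2 F) (hG : IsDeg R 2 G)
    (h : ∀ x y, F [x, y] = G [x, y]) : F = G := by
  funext s
  by_cases hs : s.length = 2
  · obtain ⟨x, y, rfl⟩ := List.length_eq_two.1 hs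
    exact h x y
  · rw [hF.support s hs, hG.support s hs]

variable (R 𝓛 𝓑) in
/-- The algebraic data of a Lie algebroid with a connection: a Lie–Rinehart algebra `𝓛` over `R`
and a covariant derivative on `𝓑`. -/
structure LieConnection where
  /-- the anchor -/
  ρ : 𝓛 → R →+ R
  /-- the bracket -/
  br : 𝓛 → 𝓛 → 𝓛
  /-- the covariant derivative -/
  nab : 𝓛 → 𝓑 →+ 𝓑
  ρ_lin : ∀ a x y f, ρ (a • x + y) f = a * ρ x f + ρ y f
  ρ_mul : ∀ x f g, ρ x (f * g) = ρ x f * g + f * ρ x g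
  ρ_br : ∀ x y f, ρ (br x y) f = ρ x (ρ y f) - ρ y (ρ x f)
  br_add : ∀ x y z, br x (y + z) = br x y + br x z
  add_br : ∀ x y z, br (x + y) z = br x z + br y z
  br_smul : ∀ x (a : R) y, br x (a • y) = a • br x y + ρ x a • y
  br_self : ∀ x, br x x = 0
  jacobi : ∀ x y z, br x (br y z) = br (br x y) z + br y (br x z)
  nab_lin : ∀ (a : R) x y b, nab (a • x + y) b = a • nab x b + nab y b
  nab_smul : ∀ x (a : R) b, nab x (a • b) = a • nab x b + ρ x a • b

/-! ### Curvature of a connection on a Lie–Rinehart algebra, perturbed by a one-form -/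

namespace LieConnection

variable (C : LieConnection R 𝓛 𝓑)

theorem br_swap (x y : 𝓛) : C.br x y = - C.br y x := by
  have h := C.br_self (x + y)
  rw [C.br_add, C.add_br, C.add_br, C.br_self, C.br_self, zero_add, add_zero, add_comm] at h
  exact eq_neg_of_add_eq_zero_left h

theorem br_lin (l : 𝓛) (a : R) (x y : 𝓛) :
    C.br l (a • x + y) = a • C.br l x + C.ρ l a • x + C.br l y := by
  rw [C.br_add, C.br_smul]

/-- Covariant derivatives on `N` over the given Lie–Rinehart algebra. -/
structure IsCov (D : 𝓛 → N →+ N) : Prop where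
  smul : ∀ l (a : R) n, D l (a • n) = a • D l n + C.ρ l a • n
  lin : ∀ (a : R) x y n, D (a • x + y) n = a • D x n + D y n

theorem isCov_ρ : C.IsCov C.ρ where
  smul l a n := by simp only [smul_eq_mul, C.ρ_mul]; ring
  lin := C.ρ_lin

theorem isCov_nab : C.IsCov C.nab := ⟨C.nab_smul, C.nab_lin⟩

/-- The covariant Chevalley–Eilenberg differential on forms with values in `N`. -/
def d (D : 𝓛 → N →+ N) (F : PreForm 𝓛 𝓑 N) : PreForm 𝓛 𝓑 N :=
  ce (fun l => cov (D l) (C.nab l)) C.br F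

variable {C} {D : 𝓛 → N →+ N}

theorem IsCov.isConn (hD : C.IsCov D) :
    IsConn (fun l f => C.ρ l f) C.br (fun l => cov (D l) (C.nab l)) (SymLin R 𝓑 N) where
  br_lin := C.br_lin
  br_swap := C.br_swap
  br_self := C.br_self
  smul l a p := cov_smul (ρ := C.ρ l) _ (fun a n => by rw [hD.smul]; abel) a p
  lin a x y p hp := by
    funext m
    simp only [cov_apply, Pi.add_apply, Pi.smul_apply, hD.lin, C.nab_lin, hp a, sumErase_add,
      sumErase_smul]
    module
  mem l p hp := cov_symLin (ρ := C.ρ l) (fun a n => by rw [hD.smul]; abel)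
    (fun a b c => by rw [map_add, C.nab_smul]; abel) hp

theorem IsCov.isConn_vert (hD : C.IsCov D) {X : PreForm 𝓛 𝓑 𝓑} (hX : X ∈ Form R 𝓛 𝓑 𝓑) :
    IsConn (fun l f => C.ρ l f) C.br (fun l => cov (D l) (C.nab l) + vert (X [l]))
      (SymLin R 𝓑 N) where
  br_lin := C.br_lin
  br_swap := C.br_swap
  br_self := C.br_self
  smul l a p := by
    simp only [AddMonoidHom.add_apply, hD.isConn.smul, vert_smul]; module
  lin a x y p hp := by
    have h : X [a • x + y] = a • X [x] + X [y] := (Form.isAlt hX).lin [] [] a x y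
    simp only [AddMonoidHom.add_apply, hD.isConn.lin a x y p hp, h, vert_lin hp]; module
  mem l p hp := by
    exact add_mem (hD.isConn.mem l p hp) (vert_symLin (Form.symLin hX _) hp)

theorem IsCov.d_mem_form (hD : C.IsCov D) {F : PreForm 𝓛 𝓑 N} (hF : F ∈ Form R 𝓛 𝓑 N) :
    C.d D F ∈ Form R 𝓛 𝓑 N :=
  mem_form_iff.2 ⟨hD.isConn.isAlt_ce (Form.isAlt hF) (Form.symLin hF),
    ce_mem _ _ hD.isConn.mem (Form.symLin hF)⟩

theorem IsCov.actN_mem_form (hD : C.IsCov D) {X : PreForm 𝓛 𝓑 𝓑} (hX : IsDeg R 1 X)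
    {F : PreForm 𝓛 𝓑 N} (hF : F ∈ Form R 𝓛 𝓑 N) : actN X F ∈ Form R 𝓛 𝓑 N := by
  have h := ce_add_vert (fun l => cov (D l) (C.nab l)) C.br hX.support hF
  have h' : ce (fun l => cov (D l) (C.nab l) + vert (X [l])) C.br F ∈ Form R 𝓛 𝓑 N :=
    mem_form_iff.2 ⟨(hD.isConn_vert hX.form).isAlt_ce (Form.isAlt hF) (Form.symLin hF),
      ce_mem _ _ (hD.isConn_vert hX.form).mem (Form.symLin hF)⟩
  rw [← sub_eq_iff_eq_add'] at h
  rw [← h]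
  exact sub_mem h' (hD.d_mem_form hF)

theorem IsCov.isDeg_d (hD : C.IsCov D) {n : ℕ} {F : PreForm 𝓛 𝓑 N} (hF : IsDeg R n F) :
    IsDeg R (n + 1) (C.d D F) where
  form := hD.d_mem_form hF.form
  support s hs := by
    cases s with
    | nil => rfl
    | cons x s => exact ce_support (Z := fun k => k ≠ n) _ _ hF.support _ s.length rfl (by simpa using hs)

theorem IsCov.isDeg_actN (hD : C.IsCov D) {X : PreForm 𝓛 𝓑 𝓑} (hX : IsDeg R 1 X) {n : ℕ}
    {F : PreForm 𝓛 𝓑 N} (hF : IsDeg R n F) : IsDeg R (n + 1) (actN X F) where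
  form := hD.actN_mem_form hX hF.form
  support s hs := by
    have h := congrFun (ce_add_vert (fun l => cov (D l) (C.nab l)) C.br hX.support hF.form) s
    rw [Pi.add_apply] at h
    cases s with
    | nil => exact actN_nil_of_support one_ne_zero hX.support hF.form
    | cons x s =>
      rwa [ce_support (Z := fun k => k ≠ n) _ _ hF.support _ s.length rfl (by simpa using hs),
        ce_support (Z := fun k => k ≠ n) _ _ hF.support _ s.length rfl (by simpa using hs), zero_add, eq_comm] at h

theorem d_add (F G : PreForm 𝓛 𝓑 N) : C.d D (F + G) = C.d D F + C.d D G := ce_add _ _ _ _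

theorem d_neg (F : PreForm 𝓛 𝓑 N) : C.d D (-F) = - C.d D F := ce_neg _ _ _

theorem d_sub (F G : PreForm 𝓛 𝓑 N) : C.d D (F - G) = C.d D F - C.d D G := ce_sub _ _ _ _

theorem d_zero : C.d D (0 : PreForm 𝓛 𝓑 N) = 0 := ce_zero _ _

theorem d_one_apply (F : PreForm 𝓛 𝓑 N) (x y : 𝓛) :
    C.d D F [x, y] = cov (D x) (C.nab x) (F [y]) - F [C.br x y] - cov (D y) (C.nab y) (F [x]) := by
  simp only [d, ce_cons, ce_nil, lieOp_cons, lieOp_nil, ins_apply, sub_zero]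

theorem actN_one_apply (X : PreForm 𝓛 𝓑 𝓑) (F : PreForm 𝓛 𝓑 N) (h0 : X [] = 0)
    (h2 : ∀ x y, X [x, y] = 0) (hF : F ∈ Form R 𝓛 𝓑 N) (x y : 𝓛) :
    actN X F [x, y] = vert (X [x]) (F [y]) - vert (X [y]) (F [x]) := by
  simp [actN, shuffle, signedSplits, h0, h2, vert_zero (Form.symLin hF _), sub_eq_add_neg]

variable (C)

/-- The curvature of the covariant derivative on `𝓑`, as a vertical vector field. -/
def curv : PreForm 𝓛 𝓑 𝓑 := twoForm fun l x => atOne fun b =>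
  C.nab x (C.nab l b) - C.nab l (C.nab x b) + C.nab (C.br l x) b

/-- The curvature on `𝓑` enters with the opposite of the usual sign, because `∇` acts on symmetric
functions by the dual connection. -/
theorem isDeg_curv : IsDeg R 2 C.curv where
  support := twoForm_support _
  form := by
    have hneg : ∀ x b, C.nab (-x) b = - C.nab x b := by
      intro x b
      have h0 : C.nab 0 b = 0 := by simpa using C.nab_lin 1 0 0 b
      simpa [h0] using C.nab_lin (-1) x 0 b
    refine mem_form_iff.2 ⟨isAlt_twoForm ?_ ?_ ?_, fun s => ?_⟩
    · intro a x y z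
      have h : ∀ b, C.nab (C.br z (a • x + y)) b =
          a • C.nab (C.br z x) b + C.ρ z a • C.nab x b + C.nab (C.br z y) b := by
        intro b
        rw [C.br_lin, add_assoc, C.nab_lin, C.nab_lin, add_assoc]
      funext m
      by_cases hm : m.card = 1
      · obtain ⟨b, rfl⟩ := Multiset.card_eq_one.1 hm
        simp only [atOne, hm, if_true, Pi.add_apply, Pi.smul_apply, Multiset.map_singleton,
          Multiset.sum_singleton, h, C.nab_lin, map_add, C.nab_smul]
        module
      · simp [atOne, hm]
    · intro x y
      funext m
      by_cases hm : m.card = 1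
      · obtain ⟨b, rfl⟩ := Multiset.card_eq_one.1 hm
        simp only [atOne, hm, if_true, Pi.neg_apply, Multiset.map_singleton,
          Multiset.sum_singleton]
        rw [C.br_swap x y, hneg]
        abel
      · simp [atOne, hm]
    · intro x
      have h0 : ∀ b, C.nab 0 b = 0 := fun b => by simpa using C.nab_lin 1 0 0 b
      funext m
      simp [atOne, C.br_self, h0]
    · by_cases hs : s.length = 2
      · obtain ⟨x, y, rfl⟩ := List.length_eq_two.1 hs
        refine atOne_symLin fun a b c => ?_
        -- As the anchor respects brackets, all derivatives of `a` cancel and the curvature is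
        -- `R`-linear in its symmetric argument.
        have hb : C.ρ (C.br x y) a = C.ρ x (C.ρ y a) - C.ρ y (C.ρ x a) := C.ρ_br x y a
        simp only [map_add, C.nab_smul, hb]
        module
      · rw [curv, twoForm_support _ _ hs]
        exact zero_mem _

/-- The curvature of the connection `∇ + Z` in the bundle of formal vertical vector fields. -/
def mc (Z : PreForm 𝓛 𝓑 𝓑) : PreForm 𝓛 𝓑 𝓑 := C.curv + C.d C.nab Z + actN Z Z

variable {C}

theorem isDeg_mc {Z : PreForm 𝓛 𝓑 𝓑} (hZ : IsDeg R 1 Z) : IsDeg R 2 (C.mc Z) :=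
  (C.isDeg_curv.add (C.isCov_nab.isDeg_d hZ)).add (C.isCov_nab.isDeg_actN hZ hZ)

/-- By `ce_add_vert`, `d + Z` is the differential of the connection with operators `cov + vert (Z
[l])`, so by `ce_ce` only its curvature on symmetric functions is needed. The commutators of its two
summands, `cov_curvature`, `cov_vert` and `vert_vert`, give `R`, `dZ` and `Z·Z`. On two arguments
`Z·Z` is already the bracket of the two vector fields, so there is no factor `1/2`. -/
theorem sq_eq {Z : PreForm 𝓛 𝓑 𝓑} (hZ : IsDeg R 1 Z) {F : PreForm 𝓛 𝓑 R}
    (hF : F ∈ Form R 𝓛 𝓑 R) :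
    C.d C.ρ (C.d C.ρ F + actN Z F) + actN Z (C.d C.ρ F + actN Z F) = actN (C.mc Z) F := by
  have hG : C.d C.ρ F + actN Z F ∈ Form R 𝓛 𝓑 R :=
    add_mem (C.isCov_ρ.d_mem_form hF) (C.isCov_ρ.actN_mem_form hZ hF)
  have h := fun G hG => ce_add_vert (R := R) (F := G) (fun l => cov (C.ρ l) (C.nab l)) C.br
    hZ.support hG
  change ce _ _ _ + _ = _
  rw [← h _ hG]
  unfold d
  rw [← h _ hF]
  refine ce_ce C.jacobi (isDeg_mc hZ).support (fun l x f hf => ?_) hF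
  have h0 : Z [] = 0 := hZ.support [] (by simp)
  have h2 : ∀ x y, Z [x, y] = 0 := fun x y => hZ.support _ (by simp)
  rw [mc, Pi.add_apply, Pi.add_apply, d_one_apply Z,
    actN_one_apply (R := R) Z Z h0 h2 hZ.form, vert_add hf, vert_add hf, vert_sub hf, vert_sub hf,
    ← vert_vert hf, ← cov_vert (C.ρ l) (C.nab l) _ hf, ← cov_vert (C.ρ x) (C.nab x) _ hf, curv,
    twoForm, ← cov_curvature (D₁ := C.ρ l) (D₂ := C.ρ x) (D₃ := C.ρ (C.br l x)) _ hf]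
  · simp only [AddMonoidHom.add_apply, map_add]
    abel
  · intro n
    rw [C.ρ_br, sub_self]

theorem d_d {F : PreForm 𝓛 𝓑 R} (hF : F ∈ Form R 𝓛 𝓑 R) :
    C.d C.ρ (C.d C.ρ F) = actN C.curv F := by
  have h := sq_eq (C := C) (IsDeg.zero (R := R) (𝓛 := 𝓛) (𝓑 := 𝓑) (N := 𝓑) (n := 1)) hF
  simpa [mc, d_zero, actN_zero_right, actN_zero_left (R := R) (Form.symLin hF),
    actN_zero_left (R := R) (Form.symLin (C.isCov_ρ.d_mem_form hF))] using h

/-- In the sum of `sq_eq` for `Z` and for `-Z` the terms odd in `Z` cancel; what remains, after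
removing `d²`, is twice the claim. -/
theorem actN_actN_self (C : LieConnection R 𝓛 𝓑) (h2 : ∀ r : R, r + r = 0 → r = 0) {Z : PreForm 𝓛 𝓑 𝓑} (hZ : IsDeg R 1 Z)
    {F : PreForm 𝓛 𝓑 R} (hF : F ∈ Form R 𝓛 𝓑 R) :
    actN Z (actN Z F) = actN (actN Z Z) F := by
  have hdF := Form.symLin (C.isCov_ρ.d_mem_form hF)
  have haF := Form.symLin (C.isCov_ρ.actN_mem_form hZ hF)
  have hs := Form.symLin hF
  have h0 := d_d (C := C) hF
  have h1 := sq_eq (C := C) hZ hF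
  have h3 := sq_eq (C := C) hZ.neg hF
  have hZZ : actN (-Z) (-Z) = actN Z Z := by
    rw [actN_neg_left (R := R) _ (Form.symLin hZ.neg.form), actN_neg_right, neg_neg]
  simp only [mc, d_neg, d_add, hZZ, actN_neg_left (R := R) _ hs, actN_add_left (R := R) _ _ hs,
    actN_neg_left (R := R) _ hdF, actN_neg_left (R := R) _ haF, actN_add_right, actN_neg_right,
    h0] at h1 h3
  have h4 : (actN Z (actN Z F) - actN (actN Z Z) F) + (actN Z (actN Z F) - actN (actN Z Z) F)
      = 0 := by
    linear_combination (norm := abel) h1 + h3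
  rw [← sub_eq_zero]
  funext s m
  exact h2 _ (congrFun (congrFun h4 s) m)

/-- This is the part of `sq_eq` linear in `Z`, left over once the curvature and the quadratic part
are removed. -/
theorem d_actN_add (h2 : ∀ r : R, r + r = 0 → r = 0) {Z : PreForm 𝓛 𝓑 𝓑} (hZ : IsDeg R 1 Z)
    {F : PreForm 𝓛 𝓑 R} (hF : F ∈ Form R 𝓛 𝓑 R) :
    C.d C.ρ (actN Z F) + actN Z (C.d C.ρ F) = actN (C.d C.nab Z) F := by
  have hs := Form.symLin hF
  have h1 := sq_eq (C := C) hZ hF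
  simp only [mc, d_add, actN_add_left (R := R) _ _ hs, actN_add_right, d_d hF,
    actN_actN_self C h2 hZ hF] at h1
  rw [← sub_eq_zero] at h1 ⊢
  rw [← h1]
  abel

/-- Polarization of `actN_actN_self` at `Z + W`. The sum is needed: a single composite `Z ∘ W` is in
general not a derivation. -/
theorem actN_actN_add (C : LieConnection R 𝓛 𝓑) (h2 : ∀ r : R, r + r = 0 → r = 0) {Z W : PreForm 𝓛 𝓑 𝓑}
    (hZ : IsDeg R 1 Z) (hW : IsDeg R 1 W) {F : PreForm 𝓛 𝓑 R} (hF : F ∈ Form R 𝓛 𝓑 R) :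
    actN Z (actN W F) + actN W (actN Z F) = actN (actN Z W) F + actN (actN W Z) F := by
  have hs := Form.symLin hF
  have h := actN_actN_self C h2 (hZ.add hW) hF
  simp only [actN_add_left (R := R) _ _ hs, actN_add_right,
    actN_add_left (R := R) _ _ (Form.symLin (C.isCov_ρ.actN_mem_form hZ hF)),
    actN_add_left (R := R) _ _ (Form.symLin (C.isCov_ρ.actN_mem_form hW hF)),
    actN_add_left (R := R) _ _ (Form.symLin hZ.form),
    actN_add_left (R := R) _ _ (Form.symLin hW.form),
    actN_actN_self C h2 hZ hF, actN_actN_self C h2 hW hF] at h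
  rw [← sub_eq_zero] at h ⊢
  rw [← h]
  abel

end LieConnection

end Square

/-! ## The homotopy operator in low degrees -/

section Homotopy

variable {R 𝓛 𝓑 N : Type*} [CommRing R] [AddCommGroup 𝓛] [Module R 𝓛] [AddCommGroup 𝓑] [Module R 𝓑]
  [AddCommGroup N] [Module R N] {K : Type*} [Field K] (ι : K →+* R)

theorem inv_smul_nsmul [CharZero K] {n : ℕ} (hn : n ≠ 0) (x : N) :
    ι ((n : K)⁻¹) • (n • x) = x := by
  have h : (n : K) ≠ 0 := Nat.cast_ne_zero.2 hn
  rw [← Nat.cast_smul_eq_nsmul R, ← map_natCast ι, smul_smul, ← map_mul, inv_mul_cancel₀ h,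
    map_one, one_smul]

theorem eq_zero_of_nsmul (ι : K →+* R) [CharZero K] {n : ℕ} (hn : n ≠ 0) {x : N} (h : n • x = 0) : x = 0 := by
  rw [← inv_smul_nsmul ι hn x, h, smul_zero]

theorem eq_zero_of_inv_smul [CharZero K] {n : ℕ} (hn : n ≠ 0) {x : N}
    (h : ι ((n : K)⁻¹) • x = 0) : x = 0 := by
  rw [← inv_smul_nsmul ι hn x, smul_comm, h, smul_zero]

variable (q : 𝓛 →ₗ[R] 𝓑) (j : 𝓑 →ₗ[R] 𝓛)

theorem bComponent_sub (v : ℕ) (F G : PreForm 𝓛 𝓑 N) :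
    bComponent q j v (F - G) = bComponent q j v F - bComponent q j v G := by
  funext s m
  simp [bComponent]

theorem homotopy_sub (F G : PreForm 𝓛 𝓑 N) :
    homotopy ι q j (F - G) = homotopy ι q j F - homotopy ι q j G := by
  funext s m
  simp [homotopy, bComponent_sub, smul_sub, Multiset.sum_map_sub]

/-- The homotopy trades an argument in `𝓛` for a symmetric one. This gain of one symmetric degree
makes Fedosov's iteration converge. -/
theorem homotopy_vanish {n : ℕ} {F : PreForm 𝓛 𝓑 N} (hF : ∀ s m, m.card ≤ n → F s m = 0)
    (s : List 𝓛) (m : Multiset 𝓑) (hm : m.card ≤ n + 1) : homotopy ι q j F s m = 0 := by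
  classical
  refine Finset.sum_eq_zero fun v _ => Multiset.sum_eq_zero fun x hx => ?_
  obtain ⟨b, hb, rfl⟩ := Multiset.mem_map.1 hx
  have hc : (m.erase b).card ≤ n := by
    have := Multiset.card_erase_add_one hb
    omega
  simp [bComponent, hF _ _ hc]

theorem homotopy_symComponent (n : ℕ) (F : PreForm 𝓛 𝓑 N) :
    homotopy ι q j (symComponent n F) = symComponent (n + 1) (homotopy ι q j F) := by
  classical
  funext s m
  simp only [symComponent]
  by_cases hm : m.card = n + 1
  · rw [if_pos hm]
    refine Finset.sum_congr rfl fun v _ => ?_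
    congr 1
    refine Multiset.map_congr rfl fun b hb => ?_
    have hc : (m.erase b).card = n := by rw [Multiset.card_erase_of_mem hb, hm]; rfl
    simp [bComponent, symComponent, hc]
  · rw [if_neg hm]
    refine Finset.sum_eq_zero fun v _ => Multiset.sum_eq_zero fun x hx => ?_
    obtain ⟨b, hb, rfl⟩ := Multiset.mem_map.1 hx
    have hc : (m.erase b).card ≠ n := by
      have := Multiset.card_erase_add_one hb
      omega
    simp [bComponent, symComponent, hc]

theorem homotopy_support {n : ℕ} {F : PreForm 𝓛 𝓑 N} (hF : ∀ s, s.length ≠ n + 1 → F s = 0)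
    (s : List 𝓛) (hs : s.length ≠ n) : homotopy ι q j F s = 0 := by
  classical
  funext m
  refine Finset.sum_eq_zero fun v _ => Multiset.sum_eq_zero fun x hx => ?_
  obtain ⟨b, hb, rfl⟩ := Multiset.mem_map.1 hx
  have h0 : ∀ S : Finset ℕ, F ((j b :: s).mapIdx fun i l => if i ∈ S then j (q l) else
    l - j (q l)) = 0 := fun S => hF _ (by simpa using hs)
  simp only [bComponent, h0, Pi.zero_apply, Finset.sum_const_zero, smul_zero]

variable {q j}

theorem homotopy_nil (hj : ∀ b, q (j b) = b) (F : PreForm 𝓛 𝓑 N) (m : Multiset 𝓑) :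
    homotopy ι q j F [] m = ι ((m.card : K)⁻¹) • sumErase (fun b => F [j b]) m := by
  classical
  rw [← sumErase_smul]
  simp only [homotopy, sumErase, List.length_nil, zero_add, Finset.Icc_self, Finset.sum_singleton]
  congr 1
  refine Multiset.map_congr rfl fun b hb => ?_
  have hP : Finset.powersetCard 1 (Finset.range 1) = {{0}} := by decide
  simp only [bComponent, List.length_cons, List.length_nil, zero_add, hP, Finset.sum_singleton]
  rw [add_comm, Multiset.card_erase_add_one hb]
  simp [hj]

theorem homotopy_single (hj : ∀ b, q (j b) = b) {F : PreForm 𝓛 𝓑 N} (hF : F ∈ Form R 𝓛 𝓑 N) (l : 𝓛) (m : Multiset 𝓑) :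
    homotopy ι q j F [l] m =
      ι ((m.card : K)⁻¹) • sumErase (fun b => F [j b, l - j (q l)]) m +
      ι (((m.card + 1 : ℕ) : K)⁻¹) • sumErase (fun b => F [j b, j (q l)]) m := by
  classical
  rw [← sumErase_smul, ← sumErase_smul]
  have hI : Finset.Icc 1 2 = {1, 2} := by decide
  have hP : Finset.powersetCard 1 (Finset.range 2) = {{0}, {1}} := by decide
  have hP2 : Finset.powersetCard 2 (Finset.range 2) = {{0, 1}} := by decide
  simp only [homotopy, sumErase, List.length_cons, List.length_nil, zero_add, Nat.reduceAdd, hI]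
  rw [Finset.sum_pair (by decide)]
  -- The argument `j b` has no `A`-part. So for `v = 1` the term that projects `j b` to `A`
  -- vanishes, and `j b` is the one argument in `B`.
  have h0 : ∀ m', F [0, j (q l)] m' = 0 := fun m' =>
    congrFun (congrFun (Form.isAlt hF).ins_zero _) m'
  congr 2
  · refine Multiset.map_congr rfl fun b hb => ?_
    simp only [bComponent, List.length_cons, List.length_nil, zero_add, Nat.reduceAdd, hP]
    rw [Finset.sum_pair (by decide), add_comm, Multiset.card_erase_add_one hb]
    simp [hj, h0]
  · refine Multiset.map_congr rfl fun b hb => ?_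
    simp only [bComponent, List.length_cons, List.length_nil, zero_add, Nat.reduceAdd, hP2,
      Finset.sum_singleton]
    rw [← Multiset.card_erase_add_one hb, add_comm, add_assoc]
    simp [hj]

theorem isDeg_homotopy (hj : ∀ b, q (j b) = b) {F : PreForm 𝓛 𝓑 N} (hF : IsDeg R 2 F) :
    IsDeg R 1 (homotopy ι q j F) where
  support := homotopy_support ι q j hF.support
  form := by
    -- The weights depend only on the number of symmetric arguments, so they do not spoil
    -- multilinearity.
    have hw : ∀ (w : ℕ → R) (f : Multiset 𝓑 → N), f ∈ SymLin R 𝓑 N →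
        (fun m => w m.card • f m) ∈ SymLin R 𝓑 N := by
      intro w f hf a b c m
      simp only [Multiset.card_cons, hf a b c]
      module
    have hl : ∀ b x (a : R) y, F [b, a • x + y] = a • F [b, x] + F [b, y] := fun b x a y =>
      (Form.isAlt hF.form).lin [b] [] a x y
    have hl' : ∀ b x (a : R) y, F [a • x + y, b] = a • F [x, b] + F [y, b] := fun b x a y =>
      (Form.isAlt hF.form).lin [] [b] a x y
    have hS : ∀ x, sumErase (fun b => F [j b, x]) ∈ SymLin R 𝓑 N := fun x =>
      sumErase_symLin (fun b => Form.symLin hF.form _) fun a b c m => by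
        rw [map_add, map_smul, hl']; rfl
    have h1 : homotopy ι q j F = oneForm fun l => homotopy ι q j F [l] := by
      funext s
      by_cases hs : s.length = 1
      · obtain ⟨x, rfl⟩ := List.length_eq_one_iff.1 hs; rfl
      · rw [oneForm_support _ _ hs, homotopy_support ι q j hF.support _ hs]
    rw [h1]
    refine mem_form_iff.2 ⟨isAlt_oneForm fun a x y => funext fun m => ?_, fun s => ?_⟩
    · have e : a • x + y - j (q (a • x + y)) = a • (x - j (q x)) + (y - j (q y)) := by
        simp only [map_add, map_smul]; module
      change homotopy ι q j F [a • x + y] m = a • homotopy ι q j F [x] m + homotopy ι q j F [y] m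
      rw [homotopy_single ι hj hF.form, homotopy_single ι hj hF.form,
        homotopy_single ι hj hF.form, e]
      simp only [Pi.add_apply, Pi.smul_apply, map_add, map_smul, hl, sumErase_add_fun,
        sumErase_smul_fun]
      module
    · by_cases hs : s.length = 1
      · obtain ⟨x, rfl⟩ := List.length_eq_one_iff.1 hs
        have h := add_mem (hw (fun n => ι ((n : K)⁻¹)) _ (hS (x - j (q x))))
          (hw (fun n => ι (((n + 1 : ℕ) : K)⁻¹)) _ (hS (j (q x))))
        convert h using 1
        exact funext fun m => homotopy_single ι hj hF.form x m
      · rw [oneForm_support _ _ hs]; exact zero_mem _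

/-- The homotopy operator has square zero on two-forms. -/
theorem homotopy_homotopy (hj : ∀ b, q (j b) = b) [CharZero K] {F : PreForm 𝓛 𝓑 N} (hF : IsDeg R 2 F) :
    homotopy ι q j (homotopy ι q j F) = 0 := by
  funext s m
  by_cases hs : s.length = 0
  · obtain rfl := List.eq_nil_of_length_eq_zero hs
    rw [homotopy_nil ι hj]
    -- As `j b` has no `A`-part, only the `v = 2` term survives; its weight `1/(t.card + 1)`, where
    -- `b ::ₘ t = m`, is the constant `1/m.card`.
    have h1 : sumErase (fun b => homotopy ι q j F [j b]) m =
        ι ((m.card : K)⁻¹) • sumErase (fun b => sumErase fun c => F [j c, j b]) m := by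
      rw [← sumErase_smul]
      refine sumErase_congr fun b t ht => ?_
      have h0 : ∀ c, F [j c, 0] = 0 := fun c => by
        simpa using (Form.isAlt hF.form).lin [j c] [] (1 : R) 0 0
      rw [homotopy_single ι hj hF.form, ← ht]
      simp [hj, h0, sumErase]
    -- The double sum is symmetric in `b` and `c`, while `F` is alternating, so it equals its own
    -- negative.
    have h2 : sumErase (fun b => sumErase fun c => F [j c, j b]) m = 0 := by
      refine eq_zero_of_nsmul ι two_ne_zero ?_
      rw [two_nsmul]
      nth_rewrite 2 [sumErase_comm]
      have h3 : ∀ b t, sumErase (fun c => F [j c, j b]) t = - sumErase (fun c => F [j b, j c]) t := by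
        intro b t
        rw [← sumErase_neg]
        exact sumErase_congr fun c u _ =>
          congrFun (congrFun ((Form.isAlt hF.form).ins_swap (j b) (j c)) []) u
      rw [sumErase_congr (H := fun b t => - sumErase (fun c => F [j b, j c]) t) fun b t _ => h3 b t,
        sumErase_neg, neg_add_cancel]
    rw [h1, h2, smul_zero, smul_zero]
    rfl
  · rw [homotopy_support ι q j (n := 0) (isDeg_homotopy ι hj hF).support _ hs]
    rfl

/-- The one-form `q`, with values in the constant vertical vector fields. -/
def qHat (q : 𝓛 →ₗ[R] 𝓑) : PreForm 𝓛 𝓑 𝓑 := oneForm fun l => atZero (q l)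

theorem isDeg_qHat (q : 𝓛 →ₗ[R] 𝓑) : IsDeg R 1 (qHat q) where
  support := oneForm_support _
  form := by
    refine mem_form_iff.2 ⟨isAlt_oneForm fun a x y => ?_, fun s => ?_⟩
    · funext m
      by_cases hm : m.card = 0 <;> simp [atZero, hm]
    · by_cases hs : s.length = 1
      · obtain ⟨x, rfl⟩ := List.length_eq_one_iff.1 hs
        exact atZero_symLin _
      · rw [qHat, oneForm_support _ _ hs]; exact zero_mem _

theorem actN_qHat_two {F : PreForm 𝓛 𝓑 N} (hF : F ∈ Form R 𝓛 𝓑 N) (x y : 𝓛) (m : Multiset 𝓑) :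
    actN (qHat q) F [x, y] m = F [y] (q x ::ₘ m) - F [x] (q y ::ₘ m) := by
  rw [LieConnection.actN_one_apply (R := R) _ _ rfl (fun _ _ => rfl) hF]
  simp only [qHat, oneForm, vert_atZero (Form.symLin hF _)]
  rfl

theorem actN_qHat_three {F : PreForm 𝓛 𝓑 N} (hF : F ∈ Form R 𝓛 𝓑 N) (x y z : 𝓛)
    (m : Multiset 𝓑) : actN (qHat q) F [x, y, z] m =
      F [y, z] (q x ::ₘ m) - F [x, z] (q y ::ₘ m) + F [x, y] (q z ::ₘ m) := by
  rw [actN_one_cons (isDeg_qHat q).support hF, Pi.sub_apply, actN_qHat_two (Form.ins hF x)]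
  simp only [qHat, oneForm, vert_atZero (Form.symLin hF _), insB, ins]
  abel

/-- The `A`-part and the `B`-part of `l` are treated separately. Euler's relation gives the factor
`m.card` on each; on the `B`-part, `hX = 0` supplies one more copy of `X`, hence `m.card + 1`. These
factors are exactly what the weights for `v = 1` and `v = 2` invert. -/
theorem homotopy_actN_qHat (hj : ∀ b, q (j b) = b) [CharZero K] {X : PreForm 𝓛 𝓑 N} (hX : IsDeg R 1 X)
    (hD : IsDeg R 2 (actN (qHat q) X)) (hX0 : ∀ s, X s 0 = 0) (hh : homotopy ι q j X = 0) :
    homotopy ι q j (actN (qHat q) X) = X := by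
  refine (isDeg_homotopy ι hj hD).ext_one hX fun l => funext fun m => ?_
  rw [homotopy_single ι hj hD.form]
  have e : ∀ x y, actN (qHat q) X [x, y] = fun m => X [y] (q x ::ₘ m) - X [x] (q y ::ₘ m) :=
    fun x y => funext fun m => actN_qHat_two hX.form x y m
  simp only [e, hj]
  -- The weight `1/m.card` is of no use for `m = 0`; there `hX0` takes over.
  by_cases hm : m = 0
  · subst hm; simp [hX0]
  have hc : m.card ≠ 0 := by simpa using hm
  have h1 : sumErase (fun b t => X [l - j (q l)] (b ::ₘ t) - X [j b] (q (l - j (q l)) ::ₘ t)) m =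
      m.card • X [l - j (q l)] m := by
    rw [← sumErase_const]
    refine sumErase_congr fun b t _ => ?_
    rw [map_sub, hj, sub_self, SymLin.zero (Form.symLin hX.form _), sub_zero]
  have h2 : sumErase (fun b t => X [j (q l)] (b ::ₘ t) - X [j b] (q l ::ₘ t)) m =
      (m.card + 1) • X [j (q l)] m := by
    have h3 := congrFun (congrFun hh []) (q l ::ₘ m)
    rw [homotopy_nil ι hj] at h3
    have h4 := eq_zero_of_inv_smul ι (by simp) h3
    rw [sumErase_cons] at h4
    simp only [sub_eq_add_neg]
    rw [sumErase_add, sumErase_neg, sumErase_const, add_smul, one_smul,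
      ← eq_neg_of_add_eq_zero_left h4]
  rw [h1, h2, inv_smul_nsmul ι hc, inv_smul_nsmul ι (Nat.succ_ne_zero _), ← Pi.add_apply]
  have h5 := (Form.isAlt hX.form).lin [] [] (1 : R) (l - j (q l)) (j (q l))
  simp only [List.nil_append, one_smul, sub_add_cancel] at h5
  rw [h5]

/-- Evaluating `h F = 0` on the `A`-part and on the `B`-part of `x` isolates the summands `v = 1`
and `v = 2`; each weight is invertible, so the contraction vanishes without weights. -/
theorem sumErase_eq_zero_of_homotopy (hj : ∀ b, q (j b) = b) [CharZero K] {F : PreForm 𝓛 𝓑 N} (hF : IsDeg R 2 F)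
    (h : homotopy ι q j F = 0) (x : 𝓛) (m : Multiset 𝓑) :
    sumErase (fun b => F [j b, x]) m = 0 := by
  by_cases hm : m = 0
  · subst hm; simp
  have hc : m.card ≠ 0 := by simpa using hm
  have h0 : ∀ b, F [b, 0] = 0 := fun b => by
    simpa using (Form.isAlt hF.form).lin [b] [] (1 : R) 0 0
  have h00 : ∀ m, sumErase (fun b => F [j b, (0 : 𝓛)]) m = 0 := fun m => by simp [h0, sumErase]
  have h1 := congrFun (congrFun h [x - j (q x)]) m
  have h2 := congrFun (congrFun h [j (q x)]) m
  rw [homotopy_single ι hj hF.form] at h1 h2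
  simp only [map_sub, hj, sub_self, map_zero, sub_zero, h00, smul_zero, add_zero, zero_add,
    Pi.zero_apply] at h1 h2
  replace h1 := eq_zero_of_inv_smul ι hc h1
  replace h2 := eq_zero_of_inv_smul ι (Nat.succ_ne_zero _) h2
  have h5 : ∀ b, F [b, x] = F [b, x - j (q x)] + F [b, j (q x)] := by
    intro b
    have := (Form.isAlt hF.form).lin [b] [] (1 : R) (x - j (q x)) (j (q x))
    simpa using this
  simp only [h5]
  rw [sumErase_add_fun, Pi.add_apply, h1, h2, add_zero]

/-- A two-form which is closed and in the kernel of the homotopy operator vanishes. -/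
theorem eq_zero_of_closed (hj : ∀ b, q (j b) = b) [CharZero K] {Z : PreForm 𝓛 𝓑 N} (hZ : IsDeg R 2 Z)
    (h : homotopy ι q j Z = 0) {n : ℕ}
    (hc : ∀ s m, m.card = n → actN (qHat q) Z s m = 0) (x y : 𝓛) (m : Multiset 𝓑)
    (hm : m.card = n + 1) : Z [x, y] m = 0 := by
  -- Closedness at `(j b, x, y)` is summed over `b` in `m`. The first term becomes `(n + 1) Z[x, y]`
  -- by Euler's relation; the other two are rewritten by the vanishing of the unweighted contraction
  -- at `q x ::ₘ m` and `q y ::ₘ m`.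
  have key : ∀ x y, (n + 1) • Z [x, y] m + Z [j (q x), y] m + Z [x, j (q y)] m = 0 := by
    intro x y
    have h1 : sumErase (fun b t => Z [x, y] (b ::ₘ t) - Z [j b, y] (q x ::ₘ t) +
        Z [j b, x] (q y ::ₘ t)) m = 0 := by
      have : sumErase (fun b t => Z [x, y] (b ::ₘ t) - Z [j b, y] (q x ::ₘ t) +
        Z [j b, x] (q y ::ₘ t)) m = sumErase (fun _ _ => (0 : N)) m := by
        refine sumErase_congr fun b t ht => ?_
        have hct : t.card = n := by
          rw [← ht, Multiset.card_cons] at hm; omega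
        have := hc [j b, x, y] t hct
        rwa [actN_qHat_three hZ.form, hj] at this
      rw [this]; simp [sumErase]
    have h2 := sumErase_eq_zero_of_homotopy ι hj hZ h y (q x ::ₘ m)
    have h3 := sumErase_eq_zero_of_homotopy ι hj hZ h x (q y ::ₘ m)
    rw [sumErase_cons] at h2 h3
    simp only [sub_eq_add_neg] at h1
    rw [sumErase_add, sumErase_add, sumErase_neg, sumErase_const, hm,
      ← eq_neg_of_add_eq_zero_left h2, eq_neg_of_add_eq_zero_right h3] at h1
    have h4 : Z [x, j (q y)] m = - Z [j (q y), x] m :=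
      congrFun (congrFun ((Form.isAlt hZ.form).ins_swap (j (q y)) x) []) m
    rw [h4]
    exact h1
  -- With `v` of the two arguments in `j(B)`, and once the components with more such arguments
  -- vanish, `key` reads `(n + 1 + v) Z = 0`; the cases `v = 2, 1` and then general arguments are
  -- settled in turn.
  have h1 : ∀ x y, Z [j (q x), j (q y)] m = 0 := by
    intro x y
    have := key (j (q x)) (j (q y))
    simp only [hj] at this
    refine eq_zero_of_nsmul ι (Nat.succ_ne_zero (n + 2)) ?_
    rw [← this]; simp only [Nat.succ_eq_add_one, add_smul, one_smul, ofNat_smul_eq_nsmul]; abel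
  have h2 : ∀ x y, Z [j (q x), y] m = 0 := by
    intro x y
    have := key (j (q x)) y
    simp only [hj, h1, add_zero] at this
    refine eq_zero_of_nsmul ι (Nat.succ_ne_zero (n + 1)) ?_
    rw [← this]; simp only [Nat.succ_eq_add_one, add_smul, one_smul]
  have h3 : Z [x, j (q y)] m = 0 := by
    have h4 : Z [x, j (q y)] m = - Z [j (q y), x] m :=
      congrFun (congrFun ((Form.isAlt hZ.form).ins_swap (j (q y)) x) []) m
    rw [h4, h2, neg_zero]
  have := key x y
  rw [h2, h3, add_zero, add_zero] at this
  exact eq_zero_of_nsmul ι (Nat.succ_ne_zero n) this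

end Homotopy

/-! ## Fedosov's construction over a Lie–Rinehart algebra -/

section Vanishing

variable {R 𝓛 𝓑 N : Type*} [CommRing R] [AddCommGroup 𝓛] [Module R 𝓛] [AddCommGroup 𝓑] [Module R 𝓑]
  [AddCommGroup N] [Module R N]

/-- The form vanishes in symmetric degrees at most `n`. -/
def VanishLE (n : ℕ) (F : PreForm 𝓛 𝓑 N) : Prop := ∀ s m, m.card ≤ n → F s m = 0

theorem VanishLE.add {n : ℕ} {F G : PreForm 𝓛 𝓑 N} (hF : VanishLE n F) (hG : VanishLE n G) :
    VanishLE n (F + G) := fun s m hm => by simp [hF s m hm, hG s m hm]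

theorem VanishLE.sub {n : ℕ} {F G : PreForm 𝓛 𝓑 N} (hF : VanishLE n F) (hG : VanishLE n G) :
    VanishLE n (F - G) := fun s m hm => by simp [hF s m hm, hG s m hm]

theorem VanishLE.mono {n k : ℕ} {F : PreForm 𝓛 𝓑 N} (hF : VanishLE n F) (h : k ≤ n) :
    VanishLE k F := fun s m hm => hF s m (hm.trans h)

theorem eq_of_vanishLE_sub {F G : PreForm 𝓛 𝓑 N} (h : ∀ n, VanishLE n (F - G)) : F = G := by
  funext s m
  exact sub_eq_zero.1 (h m.card s m le_rfl)

theorem vert_eq_zero {y : Multiset 𝓑 → 𝓑} {f : Multiset 𝓑 → N} (hf : f ∈ SymLin R 𝓑 N)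
    {m : Multiset 𝓑} (h : ∀ u v, u + v = m → y u = 0 ∨ ∀ b, f (b ::ₘ v) = 0) :
    vert y f m = 0 := by
  refine Multiset.sum_eq_zero fun x hx => ?_
  obtain ⟨d, hd, rfl⟩ := Multiset.mem_map.1 hx
  rcases h d.1 d.2 (Multiset.mem_antidiagonal.1 hd) with h | h
  · rw [h, SymLin.zero hf]
  · exact h _

theorem actN_apply_eq_zero {Y : PreForm 𝓛 𝓑 𝓑} {F : PreForm 𝓛 𝓑 N} {m : Multiset 𝓑}
    (h : ∀ s t, vert (Y s) (F t) m = 0) (s : List 𝓛) : actN Y F s m = 0 := by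
  simp only [actN, shuffle]
  induction signedSplits s with
  | nil => rfl
  | cons c l ih => simp only [List.map_cons, List.sum_cons, Pi.add_apply, ih, Pi.smul_apply, h,
      smul_zero, add_zero]

theorem vanishLE_actN_left {n : ℕ} {Y : PreForm 𝓛 𝓑 𝓑} (hY : VanishLE n Y) {F : PreForm 𝓛 𝓑 N}
    (hF : ∀ s, F s ∈ SymLin R 𝓑 N) : VanishLE n (actN Y F) := fun s m hm =>
  actN_apply_eq_zero (fun s t => vert_eq_zero (hF t) fun u v huv => Or.inl (hY s u (by
    rw [← huv, Multiset.card_add] at hm; omega))) s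

/-- Acting on `F` consumes one of its symmetric arguments; a vector field without constant term puts
at least one back. -/
theorem vanishLE_actN_right {n : ℕ} {Y : PreForm 𝓛 𝓑 𝓑} (hY : VanishLE 0 Y) {F : PreForm 𝓛 𝓑 N}
    (hF : ∀ s, F s ∈ SymLin R 𝓑 N) (hn : VanishLE n F) : VanishLE n (actN Y F) := fun s m hm =>
  actN_apply_eq_zero (fun s t => vert_eq_zero (hF t) fun u v huv => by
    by_cases hu : u.card = 0
    · exact Or.inl (hY s u hu.le)
    · refine Or.inr fun b => hn t _ ?_
      rw [← huv, Multiset.card_add] at hm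
      rw [Multiset.card_cons]
      omega) s

/-- The covariant derivative evaluates `f` only on multisets of the same size, so the functions that
vanish in prescribed sizes form a submodule it preserves. -/
theorem LieConnection.d_apply_eq_zero (C : LieConnection R 𝓛 𝓑) (D : 𝓛 → N →+ N)
    {Zc : ℕ → Prop} {F : PreForm 𝓛 𝓑 N} (hF : ∀ s m, Zc m.card → F s m = 0) (s : List 𝓛)
    (m : Multiset 𝓑) (hm : Zc m.card) : C.d D F s m = 0 := by
  let S : Submodule R (Multiset 𝓑 → N) :=
    { carrier := {f | ∀ m, Zc m.card → f m = 0}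
      zero_mem' := fun _ _ => rfl
      add_mem' := fun hf hg m hm => by simp [hf m hm, hg m hm]
      smul_mem' := fun r f hf m hm => by simp [hf m hm] }
  refine ce_mem S C.br (fun l f hf m hm => ?_) hF s m hm
  rw [cov_apply, hf m hm, map_zero, zero_sub, neg_eq_zero]
  rw [sumErase_congr (H := fun _ _ => 0) fun b t ht => hf _ ?_]
  · simp [sumErase]
  · rw [← ht, Multiset.card_cons] at hm
    rwa [Multiset.card_cons]

theorem LieConnection.vanishLE_d (C : LieConnection R 𝓛 𝓑) (D : 𝓛 → N →+ N) {n : ℕ}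
    {F : PreForm 𝓛 𝓑 N} (hF : VanishLE n F) : VanishLE n (C.d D F) := fun s m hm =>
  C.d_apply_eq_zero D (Zc := fun k => k ≤ n) hF s m hm

theorem symComponent_d (C : LieConnection R 𝓛 𝓑) (D : 𝓛 → N →+ N) (n : ℕ) (F : PreForm 𝓛 𝓑 N) :
    symComponent n (C.d D F) = C.d D (symComponent n F) := by
  funext s m
  by_cases hm : m.card = n
  · have h := C.d_apply_eq_zero D (Zc := fun k => k = n) (F := F - symComponent n F)
      (fun s m hm => by simp [symComponent, hm]) s m hm
    rw [LieConnection.d_sub, Pi.sub_apply, Pi.sub_apply, sub_eq_zero] at h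
    simp [symComponent, hm, ← h]
  · rw [C.d_apply_eq_zero D (Zc := fun k => k ≠ n) (fun s m hm => by simp [symComponent, hm]) s m hm]
    simp [symComponent, hm]

theorem symComponent_mem_form (n : ℕ) {F : PreForm 𝓛 𝓑 N} (hF : F ∈ Form R 𝓛 𝓑 N) :
    symComponent n F ∈ Form R 𝓛 𝓑 N := by
  obtain ⟨h1, h2, h3⟩ := hF
  refine ⟨fun s t a x y m => ?_, fun s t x m => ?_, fun s a b c m => ?_⟩
  · by_cases hm : m.card = n <;> simp [symComponent, hm, h1]
  · by_cases hm : m.card = n <;> simp [symComponent, hm, h2]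
  · by_cases hm : m.card + 1 = n <;> simp [symComponent, hm, h3]

theorem isDeg_symComponent (n : ℕ) {k : ℕ} {F : PreForm 𝓛 𝓑 N} (hF : IsDeg R k F) :
    IsDeg R k (symComponent n F) :=
  ⟨symComponent_mem_form n hF.form, fun s hs => funext fun m => by
    simp [symComponent, hF.support s hs]⟩

/-- One argument of `f` is taken by the value of `y`, so the parts of degrees `p` and `n + 1 - p`
pair to degree `n`. Outside `2 ≤ p ≤ n - 1` one of the two has degree at most one and vanishes. -/
theorem symComponent_vert (n : ℕ) {y : Multiset 𝓑 → 𝓑} {f : Multiset 𝓑 → N}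
    (hf : f ∈ SymLin R 𝓑 N) (hy : ∀ m, m.card ≤ 1 → y m = 0) (hf1 : ∀ m, m.card ≤ 1 → f m = 0)
    (m : Multiset 𝓑) :
    (if m.card = n then vert y f m else 0) = ∑ p ∈ Finset.Icc 2 (n - 1),
      vert (fun u => if u.card = p then y u else 0)
        (fun u => if u.card = n + 1 - p then f u else 0) m := by
  simp only [vert_apply, Multiset.card_cons]
  rw [Finset.sum_eq_multiset_sum, Multiset.sum_map_sum_map]
  by_cases hm : m.card = n
  · rw [if_pos hm]
    congr 1
    refine Multiset.map_congr rfl fun d hd => ?_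
    have hc : d.1.card + d.2.card = n := by
      rw [← hm, ← Multiset.mem_antidiagonal.1 hd, Multiset.card_add]
    rw [← Finset.sum_eq_multiset_sum]
    by_cases hr : d.1.card ∈ Finset.Icc 2 (n - 1)
    · rw [Finset.sum_eq_single_of_mem _ hr]
      · rw [Finset.mem_Icc] at hr
        rw [if_pos rfl, if_pos (by omega)]
      · intro p _ hp
        rw [if_neg hp.symm, SymLin.zero hf, ite_self]
    · rw [Finset.sum_eq_zero]
      · rw [Finset.mem_Icc, not_and_or] at hr
        rcases le_or_gt d.1.card 1 with h1 | h1
        · rw [hy _ h1, SymLin.zero hf]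
        · exact hf1 _ (by rw [Multiset.card_cons]; omega)
      · intro p hp
        rw [if_neg (c := d.1.card = p) (fun h => hr (h.symm ▸ hp)), SymLin.zero hf, ite_self]
  · rw [if_neg hm]
    symm
    refine Multiset.sum_eq_zero fun x hx => ?_
    obtain ⟨d, hd, rfl⟩ := Multiset.mem_map.1 hx
    have hc : d.1.card + d.2.card = m.card := by
      rw [← Multiset.mem_antidiagonal.1 hd, Multiset.card_add]
    rw [← Finset.sum_eq_multiset_sum]
    refine Finset.sum_eq_zero fun p hp => ?_
    rw [Finset.mem_Icc] at hp
    by_cases h1 : d.1.card = p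
    · rw [if_neg]; omega
    · rw [if_neg h1, SymLin.zero hf, ite_self]

theorem symComponent_actN (n : ℕ) {Y : PreForm 𝓛 𝓑 𝓑} {F : PreForm 𝓛 𝓑 N}
    (hF : ∀ s, F s ∈ SymLin R 𝓑 N) (hY : VanishLE 1 Y) (hF1 : VanishLE 1 F) :
    symComponent n (actN Y F) = ∑ p ∈ Finset.Icc 2 (n - 1),
      actN (symComponent p Y) (symComponent (n + 1 - p) F) := by
  funext s m
  rw [Finset.sum_apply, Finset.sum_apply]
  simp only [symComponent, actN, shuffle]
  induction signedSplits s with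
  | nil => simp
  | cons c l ih =>
    simp only [List.map_cons, List.sum_cons, Pi.add_apply, Finset.sum_add_distrib, ← ih,
      Pi.smul_apply, ← Finset.smul_sum]
    change _ = c.1 • ∑ p ∈ Finset.Icc 2 (n - 1),
      vert (fun u => if u.card = p then Y c.2.1 u else 0)
        (fun u => if u.card = n + 1 - p then F c.2.2 u else 0) m + _
    rw [← symComponent_vert n (hF c.2.2) (hY c.2.1) (hF1 c.2.2)]
    split_ifs <;> simp

/-- The linear function `χ` on `𝓑`, as a form. -/
def linForm (χ : 𝓑 →ₗ[R] R) : PreForm 𝓛 𝓑 R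
  | [] => atOne χ
  | _ => 0

theorem linForm_mem_form (χ : 𝓑 →ₗ[R] R) : (linForm χ : PreForm 𝓛 𝓑 R) ∈ Form R 𝓛 𝓑 R := by
  have h : ∀ s t (x : 𝓛), (linForm χ : PreForm 𝓛 𝓑 R) (s ++ x :: t) = 0 := by
    intro s t x
    cases s <;> rfl
  refine mem_form_iff.2 ⟨⟨fun s t a x y => by simp [h], fun s t x => h _ _ _⟩, fun s => ?_⟩
  cases s with
  | nil => exact atOne_symLin fun a b c => by simp
  | cons x s => exact zero_mem _

theorem vert_atZero_right (y : Multiset 𝓑 → 𝓑) (c : N) : vert y (atZero c) = 0 := by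
  funext m
  simp [vert_apply, atZero]

theorem vert_atOne (χ : 𝓑 → N) (y : Multiset 𝓑 → 𝓑) (m : Multiset 𝓑) :
    vert y (atOne χ) m = χ (y m) := by
  induction m using Multiset.induction generalizing y with
  | empty => simp [vert_empty, atOne]
  | cons b m ih => rw [vert_cons, ih, insB_atOne, vert_atZero_right]; simp [insB]

/-- Linear functions serve as test functions: acting on them applies `χ` to the coefficients, so a
derivation determines its vector field wherever functionals separate points. -/
theorem actN_linForm (Y : PreForm 𝓛 𝓑 𝓑) (χ : 𝓑 →ₗ[R] R) (s : List 𝓛) (m : Multiset 𝓑) :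
    actN Y (linForm χ) s m = χ (Y s m) := by
  induction s generalizing Y with
  | nil => rw [actN_nil]; exact vert_atOne _ _ _
  | cons l s ih =>
    have h0 : ins l (linForm χ : PreForm 𝓛 𝓑 R) = 0 := rfl
    rw [actN_cons (R := R) Y (Form.symLin (linForm_mem_form χ)), Pi.add_apply, ih, h0,
      actN_zero_right]
    simp [ins]

theorem actN_comp (Y : PreForm 𝓛 𝓑 𝓑) (χ : 𝓑 →ₗ[R] R) (F : PreForm 𝓛 𝓑 𝓑) (s : List 𝓛)
    (m : Multiset 𝓑) : actN Y (fun s m => χ (F s m)) s m = χ (actN Y F s m) := by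
  simp only [actN, shuffle]
  induction signedSplits s with
  | nil => simp
  | cons c l ih =>
    simp only [List.map_cons, List.sum_cons, Pi.add_apply, ih, Pi.smul_apply, map_add, map_zsmul]
    congr 2
    simp [vert_apply, map_multiset_sum]

end Vanishing

/-! ### The Maurer–Cartan equation and its solution by a fixed point -/

section Main

variable {R 𝓛 𝓑 : Type*} [CommRing R] [AddCommGroup 𝓛] [Module R 𝓛] [AddCommGroup 𝓑] [Module R 𝓑]

namespace LieConnection

variable (C : LieConnection R 𝓛 𝓑) (q : 𝓛 →ₗ[R] 𝓑)

/-- The operator `-δ + d + X`. -/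
def fedosovOp (X : PreForm 𝓛 𝓑 𝓑) (F : PreForm 𝓛 𝓑 R) : PreForm 𝓛 𝓑 R :=
  C.d C.ρ F + actN (X - qHat q) F

/-- One-forms with values in the formal vector fields of order at least two. -/
structure IsHigher (R : Type*) [CommRing R] [Module R 𝓛] [Module R 𝓑] (X : PreForm 𝓛 𝓑 𝓑) :
    Prop where
  deg : IsDeg R 1 X
  vanish : VanishLE 1 X

variable {C q}

theorem IsHigher.isDeg_sub {X : PreForm 𝓛 𝓑 𝓑} (hX : IsHigher R X) : IsDeg R 1 (X - qHat q) :=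
  hX.deg.sub (isDeg_qHat q)

theorem fedosovOp_mem_form {X : PreForm 𝓛 𝓑 𝓑} (hX : IsHigher R X) {F : PreForm 𝓛 𝓑 R}
    (hF : F ∈ Form R 𝓛 𝓑 R) : C.fedosovOp q X F ∈ Form R 𝓛 𝓑 R :=
  add_mem (C.isCov_ρ.d_mem_form hF) (C.isCov_ρ.actN_mem_form hX.isDeg_sub hF)

theorem actN_qHat_right (Y : PreForm 𝓛 𝓑 𝓑) : actN Y (qHat q) = 0 := by
  funext s
  refine shuffle_congr_zero fun u v => ?_
  by_cases hv : v.length = 1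
  · obtain ⟨x, rfl⟩ := List.length_eq_one_iff.1 hv
    exact vert_atZero_right _ _
  · rw [(isDeg_qHat q).support v hv, map_zero]

/-- On two arguments the differential of the one-form `q` is the torsion. -/
theorem d_qHat (htf : ∀ x y, C.nab x (q y) - C.nab y (q x) - q (C.br x y) = 0) :
    C.d C.nab (qHat q) = 0 := by
  refine (C.isCov_nab.isDeg_d (isDeg_qHat q)).ext_two IsDeg.zero fun x y => ?_
  have hc : ∀ (l : 𝓛) (b : 𝓑), cov (C.nab l) (C.nab l) (atZero b) = atZero (C.nab l b) := by
    intro l b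
    funext m
    by_cases hm : m.card = 0 <;> simp [cov_apply, atZero, hm, sumErase]
  rw [d_one_apply]
  simp only [qHat, oneForm, hc]
  funext m
  by_cases hm : m.card = 0
  · simp only [Pi.sub_apply, atZero, hm, if_true, Pi.zero_apply]
    rw [← htf x y]; abel
  · simp [atZero, hm]

theorem mc_sub_qHat (htf : ∀ x y, C.nab x (q y) - C.nab y (q x) - q (C.br x y) = 0)
    {X : PreForm 𝓛 𝓑 𝓑} (hX : IsHigher R X) :
    C.mc (X - qHat q) = C.mc X - actN (qHat q) X := by
  rw [mc, mc, d_sub, d_qHat htf, actN_sub_right, actN_qHat_right,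
    actN_sub_left (R := R) _ _ (Form.symLin hX.deg.form)]
  abel

theorem fedosovOp_sq (htf : ∀ x y, C.nab x (q y) - C.nab y (q x) - q (C.br x y) = 0)
    {X : PreForm 𝓛 𝓑 𝓑} (hX : IsHigher R X) {F : PreForm 𝓛 𝓑 R} (hF : F ∈ Form R 𝓛 𝓑 R) :
    C.fedosovOp q X (C.fedosovOp q X F) = actN (C.mc X - actN (qHat q) X) F := by
  rw [← mc_sub_qHat htf hX]
  exact sq_eq hX.isDeg_sub hF

theorem isDeg_actN_qHat {X : PreForm 𝓛 𝓑 𝓑} (C : LieConnection R 𝓛 𝓑) {n : ℕ}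
    (hX : IsDeg R n X) : IsDeg R (n + 1) (actN (qHat q) X) :=
  C.isCov_nab.isDeg_actN (isDeg_qHat q) hX

/-- The square of `-δ + d + X` vanishes if and only if `X` solves the Maurer–Cartan equation. -/
theorem fedosovOp_sq_eq_zero_iff
    (htf : ∀ x y, C.nab x (q y) - C.nab y (q x) - q (C.br x y) = 0)
    (hsep : ∀ b : 𝓑, (∀ χ : 𝓑 →ₗ[R] R, χ b = 0) → b = 0) {X : PreForm 𝓛 𝓑 𝓑}
    (hX : IsHigher R X) :
    (∀ F ∈ Form R 𝓛 𝓑 R, C.fedosovOp q X (C.fedosovOp q X F) = 0) ↔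
      actN (qHat q) X = C.mc X := by
  constructor
  · intro h
    symm
    rw [← sub_eq_zero]
    funext s m
    refine hsep _ fun χ => ?_
    rw [← actN_linForm, ← fedosovOp_sq htf hX (linForm_mem_form χ), h _ (linForm_mem_form χ)]
    rfl
  · intro h F hF
    rw [fedosovOp_sq htf hX hF, h, sub_self, actN_zero_left (R := R) (Form.symLin hF)]

/-- The difference is `d(X - Y) + (X - Y)·X + Y·(X - Y)`, and no term has lower order than `X - Y`,
because `Y` has no constant part. -/
theorem mc_sub_mc {X Y : PreForm 𝓛 𝓑 𝓑} (hX : IsHigher R X) (hY : IsHigher R Y) {n : ℕ}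
    (h : VanishLE n (X - Y)) : VanishLE n (C.mc X - C.mc Y) := by
  have hs := Form.symLin (hX.deg.sub hY.deg).form
  have e : C.mc X - C.mc Y = C.d C.nab (X - Y) + (actN (X - Y) X + actN Y (X - Y)) := by
    rw [mc, mc, d_sub, actN_sub_right, actN_sub_left (R := R) _ _ (Form.symLin hX.deg.form)]
    abel
  rw [e]
  exact (C.vanishLE_d _ h).add ((vanishLE_actN_left (R := R) h (Form.symLin hX.deg.form)).add
    (vanishLE_actN_right (R := R) (hY.vanish.mono zero_le_one) hs h))

theorem mc_sub_curv {X : PreForm 𝓛 𝓑 𝓑} (hX : IsHigher R X) :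
    VanishLE 1 (C.d C.nab X + actN X X) :=
  (C.vanishLE_d _ hX.vanish).add
    (vanishLE_actN_left (R := R) hX.vanish (Form.symLin hX.deg.form))

theorem vanishLE_curv : VanishLE 0 C.curv := by
  intro s m hm
  by_cases hs : s.length = 2
  · obtain ⟨x, y, rfl⟩ := List.length_eq_two.1 hs
    simp only [curv, twoForm, atOne]
    rw [if_neg (by omega)]
  · rw [C.isDeg_curv.support s hs]; rfl

theorem vanishLE_mc {X : PreForm 𝓛 𝓑 𝓑} (hX : IsHigher R X) : VanishLE 0 (C.mc X) := by
  rw [mc, add_assoc]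
  exact vanishLE_curv.add ((mc_sub_curv hX).mono zero_le_one)

variable {K : Type*} [Field K] [CharZero K] {ι : K →+* R} {j : 𝓑 →ₗ[R] 𝓛}

theorem isHigher_homotopy_mc (hj : ∀ b, q (j b) = b) {X : PreForm 𝓛 𝓑 𝓑} (hX : IsHigher R X) :
    IsHigher R (homotopy ι q j (C.mc X)) :=
  ⟨isDeg_homotopy ι hj (isDeg_mc hX.deg), homotopy_vanish ι q j (vanishLE_mc hX)⟩

theorem eq_homotopy_mc (hj : ∀ b, q (j b) = b) {X : PreForm 𝓛 𝓑 𝓑} (hX : IsHigher R X)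
    (hh : homotopy ι q j X = 0) (h : actN (qHat q) X = C.mc X) :
    X = homotopy ι q j (C.mc X) := by
  rw [← h]
  exact (homotopy_actN_qHat ι hj hX.deg (isDeg_actN_qHat C hX.deg)
    (fun s => hX.vanish s 0 (by simp)) hh).symm

/-- This is the contraction estimate. The images `X'` and `Y'` are kept apart from `X` and `Y` so
that it serves both for fixed points and for successive approximations. -/
theorem vanishLE_succ_of_fixed {X Y X' Y' : PreForm 𝓛 𝓑 𝓑} (hX : IsHigher R X)
    (hY : IsHigher R Y) (hX' : X' = homotopy ι q j (C.mc X)) (hY' : Y' = homotopy ι q j (C.mc Y))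
    {n : ℕ} (h : VanishLE n (X - Y)) : VanishLE (n + 1) (X' - Y') := by
  rw [hX', hY', ← homotopy_sub]
  exact homotopy_vanish ι q j (mc_sub_mc hX hY h)

theorem eq_of_fixed {X Y : PreForm 𝓛 𝓑 𝓑} (hX : IsHigher R X)
    (hY : IsHigher R Y) (hX' : X = homotopy ι q j (C.mc X)) (hY' : Y = homotopy ι q j (C.mc Y)) :
    X = Y := by
  refine eq_of_vanishLE_sub fun n => ?_
  induction n with
  | zero => exact (hX.vanish.sub hY.vanish).mono zero_le_one
  | succ n ih => exact vanishLE_succ_of_fixed hX hY hX' hY' ih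

/-- A form which in each symmetric degree agrees with a form of order at least two has order at
least two. -/
theorem isHigher_of_forall {X : ℕ → PreForm 𝓛 𝓑 𝓑} (hX : ∀ n, IsHigher R (X n)) :
    IsHigher R (fun s m => X m.card s m) where
  deg :=
    { form := ⟨fun s t a x y m => (hX m.card).deg.form.1 s t a x y m,
        fun s t x m => (hX m.card).deg.form.2.1 s t x m, fun s a b c m => by
          simp only [Multiset.card_cons]
          exact (hX (m.card + 1)).deg.form.2.2 s a b c m⟩
      support := fun s hs => funext fun m => congrFun ((hX m.card).deg.support s hs) m }
  vanish := fun s m hm => (hX m.card).vanish s m hm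

variable (C ι q j) in
/-- The successive approximations in Fedosov's iteration. -/
def approx : ℕ → PreForm 𝓛 𝓑 𝓑
  | 0 => 0
  | n + 1 => homotopy ι q j (C.mc (approx n))

theorem isHigher_approx (hj : ∀ b, q (j b) = b) (n : ℕ) : IsHigher R (C.approx q ι j n) := by
  induction n with
  | zero => exact ⟨IsDeg.zero, fun _ _ _ => rfl⟩
  | succ n ih => exact isHigher_homotopy_mc hj ih

theorem vanishLE_approx (hj : ∀ b, q (j b) = b) (n : ℕ) :
    VanishLE (n + 1) (C.approx q ι j (n + 1) - C.approx q ι j n) := by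
  induction n with
  | zero => exact (isHigher_approx hj _).vanish.sub (isHigher_approx hj _).vanish
  | succ n ih => exact vanishLE_succ_of_fixed (isHigher_approx hj _) (isHigher_approx hj _) rfl rfl ih

/-- From the `n`-th approximation on, nothing changes in symmetric degrees up to `n + 1`. So the
limit may be read off, in degree `n`, from the `n`-th approximation. -/
theorem exists_fixed (hj : ∀ b, q (j b) = b) :
    ∃ X : PreForm 𝓛 𝓑 𝓑, IsHigher R X ∧ X = homotopy ι q j (C.mc X) := by
  set X : PreForm 𝓛 𝓑 𝓑 := fun s m => C.approx q ι j m.card s m with hX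
  have hH : IsHigher R X := isHigher_of_forall (isHigher_approx hj)
  have hle : ∀ k n, VanishLE (n + 1) (C.approx q ι j (n + k) - C.approx q ι j n) := by
    intro k
    induction k with
    | zero => intro n s m _; simp
    | succ k ih =>
      intro n
      have h := ((vanishLE_approx (C := C) (ι := ι) hj (n + k)).mono (k := n + 1) (by omega)).add (ih n)
      rwa [sub_add_sub_cancel] at h
  have happ : ∀ n, VanishLE n (X - C.approx q ι j n) := by
    intro n s m hm
    obtain ⟨k, rfl⟩ := Nat.exists_eq_add_of_le hm
    have h := hle k m.card s m (Nat.le_succ _)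
    simp only [Pi.sub_apply, sub_eq_zero] at h ⊢
    exact h.symm
  refine ⟨X, hH, eq_of_vanishLE_sub fun n => ?_⟩
  cases n with
  | zero => exact (hH.vanish.sub (isHigher_homotopy_mc hj hH).vanish).mono zero_le_one
  | succ n =>
    have h := (happ (n + 1)).sub
      (vanishLE_succ_of_fixed (C := C) (q := q) (ι := ι) (j := j) hH (isHigher_approx (C := C) (ι := ι) hj n) rfl rfl (happ n))
    have e : C.approx q ι j (n + 1) = homotopy ι q j (C.mc (C.approx q ι j n)) := rfl
    rw [e] at h
    intro s m hm
    have := h s m hm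
    simp only [Pi.sub_apply] at this ⊢
    rw [← this]
    abel

/-- The fixed point of Fedosov's iteration solves the Maurer–Cartan equation. -/
theorem mc_of_fixed (htf : ∀ x y, C.nab x (q y) - C.nab y (q x) - q (C.br x y) = 0)
    (hsep : ∀ b : 𝓑, (∀ χ : 𝓑 →ₗ[R] R, χ b = 0) → b = 0) (hj : ∀ b, q (j b) = b)
    {X : PreForm 𝓛 𝓑 𝓑} (hX : IsHigher R X) (hf : X = homotopy ι q j (C.mc X)) :
    homotopy ι q j X = 0 ∧ actN (qHat q) X = C.mc X := by
  have hmc : IsDeg R 2 (C.mc X) := isDeg_mc hX.deg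
  have hδX : IsDeg R 2 (actN (qHat q) X) := isDeg_actN_qHat C hX.deg
  have hh : homotopy ι q j X = 0 := by
    rw [hf]; exact homotopy_homotopy ι hj hmc
  refine ⟨hh, ?_⟩
  set Z := C.mc X - actN (qHat q) X with hZdef
  have hZ : IsDeg R 2 Z := hmc.sub hδX
  have hZh : homotopy ι q j Z = 0 := by
    rw [hZdef, homotopy_sub, ← hf, homotopy_actN_qHat ι hj hX.deg hδX
      (fun s => hX.vanish s 0 (by simp)) hh, sub_self]
  -- Bianchi identity: with `U = Q² χ = χ ∘ Z`, one has `Q U = Z·(Q χ)`. In symmetric degrees up to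
  -- `n` the right side, `dU` and `X·U` vanish, so `δU = χ ∘ δZ` vanishes too.
  have hstep : ∀ n, VanishLE n Z → VanishLE n (actN (qHat q) Z) := by
    intro n hn s m hm
    refine hsep _ fun χ => ?_
    have hT := linForm_mem_form (𝓛 := 𝓛) χ
    have hQT := fedosovOp_mem_form (C := C) (q := q) hX hT
    set U : PreForm 𝓛 𝓑 R := actN Z (linForm χ) with hU
    have hU2 : C.fedosovOp q X (C.fedosovOp q X (linForm χ)) = U := fedosovOp_sq htf hX hT
    have hUF : U ∈ Form R 𝓛 𝓑 R := hU2 ▸ fedosovOp_mem_form hX hQT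
    have hUχ : U = fun s m => χ (Z s m) := by
      funext s m; exact actN_linForm Z χ s m
    have hUn : VanishLE n U := by
      intro s m hm
      rw [hUχ]
      simp [hn s m hm]
    have h1 : C.fedosovOp q X U = actN Z (C.fedosovOp q X (linForm χ)) := by
      rw [← hU2]; exact fedosovOp_sq htf hX hQT
    have h2 := congrFun (congrFun h1 s) m
    rw [vanishLE_actN_left (R := R) hn (Form.symLin hQT) s m hm, fedosovOp,
      actN_sub_left (R := R) _ _ (Form.symLin hUF)] at h2
    simp only [Pi.add_apply, Pi.sub_apply] at h2
    rw [C.vanishLE_d _ hUn s m hm, vanishLE_actN_right (R := R) (hX.vanish.mono zero_le_one)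
      (Form.symLin hUF) hUn s m hm, zero_add, zero_sub, neg_eq_zero, hUχ, actN_comp] at h2
    exact h2
  -- In degree `0`, `δX` vanishes because `X` has no part of degree one. In the induction step,
  -- closedness in degree `n` forces vanishing in degree `n + 1`.
  have hzero : ∀ n, VanishLE n Z := by
    intro n
    induction n with
    | zero =>
      refine (vanishLE_mc hX).sub fun s m hm => ?_
      obtain rfl : m = 0 := Multiset.card_eq_zero.1 (Nat.le_zero.1 hm)
      by_cases hs : s.length = 2
      · obtain ⟨x, y, rfl⟩ := List.length_eq_two.1 hs
        rw [actN_qHat_two hX.deg.form, hX.vanish _ _ (by simp), hX.vanish _ _ (by simp), sub_zero]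
      · rw [hδX.support s hs]; rfl
    | succ n ih =>
      intro s m hm
      rcases Nat.lt_or_ge m.card (n + 1) with h | h
      · exact ih s m (by omega)
      by_cases hs : s.length = 2
      · obtain ⟨x, y, rfl⟩ := List.length_eq_two.1 hs
        exact eq_zero_of_closed ι hj hZ hZh (n := n) (fun s m hm => hstep n ih s m hm.le) x y m
          (by omega)
      · rw [hZ.support s hs]; rfl
  symm
  rw [← sub_eq_zero]
  exact funext fun s => funext fun m => hzero m.card s m le_rfl

/-- Existence and uniqueness in Fedosov's construction. -/
theorem existsUnique_fedosov (htf : ∀ x y, C.nab x (q y) - C.nab y (q x) - q (C.br x y) = 0)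
    (hsep : ∀ b : 𝓑, (∀ χ : 𝓑 →ₗ[R] R, χ b = 0) → b = 0) (hj : ∀ b, q (j b) = b) :
    ∃! X : PreForm 𝓛 𝓑 𝓑, IsHigher R X ∧ homotopy ι q j X = 0 ∧
      ∀ F ∈ Form R 𝓛 𝓑 R, C.fedosovOp q X (C.fedosovOp q X F) = 0 := by
  obtain ⟨X, hX, hf⟩ := exists_fixed (C := C) (ι := ι) hj
  obtain ⟨h1, h2⟩ := mc_of_fixed htf hsep hj hX hf
  refine ⟨X, ⟨hX, h1, (fedosovOp_sq_eq_zero_iff htf hsep hX).2 h2⟩, ?_⟩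
  rintro Y ⟨hY, hY1, hY2⟩
  exact eq_of_fixed hY hX
    (eq_homotopy_mc hj hY hY1 ((fedosovOp_sq_eq_zero_iff htf hsep hY).1 hY2)) hf

theorem symComponent_curv : symComponent 1 C.curv = C.curv := by
  funext s m
  by_cases hm : m.card = 1
  · simp [symComponent, hm]
  · rw [symComponent, if_neg hm]
    by_cases hs : s.length = 2
    · obtain ⟨x, y, rfl⟩ := List.length_eq_two.1 hs
      simp [curv, twoForm, atOne, hm]
    · rw [C.isDeg_curv.support s hs]; rfl

theorem mc_symComponent_one {X : PreForm 𝓛 𝓑 𝓑} (hX : IsHigher R X) :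
    symComponent 1 (C.mc X) = C.curv := by
  funext s m
  conv_rhs => rw [← symComponent_curv (C := C)]
  by_cases hm : m.card = 1
  · simp only [symComponent, hm, if_true, mc, add_assoc]
    rw [Pi.add_apply, Pi.add_apply, mc_sub_curv hX s m hm.le, add_zero]
  · simp [symComponent, hm]

/-- The curvature lives in degree one, `d` preserves the degree and the quadratic term splits by
`symComponent_actN`; this is the argument of `h̃` in the recursion. -/
theorem mc_symComponent {X : PreForm 𝓛 𝓑 𝓑} (hX : IsHigher R X) {n : ℕ} (hn : 2 ≤ n) :
    symComponent n (C.mc X) = C.d C.nab (symComponent n X) +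
      ∑ p ∈ Finset.Icc 2 (n - 1), actN (symComponent p X) (symComponent (n + 1 - p) X) := by
  rw [← symComponent_d, ← symComponent_actN (R := R) n (Form.symLin hX.deg.form) hX.vanish hX.vanish]
  funext s m
  by_cases hm : m.card = n
  · have h : C.curv s m = 0 := by
      rw [← symComponent_curv, symComponent, if_neg (by omega)]
    simp [symComponent, hm, mc, h]
  · simp [symComponent, hm]

/-- Only the anticommutators of the `X_p` are known to act as derivations. The index set is
invariant under `p ↦ n + 1 - p`, so twice the sum is a sum of anticommutators, to which
`actN_actN_add` applies. -/
theorem sum_actN_actN (h2 : ∀ r : R, r + r = 0 → r = 0) (C : LieConnection R 𝓛 𝓑)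
    {X : PreForm 𝓛 𝓑 𝓑} (hX : IsHigher R X) (n : ℕ) {F : PreForm 𝓛 𝓑 R}
    (hF : F ∈ Form R 𝓛 𝓑 R) :
    ∑ p ∈ Finset.Icc 2 (n - 1), actN (symComponent p X) (actN (symComponent (n + 1 - p) X) F) =
      actN (∑ p ∈ Finset.Icc 2 (n - 1), actN (symComponent p X) (symComponent (n + 1 - p) X)) F := by
  have hd : ∀ p, IsDeg R 1 (symComponent p X) := fun p => isDeg_symComponent p hX.deg
  have hsum : ∀ (S : Finset ℕ) (Y : ℕ → PreForm 𝓛 𝓑 𝓑),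
      actN (∑ p ∈ S, Y p) F = ∑ p ∈ S, actN (Y p) F := by
    intro S Y
    classical
    induction S using Finset.induction with
    | empty => simp [actN_zero_left (R := R) (Form.symLin hF)]
    | insert a S ha ih =>
      rw [Finset.sum_insert ha, Finset.sum_insert ha,
        actN_add_left (R := R) _ _ (Form.symLin hF), ih]
  have hrefl : ∀ {P : Type _} [AddCommGroup P] (g : ℕ → ℕ → P),
      ∑ p ∈ Finset.Icc 2 (n - 1), g p (n + 1 - p) = ∑ p ∈ Finset.Icc 2 (n - 1), g (n + 1 - p) p := by
    intro P _ g
    refine Finset.sum_nbij' (fun p => n + 1 - p) (fun p => n + 1 - p) ?_ ?_ ?_ ?_ ?_ <;>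
      intro p hp <;> simp only [Finset.mem_Icc] at hp ⊢
    · omega
    · omega
    · omega
    · omega
    · congr 1; omega
  rw [hsum]
  set a := ∑ p ∈ Finset.Icc 2 (n - 1), actN (symComponent p X) (actN (symComponent (n + 1 - p) X) F)
    with ha
  set b := ∑ p ∈ Finset.Icc 2 (n - 1), actN (actN (symComponent p X) (symComponent (n + 1 - p) X)) F
    with hb
  have h : a + a = b + b := by
    nth_rewrite 2 [ha, hb]
    rw [hrefl (fun p r => actN (symComponent p X) (actN (symComponent r X) F)),
      hrefl (fun p r => actN (actN (symComponent p X) (symComponent r X)) F), ha, hb,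
      ← Finset.sum_add_distrib, ← Finset.sum_add_distrib]
    exact Finset.sum_congr rfl fun p _ => actN_actN_add C h2 (hd _) (hd _) hF
  rw [← sub_eq_zero]
  funext s m
  refine h2 _ ?_
  have := congrFun (congrFun h s) m
  simp only [Pi.add_apply, Pi.sub_apply] at this ⊢
  linear_combination this

end LieConnection

end Main

/-! ### The homological vector field and the recursion -/

section Conclusions

namespace LieConnection

variable {R 𝓛 𝓑 : Type*} [CommRing R] [AddCommGroup 𝓛] [Module R 𝓛] [AddCommGroup 𝓑] [Module R 𝓑]
  {C : LieConnection R 𝓛 𝓑} {q : 𝓛 →ₗ[R] 𝓑} {K : Type*} [Field K] {ι : K →+* R}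

theorem isHigher_iff {X : PreForm 𝓛 𝓑 𝓑} :
    X ∈ FormIn R 𝓛 𝓑 𝓑 (fun k p => k = 1 ∧ 2 ≤ p) ↔ IsHigher R X := by
  constructor
  · rintro ⟨h1, h2⟩
    exact ⟨⟨h1, fun s hs => funext fun m => h2 s m fun h => hs h.1⟩,
      fun s m hm => h2 s m fun h => by omega⟩
  · rintro ⟨⟨h1, h2⟩, h3⟩
    refine ⟨h1, fun s m h => ?_⟩
    by_cases hs : s.length = 1
    · exact h3 s m (by by_contra hm; exact h ⟨hs, by omega⟩)
    · rw [h2 s hs]; rfl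

theorem isDeg_iff {N : Type*} [AddCommGroup N] [Module R N] {F : PreForm 𝓛 𝓑 N} {n : ℕ} :
    F ∈ FormIn R 𝓛 𝓑 N (fun k _ => k = n) ↔ IsDeg R n F :=
  ⟨fun h => ⟨h.1, fun s hs => funext fun m => h.2 s m hs⟩,
    fun h => ⟨h.form, fun s m hs => by rw [h.support s hs]; rfl⟩⟩

/-- The operator `-δ + d + X` is a homological vector field as soon as its square vanishes. -/
theorem isHomologicalVectorField {X : PreForm 𝓛 𝓑 𝓑} (hX : IsHigher R X)
    (hι : ∀ l c, C.ρ l (ι c) = 0) {Q : PreForm 𝓛 𝓑 R → PreForm 𝓛 𝓑 R}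
    (hQ : ∀ F ∈ Form R 𝓛 𝓑 R, Q F = C.fedosovOp q X F)
    (hsq : ∀ F ∈ Form R 𝓛 𝓑 R, Q (Q F) = 0) : IsHomologicalVectorField ι Q := by
  have hconn := C.isCov_ρ.isConn_vert (hX.isDeg_sub (q := q)).form
  set A : 𝓛 → (Multiset 𝓑 → R) →+ (Multiset 𝓑 → R) :=
    fun l => cov (C.ρ l) (C.nab l) + vert ((X - qHat q) [l]) with hA
  -- As one Cartan differential with derivations `A l` on the values, `Q` inherits additivity and
  -- the Leibniz rule from the general calculus.
  have hQ' : ∀ F ∈ Form R 𝓛 𝓑 R, Q F = ce A C.br F := fun F hF => by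
    rw [hQ F hF, hA, ce_add_vert _ _ (hX.isDeg_sub (q := q)).support hF]; rfl
  have hder : ∀ l f g, A l (star f g) = star (A l f) g + star f (A l g) := by
    intro l f g
    simp only [hA, AddMonoidHom.add_apply, cov_star (C.ρ_mul l), vert_star, star_add_left,
      star_add_right]
    abel
  refine ⟨fun F hF => ?_, fun F hF G hG => ?_, fun c F hF => ?_, fun k F hF => ?_,
    fun k F hF G hG => ?_, hsq⟩
  · rw [hQ F hF]; exact fedosovOp_mem_form hX hF
  · rw [hQ' _ (add_mem hF hG), hQ' _ hF, hQ' _ hG, ce_add]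
  · rw [hQ' _ (Submodule.smul_mem _ _ hF), hQ' _ hF, hconn.ce_smul,
      wedge_zero_left fun l => hι l c, add_zero]
  · rw [isDeg_iff] at hF ⊢
    rw [hQ _ hF.form]
    exact (C.isCov_ρ.isDeg_d hF).add (C.isCov_ρ.isDeg_actN hX.isDeg_sub hF)
  · rw [isDeg_iff] at hF
    rw [hQ' _ hF.form, hQ' _ hG, mul_eq, mul_eq, mul_eq, hQ' _ (mulStar_mem_form hF.form hG),
      ce_mulStar hder, sgn_of_support hF.support]
    rcases neg_one_pow_eq_or ℤ k with h | h <;> simp [h, mulStar_neg_left]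

variable {j : 𝓑 →ₗ[R] 𝓛} [CharZero K]

/-- The homotopy sends the part of `mc X` of degree `n` to the part of `X` of degree `n + 1`, so the
witnesses are the symmetric components of `mc X`. -/
theorem isFedosovIteration {X : PreForm 𝓛 𝓑 𝓑} (hX : IsHigher R X)
    (hf : X = homotopy ι q j (C.mc X)) {d : PreForm 𝓛 𝓑 R → PreForm 𝓛 𝓑 R}
    (hd : ∀ F ∈ Form R 𝓛 𝓑 R, d F = C.d C.ρ F) :
    IsFedosovIteration d (homotopy ι q j) X := by
  have h2 : ∀ r : R, r + r = 0 → r = 0 := fun r hr =>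
    eq_zero_of_nsmul (R := R) ι two_ne_zero (by rw [two_nsmul, hr])
  have hY : ∀ n, symComponent (n + 1) X = homotopy ι q j (symComponent n (C.mc X)) := by
    intro n
    rw [homotopy_symComponent, ← hf]
  have hmem : ∀ n, symComponent n (C.mc X) ∈ FormIn R 𝓛 𝓑 𝓑 (fun k p => k = 2 ∧ p = n) := by
    intro n
    have h := isDeg_symComponent n (isDeg_mc (C := C) hX.deg)
    refine ⟨h.form, fun s m hs => ?_⟩
    by_cases h1 : s.length = 2
    · exact if_neg fun h => hs ⟨h1, h⟩
    · rw [h.support s h1]; rfl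
  refine ⟨isHigher_iff.2 hX, ⟨_, hmem 1, fun F hF => ?_, hY 1⟩, fun n hn =>
    ⟨_, hmem n, fun F hF => ?_, hY n⟩⟩
  · change act _ F = d (d F)
    rw [hd F hF, hd _ (C.isCov_ρ.d_mem_form hF), d_d hF, act_eq, mc_symComponent_one hX]
  · have hn1 := isDeg_symComponent n hX.deg
    simp only [act_eq]
    rw [hd F hF, hd _ (C.isCov_ρ.actN_mem_form hn1 hF), sum_actN_actN h2 C hX n hF,
      d_actN_add h2 hn1 hF, mc_symComponent hX hn, actN_add_left (R := R) _ _ (Form.symLin hF)]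

end LieConnection

end Conclusions

/-! ## Lie pairs -/

section Geometry

variable {𝕜 : Type*} [RCLike 𝕜]
  {E : Type*} [NormedAddCommGroup E] [NormedSpace ℝ E]
  {M : Type*} [TopologicalSpace M] [ChartedSpace E M]

theorem dirDeriv_tmul (f : M → 𝕜) (x : M) (c : 𝕜) (v : TangentSpace 𝓘(ℝ, E) x) :
    dirDeriv f x (c ⊗ₜ[ℝ] v) =
      c * (show TangentSpace 𝓘(ℝ, E) x →L[ℝ] 𝕜 from mfderiv 𝓘(ℝ, E) 𝓘(ℝ, 𝕜) f x) v := by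
  rw [dirDeriv, LinearMap.liftBaseChange_tmul]
  rfl

theorem Fn.mdifferentiableAt (f : Fn 𝕜 E M) (x : M) :
    MDifferentiableAt 𝓘(ℝ, E) 𝓘(ℝ, 𝕜) f x :=
  f.contMDiff.contMDiffAt.mdifferentiableAt (by simp)

theorem dirDeriv_add (f g : Fn 𝕜 E M) (x : M) (v : 𝕜 ⊗[ℝ] TangentSpace 𝓘(ℝ, E) x) :
    dirDeriv (f + g : Fn 𝕜 E M) x v = dirDeriv f x v + dirDeriv g x v := by
  induction v using TensorProduct.induction_on with
  | zero => simp
  | tmul c v =>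
    have h := ((Fn.mdifferentiableAt f x).hasMFDerivAt.add
      (Fn.mdifferentiableAt g x).hasMFDerivAt).mfderiv
    rw [dirDeriv_tmul, dirDeriv_tmul, dirDeriv_tmul, ← mul_add]
    congr 1
    exact congrArg (fun T : E →L[ℝ] 𝕜 => T v) h
  | add v w hv hw => rw [map_add, map_add, map_add, hv, hw]; ring

theorem dirDeriv_mul (f g : Fn 𝕜 E M) (x : M) (v : 𝕜 ⊗[ℝ] TangentSpace 𝓘(ℝ, E) x) :
    dirDeriv (f * g : Fn 𝕜 E M) x v = dirDeriv f x v * g x + f x * dirDeriv g x v := by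
  induction v using TensorProduct.induction_on with
  | zero => simp
  | tmul c v =>
    have h := ((Fn.mdifferentiableAt f x).hasMFDerivAt.mul
      (Fn.mdifferentiableAt g x).hasMFDerivAt).mfderiv
    have h' := congrArg (fun T : E →L[ℝ] 𝕜 => T v) h
    rw [dirDeriv_tmul, dirDeriv_tmul, dirDeriv_tmul]
    refine (congrArg (c * ·) h').trans ?_
    have key : ∀ a b : 𝕜, c * (f x * a + g x * b) = c * b * g x + f x * (c * a) :=
      fun a b => by ring
    exact key _ _
  | add v w hv hw => rw [map_add, map_add, map_add, hv, hw]; ring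

theorem dirDeriv_const (c : 𝕜) (x : M) (v : 𝕜 ⊗[ℝ] TangentSpace 𝓘(ℝ, E) x) :
    dirDeriv (constFn 𝕜 E M c : Fn 𝕜 E M) x v = 0 := by
  induction v using TensorProduct.induction_on with
  | zero => simp
  | tmul a v =>
    rw [dirDeriv_tmul]
    have h : mfderiv 𝓘(ℝ, E) 𝓘(ℝ, 𝕜) (constFn 𝕜 E M c : Fn 𝕜 E M) x = 0 :=
      mfderiv_const
    refine (congrArg (fun T : E →L[ℝ] 𝕜 => a * T v) h).trans ?_
    exact mul_zero a
  | add v w hv hw => rw [map_add, hv, hw, add_zero]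

variable
  {F : Type*} [NormedAddCommGroup F] [NormedSpace ℝ F] [NormedSpace 𝕜 F] [IsScalarTower ℝ 𝕜 F]
  {L : M → Type*} [TopologicalSpace (Bundle.TotalSpace F L)] [∀ x, TopologicalSpace (L x)]
  [∀ x, AddCommGroup (L x)] [∀ x, Module 𝕜 (L x)] [FiberBundle F L] [VectorBundle 𝕜 F L]
  [∀ x, Module ℝ (L x)] [VectorBundle ℝ F L]

/-! ### Separation of sections by functionals -/

section Separation

variable [FiniteDimensional ℝ E] [IsManifold 𝓘(ℝ, E) ∞ M] [T2Space M]
  [ContMDiffVectorBundle ∞ F L 𝓘(ℝ, E)]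

/-- A continuous functional on the fibre in a local trivialization, cut off by a bump function, as
a `C^∞`-linear functional on sections. -/
def localFunctional (x₀ : M) (f : SmoothBumpFunction 𝓘(ℝ, E) x₀)
    (hf : tsupport f ⊆ (trivializationAt F L x₀).baseSet) (φ : F →L[𝕜] 𝕜) :
    Sec E F L →ₗ[Fn 𝕜 E M] Fn 𝕜 E M where
  toFun s := ⟨fun x => f x • φ (trivializationAt F L x₀ ⟨x, s x⟩).2, by
    -- Smoothness only matters on the support of the product, which lies in the domain of the
    -- trivialization.
    refine contMDiff_of_tsupport fun x hx => ?_
    have hb : x ∈ (trivializationAt F L x₀).baseSet :=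
      hf (tsupport_smul_subset_left (f : M → ℝ)
        (fun x => φ (trivializationAt F L x₀ ⟨x, s x⟩).2) hx)
    have hs := ((trivializationAt F L x₀).contMDiffAt_section_iff (IB := 𝓘(ℝ, E)) (s := s) hb).1
      (s.contMDiff x)
    exact f.contMDiffAt.smul
      ((φ.restrictScalars ℝ).contDiff.contMDiff.contMDiffAt.comp x hs)⟩
  map_add' s t := by
    ext x
    by_cases hb : x ∈ (trivializationAt F L x₀).baseSet
    · have h := ((trivializationAt F L x₀).linear 𝕜 hb).1 (s x) (t x)
      change f x • φ (trivializationAt F L x₀ ⟨x, s x + t x⟩).2 =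
        f x • φ (trivializationAt F L x₀ ⟨x, s x⟩).2 + f x • φ (trivializationAt F L x₀ ⟨x, t x⟩).2
      rw [h, map_add, smul_add]
    · have h0 : f x = 0 := image_eq_zero_of_notMem_tsupport fun h => hb (hf h)
      change f x • (_ : 𝕜) = f x • (_ : 𝕜) + f x • (_ : 𝕜)
      simp [h0]
  map_smul' a s := by
    ext x
    by_cases hb : x ∈ (trivializationAt F L x₀).baseSet
    · have h := ((trivializationAt F L x₀).linear 𝕜 hb).2 (a x) (s x)
      change f x • φ (trivializationAt F L x₀ ⟨x, a x • s x⟩).2 =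
        a x * (f x • φ (trivializationAt F L x₀ ⟨x, s x⟩).2)
      rw [h, map_smul, smul_eq_mul, mul_smul_comm]
    · have h0 : f x = 0 := image_eq_zero_of_notMem_tsupport fun h => hb (hf h)
      change f x • (_ : 𝕜) = a x * (f x • (_ : 𝕜))
      simp [h0]

/-- The `C^∞`-linear functionals separate the sections of a vector bundle. -/
theorem Sec.eq_zero_of_forall_functional (s : Sec E F L)
    (h : ∀ χ : Sec E F L →ₗ[Fn 𝕜 E M] Fn 𝕜 E M, χ s = 0) : s = 0 := by
  ext x₀
  by_contra hs
  have hb := FiberBundle.mem_baseSet_trivializationAt F L x₀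
  have hne : (trivializationAt F L x₀ ⟨x₀, s x₀⟩).2 ≠ 0 := by
    intro h0
    refine hs ?_
    have h1 : (trivializationAt F L x₀).linearEquivAt 𝕜 x₀ hb (s x₀) = 0 := h0
    exact ((trivializationAt F L x₀).linearEquivAt 𝕜 x₀ hb).map_eq_zero_iff.1 h1
  obtain ⟨φ, hφ⟩ := SeparatingDual.exists_ne_zero (R := 𝕜) hne
  obtain ⟨f, -, hf⟩ := (SmoothBumpFunction.nhds_basis_tsupport (I := 𝓘(ℝ, E)) x₀).mem_iff.1
    ((trivializationAt F L x₀).open_baseSet.mem_nhds hb)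
  have h1 : f x₀ • φ (trivializationAt F L x₀ ⟨x₀, s x₀⟩).2 = 0 :=
    congrArg (fun g : Fn 𝕜 E M => g x₀) (h (localFunctional x₀ f hf φ))
  rw [f.eq_one, one_smul] at h1
  exact hφ h1

end Separation

variable {LA : LieAlgebroid 𝕜 E F L} {A : LieSubalgebroid LA}

theorem LieAlgebroid.rho_const (LA : LieAlgebroid 𝕜 E F L) (s : Sec E F L) (c : 𝕜) :
    LA.rho s (constFn 𝕜 E M c) = 0 := by
  ext x; exact dirDeriv_const c x _

/-- The algebraic data of a connection on the quotient of a Lie pair. -/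
def QuotConnection.toLieConnection (nab : QuotConnection A) :
    LieConnection (Fn 𝕜 E M) (Sec E F L) A.QuotSec where
  ρ s := AddMonoidHom.mk' (LA.rho s) fun f g => by ext x; exact dirDeriv_add f g x _
  br := LA.bracket
  nab l := AddMonoidHom.mk' (nab.cov l) (nab.cov_add l)
  ρ_lin a s t f := by
    ext x
    change dirDeriv f x (LA.anchor x (a x • s x + t x)) =
      a x * dirDeriv f x (LA.anchor x (s x)) + dirDeriv f x (LA.anchor x (t x))
    rw [map_add, map_add, map_smul, map_smul, smul_eq_mul]
  ρ_mul s f g := by ext x; exact dirDeriv_mul f g x _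
  ρ_br s t f := by ext x; exact LA.anchor_bracket s t f x
  br_add := LA.bracket_add
  add_br := LA.add_bracket
  br_smul s f t := by ext x; exact LA.leibniz s t f x
  br_self := LA.bracket_self
  jacobi := LA.jacobi
  nab_lin a s t b := by
    change nab.cov _ _ = _
    rw [nab.add_cov, nab.smul_cov]; rfl
  nab_smul s f b := by
    change nab.cov _ _ = _
    rw [nab.leibniz, add_comm]; rfl

/-- The explicit sums that define `δ`, `d` and the action agree with their Cartan-type versions on
genuine forms. -/
theorem QuotConnection.Q_eq (nab : QuotConnection A)
    {X : PreForm (Sec E F L) A.QuotSec A.QuotSec}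
    {G : PreForm (Sec E F L) A.QuotSec (Fn 𝕜 E M)}
    (hG : G ∈ Form (Fn 𝕜 E M) (Sec E F L) A.QuotSec (Fn 𝕜 E M)) :
    nab.Q X G = nab.toLieConnection.fedosovOp A.q X G := by
  have h1 : nab.d G = nab.toLieConnection.d nab.toLieConnection.ρ G :=
    dCE_eq nab.toLieConnection.ρ LA.bracket nab.cov hG
  have h2 : delta A.q G = actN (qHat A.q) G :=
    delta_eq A.q (isDeg_qHat A.q).support (fun _ => rfl) hG
  rw [QuotConnection.Q, h1, h2, act_eq, LieConnection.fedosovOp,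
    actN_sub_left (R := Fn 𝕜 E M) _ _ (Form.symLin hG)]
  abel

end Geometry

end Fedosov

end

theorem mainTheorem4 {𝕜 : Type*} [RCLike 𝕜]
    {E : Type*} [NormedAddCommGroup E] [NormedSpace ℝ E] [FiniteDimensional ℝ E]
    {M : Type*} [TopologicalSpace M] [ChartedSpace E M] [IsManifold 𝓘(ℝ, E) ∞ M]
    [T2Space M] [SigmaCompactSpace M]
    {F : Type*} [NormedAddCommGroup F] [NormedSpace ℝ F] [NormedSpace 𝕜 F] [IsScalarTower ℝ 𝕜 F]
    [FiniteDimensional 𝕜 F]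
    {L : M → Type*} [TopologicalSpace (Bundle.TotalSpace F L)] [∀ x, TopologicalSpace (L x)]
    [∀ x, AddCommGroup (L x)] [∀ x, Module ℝ (L x)] [∀ x, Module 𝕜 (L x)]
    [∀ x, IsScalarTower ℝ 𝕜 (L x)]
    [FiberBundle F L] [VectorBundle ℝ F L] [VectorBundle 𝕜 F L]
    [ContMDiffVectorBundle ∞ F L 𝓘(ℝ, E)]
    (LA : Fedosov.LieAlgebroid 𝕜 E F L) (A : Fedosov.LieSubalgebroid LA)
    (j : A.QuotSec →ₗ[Fedosov.Fn 𝕜 E M] Fedosov.Sec E F L) (hj : ∀ b, A.q (j b) = b)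
    (nab : Fedosov.QuotConnection A) (hBott : nab.ExtendsBott) (hTors : nab.IsTorsionFree) :
    (∃! X : Fedosov.PreForm (Fedosov.Sec E F L) A.QuotSec A.QuotSec,
      X ∈ Fedosov.FormIn (Fedosov.Fn 𝕜 E M) (Fedosov.Sec E F L) A.QuotSec A.QuotSec
        (fun k p => k = 1 ∧ 2 ≤ p) ∧
      Fedosov.hTilde j X = 0 ∧
      ∀ G ∈ Fedosov.Form (Fedosov.Fn 𝕜 E M) (Fedosov.Sec E F L) A.QuotSec (Fedosov.Fn 𝕜 E M),
        nab.Q X (nab.Q X G) = 0) ∧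
    (∀ X : Fedosov.PreForm (Fedosov.Sec E F L) A.QuotSec A.QuotSec,
      X ∈ Fedosov.FormIn (Fedosov.Fn 𝕜 E M) (Fedosov.Sec E F L) A.QuotSec A.QuotSec
        (fun k p => k = 1 ∧ 2 ≤ p) →
      Fedosov.hTilde j X = 0 →
      (∀ G ∈ Fedosov.Form (Fedosov.Fn 𝕜 E M) (Fedosov.Sec E F L) A.QuotSec (Fedosov.Fn 𝕜 E M),
        nab.Q X (nab.Q X G) = 0) →
      Fedosov.IsHomologicalVectorField (Fedosov.constFn 𝕜 E M) (nab.Q X) ∧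
      Fedosov.IsFedosovIteration nab.d (Fedosov.hTilde j) X) := by
  have hsep : ∀ b : A.QuotSec,
      (∀ χ : A.QuotSec →ₗ[Fedosov.Fn 𝕜 E M] Fedosov.Fn 𝕜 E M, χ b = 0) → b = 0 := by
    intro b h
    -- The splitting embeds the sections of `B` into those of `L`, so functionals on `Γ(L)` pulled
    -- back along `j` suffice.
    have hjb : j b = 0 := Fedosov.Sec.eq_zero_of_forall_functional (𝕜 := 𝕜) (j b) fun χ =>
      h (χ ∘ₗ j)
    rw [← hj b, hjb, map_zero]
  have htf : ∀ x y, nab.toLieConnection.nab x (A.q y) - nab.toLieConnection.nab y (A.q x) -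
      A.q (nab.toLieConnection.br x y) = 0 := hTors
  have hQ : ∀ X : Fedosov.PreForm (Fedosov.Sec E F L) A.QuotSec A.QuotSec,
      Fedosov.LieConnection.IsHigher (Fedosov.Fn 𝕜 E M) X →
      ∀ G ∈ Fedosov.Form (Fedosov.Fn 𝕜 E M) (Fedosov.Sec E F L) A.QuotSec (Fedosov.Fn 𝕜 E M),
        nab.Q X (nab.Q X G) =
          nab.toLieConnection.fedosovOp A.q X (nab.toLieConnection.fedosovOp A.q X G) := by
    intro X hX G hG
    rw [nab.Q_eq hG, nab.Q_eq (Fedosov.LieConnection.fedosovOp_mem_form hX hG)]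
  refine ⟨?_, fun X hX hh hsq => ?_⟩
  · obtain ⟨X, ⟨h1, h2, h3⟩, h4⟩ := Fedosov.LieConnection.existsUnique_fedosov
      (ι := Fedosov.constFn 𝕜 E M) htf hsep hj
    refine ⟨X, ⟨Fedosov.LieConnection.isHigher_iff.2 h1, h2, fun G hG => ?_⟩, ?_⟩
    · rw [hQ X h1 G hG, h3 G hG]
    · rintro Y ⟨k1, k2, k3⟩
      have k1' := Fedosov.LieConnection.isHigher_iff.1 k1
      exact h4 Y ⟨k1', k2, fun G hG => by rw [← hQ Y k1' G hG, k3 G hG]⟩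
  · rw [Fedosov.LieConnection.isHigher_iff] at hX
    refine ⟨Fedosov.LieConnection.isHomologicalVectorField hX
      (C := nab.toLieConnection) (fun l c => LA.rho_const l c) (fun G hG => nab.Q_eq hG) hsq, ?_⟩
    refine Fedosov.LieConnection.isFedosovIteration (C := nab.toLieConnection) (q := A.q) hX ?_
      fun G hG => Fedosov.dCE_eq nab.toLieConnection.ρ LA.bracket nab.cov hG
    refine Fedosov.LieConnection.eq_homotopy_mc hj hX hh
      ((Fedosov.LieConnection.fedosovOp_sq_eq_zero_iff htf hsep hX).1 fun G hG => ?_)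
    rw [← hQ X hX G hG, hsq G hG]
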